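/- **Setting.** Let $q\in\mathbb C^\times$ with $|q|\neq 1$, fix $\ell\in\mathbb C$ with $e^\ell=q$, write $q^x:=e^{\ell x}$ and $\tau=\ell/(2\pi i)$. Let $N\ge 1$, $\epsilon\in\{1,-1\}$, $r\in\mathbb Z$. *The algebra $\widehat{\mathscr S}$.* Let $\mathscr S_{q,N}$ be the associative algebra with basis $z^kT_q^nE_{i,j}$ ($k,n\in\mathbb Z$, $1\le i,j\le N$) and product $(z^kT_q^nA)(z^{k'}T_q^{n'}B)=q^{nk'}z^{k+k'}T_q^{n+n'}AB$, and let $\sigma$ be its anti-involution $\sigma(z^kT_q^nE_{i,j})=\epsilon^kq^{k(k-1)r/2}\,z^k(q^{1-k}T_q^{-1})^nT_q^{kr}E_{N+1-j,N+1-i}$. Let $\mathscr S=\{x:\sigma(x)=-x\}$ with the commutator bracket, and let $\widehat{\mathscr S}=\mathscr S\oplus\mathbb C C$ be its central extension by the cocycle $\psi(z^kf(T_q)A,z^{k'}g(T_q)B)=\delta_{k,-k'}\,k\,\mathrm{tr}_0\big(f(q^{-k}T_q)g(T_q)\big)\mathrm{tr}(AB)$, where $\mathrm{tr}_0$ is the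 constant coefficient of a Laurent polynomial. *The target algebras.* For $m\ge0$ let $R_m=\mathbb C[u]/(u^{m+1})$; let $g\ell_\infty^{[m]}$ be the Lie algebra of matrices $(a_{i,j}(u))_{i,j\in\mathbb Z}$ over $R_m$ with finitely many nonzero diagonals and $\widehat{g\ell}{}_\infty^{[m]}=g\ell_\infty^{[m]}\oplus R_m$ its central extension by the cocycle $\mathrm{Tr}([J,A]B)$, $J=\sum_{i\le0}E_{i,i}$, graded by $\deg E_{i,j}=j-i$, $\deg R_m=0$. Let $\tilde b_\infty^{[m]}$, $b_\infty^{[m]}$, $d_\infty^{[m]}$, $c_\infty^{[m]}$ be the graded subalgebras $\{\dots\}\oplus R_m$ of $\widehat{g\ell}{}_\infty^{[m]}$ given respectively by $a_{i,j}(u)=-a_{-j,-i}(-u)$, $a_{i,j}(u)=-(-1)^{i+j}a_{-j,-i}(-u)$, $a_{i,j}(u)=-a_{1-j,1-i}(-u)$, $a_{i,j}(u)=-(-1)^{i+j}a_{1-j,1-i}(-u)$. For $a\in\mathbb C$ let $\mathfrak g_a^{[m]}$ be: for $a=1$, $d_\infty^{[m]}$ if $\epsilon=1$ and $c_\infty^{[m]}$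 if $\epsilon=-1$; for $a=1/2$, $d_\infty^{[m]}$ if $N$ is even, and, if $N$ is odd, $\tilde b_\infty^{[m]}$ for $\epsilon=1$, $b_\infty^{[m]}$ for $\epsilon=-1$; for all other $a$, $\widehat{g\ell}{}_\infty^{[m]}$. *The homomorphism.* Define $\hat\varphi_a:\widehat{\mathscr S}\to\widehat{g\ell}{}_\infty^{[m]}$ as the restriction of the linear map with $C\mapsto 1\in R_m$ and $$z^kT_q^nE_{i,j}\mapsto\sum_{l\in\mathbb Z}q^{n(a-l+u)}E_{(l-k)N-i+1,\,lN-j+1}+\kappa,$$ where $q^{n(b+u)}=e^{n\ell b}\sum_{p=0}^m\frac{(n\ell u)^p}{p!}$ and $\kappa=\frac{q^{n(a+u)}}{1-q^n}\in R_m$ if $k=0$, $n\ne0$, $i=j$, and $\kappa=0$ otherwise. This is a Lie algebra homomorphism. Put $\varphi_a=\hat\varphi_a$ if $a\notin\{1,1/2\}$. If $a\in\{1,1/2\}$, put $\varphi_a=D\circ S\circ\hat\varphi_a$. Here, with $c=0$ if $a=1$ and $c=\lfloor N/2\rfloor$ if $a=1/2$, $S$ is the automorphism $E_{i,j}\mapsto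 E_{i+c,j+c}$ lifted to the central extension by $S(A,\zeta)=\big((A_{i-c,j-c})_{i,j},\ \zeta-\sum_{-c<p\le0}A_{p,p}\big)$. And $D$ is conjugation by the diagonal matrix (trivial on the centre) with entries $$w_x=\theta_x\,q^{\frac{rl}{2}\left(a+u-\frac{l+1}{2}\right)},\qquad \theta_x=\epsilon^l\eta^x\ (x>0),\quad \theta_x=1\ (x\le0),$$ where $l=\lceil (x-c)/N\rceil$, and $\eta=1$ if $a=1/2$ and $N$ is even, $\eta=\epsilon$ otherwise. Then $\varphi_a(\widehat{\mathscr S})\subset\mathfrak g_a^{[m]}$. Let $M\ge0$, $\vec m=(m_1,\dots,m_M)\in\mathbb Z_{\ge0}^M$, $\vec a=(a_1,\dots,a_M)\in\mathbb C^M$, $s_i=q^{a_i}$. Put $\mathfrak g^{[\vec m]}=\bigoplus_i\mathfrak g_{a_i}^{[m_i]}$ and $\varphi^{[\vec m]}_{\vec s}=\bigoplus_i\varphi_{a_i}:\widehat{\mathscr S}\to\mathfrak g^{[\vec m]}$. A module over a $\mathbb Z$-graded Lie algebra is quasifinite if it has a compatible $\mathbb Z$-gradation with finite-dimensional components. **Theorem.**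 Assume: - $a_i\in\mathbb Z\Rightarrow a_i=1$, and $a_i\in\mathbb Z+\frac12\Rightarrow a_i=\frac12$; - $a_i-a_j\notin\mathbb Z+\tau^{-1}\mathbb Z$ for $i\ne j$; - $a_i+a_j\notin\mathbb Z+\tau^{-1}\mathbb Z$ for $i\neq j$, and $2a_i\notin\mathbb Z+\tau^{-1}\mathbb Z$ unless $a_i\in\{1,\frac12\}$. 1. Let $V$ be a quasifinite $\mathfrak g^{[\vec m]}$-module, regarded as an $\widehat{\mathscr S}$-module via $\varphi^{[\vec m]}_{\vec s}$, and let $W$ be an $\widehat{\mathscr S}$-submodule of $V$. Then $W$ is stable under the derived algebra $[\mathfrak g^{[\vec m]},\mathfrak g^{[\vec m]}]$. If moreover $W$ is stable under the central elements $u^j$, $j$ odd, of the summands $\mathfrak g_{a_i}^{[m_i]}$ with $a_i\in\{1,\frac12\}$ (for instance if these act on $V$ by scalars, or if there are none), then $W$ is a $\mathfrak g^{[\vec m]}$-submodule. 2. For each $i$ let $\lambda_i$ be a linear functional on the degree zero part of $\mathfrak g_{a_i}^{[m_i]}$, and let $L(\mathfrak g_{a_i}^{[m_i]},\lambda_i)$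 be the irreducible highest weight module with highest weight $\lambda_i$ (highest weight vectors are killed by the components of positive degree). Suppose that it is quasifinite. Then the $\widehat{\mathscr S}$-module $L^{[\vec m]}_{\vec s}(\vec\lambda)=\bigotimes_iL(\mathfrak g_{a_i}^{[m_i]},\lambda_i)$, with action through $\varphi^{[\vec m]}_{\vec s}$, is irreducible. -/

import Mathlib

namespace QPDO

noncomputable section

open Polynomial

/-- `R_m = ℂ[u] / (u^(m+1))`. -/
abbrev TruncPoly (m : ℕ) : Type := AdjoinRoot ((X : ℂ[X]) ^ (m + 1))

/-- The class `u` of the variable. -/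
def uu (m : ℕ) : TruncPoly m := AdjoinRoot.root _

theorem uu_pow (m : ℕ) : uu m ^ (m + 1) = 0 := by
  have h := AdjoinRoot.eval₂_root ((X : ℂ[X]) ^ (m + 1))
  rwa [eval₂_X_pow] at h

/-- The substitution `u ↦ -u`. -/
def negU (m : ℕ) : TruncPoly m →ₐ[ℂ] TruncPoly m :=
  AdjoinRoot.liftAlgHom _ (Algebra.ofId ℂ _) (-uu m) (by
    rw [eval₂_X_pow, neg_pow, uu_pow, mul_zero])

theorem negU_uu (m : ℕ) : negU m (uu m) = -uu m := by
  simp [negU, uu]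

theorem negU_negU (m : ℕ) (x : TruncPoly m) : negU m (negU m x) = x := by
  have h : (negU m).comp (negU m) = AlgHom.id ℂ _ := by
    apply AdjoinRoot.algHom_ext
    change negU m (negU m (uu m)) = uu m
    rw [negU_uu, map_neg, negU_uu, neg_neg]
  exact DFunLike.congr_fun h x

/-- `q^(n (b + u)) = exp (n ℓ b) ∑_j (n ℓ)^j u^j / j!` in `R_m`, where `ℓ = log q`. -/
def qpow (ℓ : ℂ) (m : ℕ) (n b : ℂ) : TruncPoly m :=
  Complex.exp (n * ℓ * b) •
    ∑ j ∈ Finset.range (m + 1), ((n * ℓ) ^ j / (j.factorial : ℂ)) • uu m ^ j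

theorem qpow_eq (ℓ : ℂ) (m : ℕ) (n b : ℂ) :
    qpow ℓ m n b = Complex.exp (n * ℓ * b) • IsNilpotent.exp ((n * ℓ) • uu m) := by
  rw [qpow, IsNilpotent.exp_eq_sum (k := m + 1) (by rw [_root_.smul_pow, uu_pow, smul_zero])]
  congr 1
  refine Finset.sum_congr rfl fun j _ => ?_
  rw [_root_.smul_pow, div_eq_inv_mul, mul_smul]
  rw [← algebraMap_smul ℂ ((j.factorial : ℚ)⁻¹) ]
  simp

theorem isNilpotent_smul_uu (c : ℂ) (m : ℕ) : IsNilpotent (c • uu m) :=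
  ⟨m + 1, by rw [_root_.smul_pow, uu_pow, smul_zero]⟩

theorem qpow_add (ℓ : ℂ) (m : ℕ) (n n2 b : ℂ) :
    qpow ℓ m (n + n2) b = qpow ℓ m n b * qpow ℓ m n2 b := by
  simp only [qpow_eq]
  rw [smul_mul_smul_comm, ← Complex.exp_add, add_mul, add_smul,
    IsNilpotent.exp_add_of_commute (Commute.all _ _) (isNilpotent_smul_uu _ _)
      (isNilpotent_smul_uu _ _), add_mul]

theorem qpow_shift (ℓ : ℂ) (m : ℕ) (n b c : ℂ) :
    qpow ℓ m n (b + c) = Complex.exp (n * ℓ * c) • qpow ℓ m n b := by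
  simp only [qpow_eq]
  rw [smul_smul, ← Complex.exp_add]
  congr 2
  ring

theorem qpow_zero (ℓ : ℂ) (m : ℕ) (b : ℂ) : qpow ℓ m 0 b = 1 := by
  simp [qpow_eq, IsNilpotent.exp_zero]

theorem negU_qpow (ℓ : ℂ) (m : ℕ) (n b : ℂ) : negU m (qpow ℓ m n b) = qpow ℓ m (-n) (-b) := by
  simp only [qpow, map_smul, map_sum, map_pow, negU_uu]
  congr 1
  · congr 1; ring
  · refine Finset.sum_congr rfl fun j _ => ?_
    rw [neg_mul, neg_pow (uu m), neg_pow (n * ℓ), mul_div_assoc, mul_smul]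
    rcases Nat.even_or_odd j with h | h <;> simp [h.neg_one_pow]

/-- `q^(n (b + u))` as a unit. -/
def qpowUnit (ℓ : ℂ) (m : ℕ) (n b : ℂ) : (TruncPoly m)ˣ where
  val := qpow ℓ m n b
  inv := qpow ℓ m (-n) b
  val_inv := by rw [← qpow_add, add_neg_cancel, qpow_zero]
  inv_val := by rw [← qpow_add, neg_add_cancel, qpow_zero]

/-! ### Central extensions, products and restriction of modules -/

/-- A 2-cocycle on `L` with values in the trivial module `Z`. -/
structure Cocycle (L Z : Type*) [LieRing L] [LieAlgebra ℂ L] [AddCommGroup Z] [Module ℂ Z] where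
  /-- The underlying bilinear map. -/
  toBilin : L →ₗ[ℂ] L →ₗ[ℂ] Z
  alt : ∀ x, toBilin x x = 0
  jacobi : ∀ x y z, toBilin x ⁅y, z⁆ = toBilin ⁅x, y⁆ z + toBilin y ⁅x, z⁆

section CentralExt

variable {L Z : Type*} [LieRing L] [LieAlgebra ℂ L] [AddCommGroup Z] [Module ℂ Z]

/-- The central extension `L ⊕ Z` with bracket `[(x, a), (y, b)] = ([x, y], c(x, y))`. -/
def CentralExt (_c : Cocycle L Z) : Type _ := L × Z

variable (c : Cocycle L Z)

instance : AddCommGroup (CentralExt c) := inferInstanceAs (AddCommGroup (L × Z))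

instance : Module ℂ (CentralExt c) := inferInstanceAs (Module ℂ (L × Z))

variable {c}

namespace CentralExt

/-- The component in `L`. -/
def base : CentralExt c →ₗ[ℂ] L := LinearMap.fst ℂ L Z

/-- The component in the centre `Z`. -/
def centre : CentralExt c →ₗ[ℂ] Z := LinearMap.snd ℂ L Z

variable (c) in
/-- The element `x + z`. -/
def mk (x : L) (z : Z) : CentralExt c := (x, z)

@[simp] theorem base_mk (x : L) (z : Z) : (mk c x z).base = x := rfl

@[simp] theorem centre_mk (x : L) (z : Z) : (mk c x z).centre = z := rfl

@[ext] theorem ext {x y : CentralExt c} (h : x.base = y.base) (h2 : x.centre = y.centre) :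
    x = y := Prod.ext h h2

instance : LieRing (CentralExt c) where
  bracket x y := mk c ⁅x.base, y.base⁆ (c.toBilin x.base y.base)
  add_lie x y z := by ext <;> simp [map_add]
  lie_add x y z := by ext <;> simp [map_add]
  lie_self x := by ext <;> simp [c.alt]
  leibniz_lie x y z := by
    ext
    · simp [map_add]
    · simpa [map_add] using c.jacobi x.base y.base z.base

@[simp] theorem base_lie (x y : CentralExt c) : base ⁅x, y⁆ = ⁅base x, base y⁆ := rfl

@[simp] theorem centre_lie (x y : CentralExt c) :
    centre ⁅x, y⁆ = c.toBilin (base x) (base y) := rfl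

instance : LieAlgebra ℂ (CentralExt c) where
  lie_smul t x y := by ext <;> simp [map_smul]

end CentralExt

end CentralExt

section Pi

variable {ι : Type*} {L : ι → Type*} [∀ i, LieRing (L i)]

/-- The direct product (for finite `ι`: the direct sum) of Lie rings. -/
instance piLieRing : LieRing (∀ i, L i) where
  bracket x y := fun i => ⁅x i, y i⁆
  add_lie x y z := by ext i; exact add_lie _ _ _
  lie_add x y z := by ext i; exact lie_add _ _ _
  lie_self x := by ext i; exact lie_self _
  leibniz_lie x y z := by ext i; exact leibniz_lie _ _ _

instance piLieAlgebra [∀ i, LieAlgebra ℂ (L i)] : LieAlgebra ℂ (∀ i, L i) where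
  lie_smul t x y := by ext i; exact lie_smul _ _ _

@[simp] theorem pi_lie_apply (x y : ∀ i, L i) (i : ι) : ⁅x, y⁆ i = ⁅x i, y i⁆ := rfl

/-- The homomorphism into a product with given components. -/
def lieHomPi {S : Type*} [LieRing S] [LieAlgebra ℂ S] [∀ i, LieAlgebra ℂ (L i)]
    (f : ∀ i, S →ₗ⁅ℂ⁆ L i) : S →ₗ⁅ℂ⁆ (∀ i, L i) where
  toFun x := fun i => f i x
  map_add' x y := by ext i; exact map_add _ _ _
  map_smul' t x := by ext i; exact map_smul _ _ _
  map_lie' {x y} := by ext i; exact LieHom.map_lie _ _ _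

end Pi

section Restrict

variable {L S : Type*} [LieRing L] [LieAlgebra ℂ L] [LieRing S] [LieAlgebra ℂ S]

/-- The `L`-module `V`, regarded as an `S`-module via `φ : S → L`. -/
def Restrict (_φ : S →ₗ⁅ℂ⁆ L) (V : Type*) : Type _ := V

variable (φ : S →ₗ⁅ℂ⁆ L) (V : Type*) [AddCommGroup V] [Module ℂ V]

instance : AddCommGroup (Restrict φ V) := inferInstanceAs (AddCommGroup V)

instance : Module ℂ (Restrict φ V) := inferInstanceAs (Module ℂ V)

instance [LieRingModule L V] : LieRingModule S (Restrict φ V) := LieRingModule.compLieHom V φ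

instance [LieRingModule L V] [LieModule ℂ L V] : LieModule ℂ S (Restrict φ V) :=
  LieModule.compLieHom V φ

variable {φ V} in
/-- The vector space underlying an `S`-submodule of `V`. -/
def Restrict.submodule [LieRingModule L V] (W : LieSubmodule ℂ S (Restrict φ V)) :
    Submodule ℂ V := W.toSubmodule

end Restrict

theorem toEnd_lie_eq {K W : Type*} [LieRing K] [LieAlgebra ℂ K] [AddCommGroup W] [Module ℂ W]
    [LieRingModule K W] [LieModule ℂ K W] (x y : K) :
    LieModule.toEnd ℂ K W ⁅x, y⁆ = LieModule.toEnd ℂ K W x * LieModule.toEnd ℂ K W y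
      - LieModule.toEnd ℂ K W y * LieModule.toEnd ℂ K W x := by
  ext w
  simp

section Tensor

open scoped TensorProduct

variable {ι : Type*} [DecidableEq ι] (V : ι → Type*) [∀ i, AddCommGroup (V i)]
  [∀ i, Module ℂ (V i)]

/-- An endomorphism of the `i`-th factor acting on the tensor product. -/
def tensorAt (i : ι) : Module.End ℂ (V i) →ₗ[ℂ] Module.End ℂ (⨂[ℂ] j, V j) where
  toFun f := PiTensorProduct.map (Function.update (fun _ => LinearMap.id) i f)
  map_add' _ _ := PiTensorProduct.map_update_add _ _ _ _
  map_smul' _ _ := PiTensorProduct.map_update_smul _ _ _ _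

theorem tensorAt_eq (i : ι) (f : Module.End ℂ (V i)) :
    tensorAt V i f = PiTensorProduct.mapMonoidHom
      (Pi.mulSingle (M := fun j => Module.End ℂ (V j)) i f) := rfl

theorem tensorAt_mul (i : ι) (f g : Module.End ℂ (V i)) :
    tensorAt V i (f * g) = tensorAt V i f * tensorAt V i g := by
  rw [tensorAt_eq, tensorAt_eq, tensorAt_eq, ← map_mul, Pi.mulSingle_mul]

theorem tensorAt_comm {i j : ι} (h : i ≠ j) (f : Module.End ℂ (V i)) (g : Module.End ℂ (V j)) :
    tensorAt V i f * tensorAt V j g = tensorAt V j g * tensorAt V i f := by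
  rw [tensorAt_eq, tensorAt_eq, ← map_mul, ← map_mul]
  congr 1
  exact Pi.mulSingle_commute (f := fun j => Module.End ℂ (V j)) h f g

variable [Fintype ι] {L : ι → Type*} [∀ i, LieRing (L i)] [∀ i, LieAlgebra ℂ (L i)]
  [∀ i, LieRingModule (L i) (V i)] [∀ i, LieModule ℂ (L i) (V i)]

/-- The action of `⊕ L_i` on `⊗ V_i`: the sum over `i` of the actions of the `i`-th components
on the `i`-th factors. -/
def tensorAction : (∀ i, L i) →ₗ[ℂ] Module.End ℂ (⨂[ℂ] j, V j) where
  toFun x := ∑ i, tensorAt V i (LieModule.toEnd ℂ (L i) (V i) (x i))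
  map_add' x y := by simp [Finset.sum_add_distrib]
  map_smul' t x := by simp [Finset.smul_sum]

theorem tensorAction_lie (x y : ∀ i, L i) :
    tensorAction V ⁅x, y⁆ = tensorAction V x * tensorAction V y
      - tensorAction V y * tensorAction V x := by
  simp only [tensorAction, LinearMap.coe_mk, AddHom.coe_mk, pi_lie_apply, toEnd_lie_eq, map_sub,
    tensorAt_mul, Finset.sum_mul_sum, Finset.sum_sub_distrib]
  conv_rhs => rw [Finset.sum_comm (γ := ι)]
  rw [← Finset.sum_sub_distrib, ← Finset.sum_sub_distrib]
  refine Finset.sum_congr rfl fun i _ => ?_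
  rw [← Finset.sum_sub_distrib, Finset.sum_eq_single i]
  · intro j _ hj
    rw [tensorAt_comm V hj, sub_self]
  · simp

instance tensorLieRingModule : LieRingModule (∀ i, L i) (⨂[ℂ] j, V j) where
  bracket x v := tensorAction V x v
  add_lie x y v := by simp [map_add]
  lie_add x v w := by simp [map_add]
  leibniz_lie x y v := by
    change tensorAction V x (tensorAction V y v) = tensorAction V ⁅x, y⁆ v
      + tensorAction V y (tensorAction V x v)
    rw [tensorAction_lie]
    simp

instance tensorLieModule : LieModule ℂ (∀ i, L i) (⨂[ℂ] j, V j) where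
  smul_lie t x v := by
    change tensorAction V (t • x) v = t • tensorAction V x v
    simp
  lie_smul t x v := by
    change tensorAction V x (t • v) = t • tensorAction V x v
    simp

end Tensor

section Graded

variable {L : Type*} [LieRing L] [LieAlgebra ℂ L] (gr : ℤ → Submodule ℂ L)
  (V : Type*) [AddCommGroup V] [Module ℂ V] [LieRingModule L V]

/-- `V` is quasifinite: it has a `ℤ`-gradation compatible with the gradation `gr` of `L`,
with finite-dimensional homogeneous components. -/
def IsQuasifinite : Prop :=
  ∃ grV : ℤ → Submodule ℂ V, DirectSum.IsInternal grV ∧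
    (∀ i j : ℤ, ∀ x ∈ gr i, ∀ v ∈ grV j, ⁅x, v⁆ ∈ grV (i + j)) ∧
    ∀ j : ℤ, FiniteDimensional ℂ (grV j)

/-- `V` is the irreducible highest weight module with highest weight `wt`, a linear functional
on the degree zero part: `V` is irreducible and has a nonzero vector killed by all components of
positive degree, on which the degree zero part acts by `wt`. -/
def IsIrreducibleHighestWeight (wt : Module.Dual ℂ (gr 0)) : Prop :=
  LieModule.IsIrreducible ℂ L V ∧ ∃ v : V, v ≠ 0 ∧
    (∀ h : gr 0, ⁅(h : L), v⁆ = wt h • v) ∧ ∀ j : ℤ, 0 < j → ∀ x ∈ gr j, ⁅x, v⁆ = 0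

end Graded

/-! ### Infinite matrices with finitely many nonzero diagonals -/

section Band

variable (K : Type*) [CommRing K] [Algebra ℂ K]

/-- The matrices `(A i j)`, `i, j ∈ ℤ`, with finitely many nonzero diagonals. -/
def bandSubmodule : Submodule ℂ (ℤ → ℤ → K) where
  carrier := {A | ∃ d : ℕ, ∀ i j : ℤ, (d : ℤ) < |i - j| → A i j = 0}
  add_mem' := by
    rintro A B ⟨d, hd⟩ ⟨e, he⟩
    refine ⟨max d e, fun i j h => ?_⟩
    rw [Nat.cast_max, max_lt_iff] at h
    simp [hd i j h.1, he i j h.2]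
  zero_mem' := ⟨0, fun _ _ _ => rfl⟩
  smul_mem' := by
    rintro t A ⟨d, hd⟩
    exact ⟨d, fun i j h => by simp [hd i j h]⟩

/-- The algebra of matrices with finitely many nonzero diagonals. -/
def BandMat : Type _ := bandSubmodule K

namespace BandMat

variable {K}

instance : AddCommGroup (BandMat K) := inferInstanceAs (AddCommGroup (bandSubmodule K))

instance : Module ℂ (BandMat K) := inferInstanceAs (Module ℂ (bandSubmodule K))

/-- The entries of a matrix. -/
def entry (A : BandMat K) : ℤ → ℤ → K := A.1

instance : CoeFun (BandMat K) (fun _ => ℤ → ℤ → K) := ⟨entry⟩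

/-- The matrix with given entries. -/
def of (A : ℤ → ℤ → K) (h : ∃ d : ℕ, ∀ i j : ℤ, (d : ℤ) < |i - j| → A i j = 0) : BandMat K :=
  ⟨A, h⟩

@[simp] theorem of_apply (A : ℤ → ℤ → K) (h) (i j : ℤ) : of A h i j = A i j := rfl

@[ext] theorem ext {A B : BandMat K} (h : ∀ i j, A i j = B i j) : A = B :=
  Subtype.ext (funext fun i => funext fun j => h i j)

theorem exists_band (A : BandMat K) : ∃ d : ℕ, ∀ i j : ℤ, (d : ℤ) < |i - j| → A i j = 0 := A.2

@[simp] theorem add_apply (A B : BandMat K) (i j : ℤ) : (A + B) i j = A i j + B i j := rfl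

@[simp] theorem sub_apply (A B : BandMat K) (i j : ℤ) : (A - B) i j = A i j - B i j := rfl

@[simp] theorem neg_apply (A : BandMat K) (i j : ℤ) : (-A) i j = -A i j := rfl

@[simp] theorem zero_apply (i j : ℤ) : (0 : BandMat K) i j = 0 := rfl

@[simp] theorem smul_apply (t : ℂ) (A : BandMat K) (i j : ℤ) : (t • A) i j = t • A i j := rfl

theorem finite_row (A : BandMat K) (i : ℤ) : {k | A i k ≠ 0}.Finite := by
  obtain ⟨d, hd⟩ := A.exists_band
  refine (Set.finite_Icc (i - d) (i + d)).subset fun k hk => ?_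
  by_contra hc
  refine hk (hd i k ?_)
  rw [Set.mem_Icc, not_and_or] at hc
  rw [lt_abs]
  omega

theorem finite_mul (A : BandMat K) (B : ℤ → ℤ → K) (i j : ℤ) :
    (Function.support fun k => A i k * B k j).Finite :=
  (A.finite_row i).subset fun k hk h => hk (by simp [h])

instance : Mul (BandMat K) where
  mul A B := of (fun i j => ∑ᶠ k, A i k * B k j) (by
    obtain ⟨d, hd⟩ := A.exists_band
    obtain ⟨e, he⟩ := B.exists_band
    refine ⟨d + e, fun i j h => ?_⟩
    rw [← finsum_zero (α := ℤ) (M := K)]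
    refine finsum_congr fun k => ?_
    by_cases h1 : (d : ℤ) < |i - k|
    · rw [hd i k h1, zero_mul]
    · have h2 : (e : ℤ) < |k - j| := by
        have := abs_sub_le i k j
        push_cast at h
        linarith
      rw [he k j h2, mul_zero])

theorem mul_apply (A B : BandMat K) (i j : ℤ) : (A * B) i j = ∑ᶠ k, A i k * B k j := rfl

theorem mul_apply_sum (A B : BandMat K) (i j : ℤ) (s : Finset ℤ)
    (h : ∀ k, k ∉ s → A i k * B k j = 0) : (A * B) i j = ∑ k ∈ s, A i k * B k j := by
  rw [mul_apply]
  refine finsum_eq_sum_of_support_subset _ fun k hk => ?_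
  by_contra hc
  exact hk (h k (by simpa using hc))

instance : One (BandMat K) where
  one := of (fun i j => if i = j then 1 else 0) ⟨0, fun i j h => by
    rw [if_neg]
    rintro rfl
    simp at h⟩

theorem one_apply (i j : ℤ) : (1 : BandMat K) i j = if i = j then 1 else 0 := rfl

theorem mul_assoc_aux (A B C : BandMat K) : A * B * C = A * (B * C) := by
  ext i j
  obtain ⟨d, hd⟩ := A.exists_band
  obtain ⟨e, he⟩ := B.exists_band
  have hA : ∀ k, k ∉ Finset.Icc (i - d) (i + d) → A i k = 0 := fun k hk => by
    refine hd i k ?_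
    rw [Finset.mem_Icc, not_and_or] at hk
    rw [lt_abs]
    omega
  have hB : ∀ l k, A i l ≠ 0 → k ∉ Finset.Icc (i - d - e) (i + d + e) → B l k = 0 := by
    intro l k hl hk
    have hl2 : l ∈ Finset.Icc (i - d) (i + d) := by
      by_contra hc
      exact hl (hA l hc)
    refine he l k ?_
    rw [Finset.mem_Icc, not_and_or] at hk
    rw [Finset.mem_Icc] at hl2
    rw [lt_abs]
    omega
  have hAB : ∀ k, (A * B) i k = ∑ l ∈ Finset.Icc (i - d) (i + d), A i l * B l k := fun k =>
    mul_apply_sum _ _ _ _ _ fun l hl => by rw [hA l hl, zero_mul]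
  rw [mul_apply_sum (A * B) C i j (Finset.Icc (i - d - e) (i + d + e)),
    mul_apply_sum A (B * C) i j (Finset.Icc (i - d) (i + d))]
  · simp only [hAB, Finset.sum_mul]
    rw [Finset.sum_comm]
    refine Finset.sum_congr rfl fun l _ => ?_
    by_cases hl : A i l = 0
    · simp [hl]
    rw [mul_apply_sum B C l j (Finset.Icc (i - d - e) (i + d + e)) fun k hk => by
      rw [hB l k hl hk, zero_mul], Finset.mul_sum]
    exact Finset.sum_congr rfl fun k _ => mul_assoc _ _ _
  · intro l hl
    rw [hA l hl, zero_mul]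
  · intro k hk
    rw [hAB, Finset.sum_eq_zero, zero_mul]
    intro l _
    by_cases hl : A i l = 0
    · rw [hl, zero_mul]
    · rw [hB l k hl hk, mul_zero]

instance : Ring (BandMat K) where
  __ := (inferInstance : AddCommGroup (BandMat K))
  left_distrib A B C := by
    ext i j
    simp only [mul_apply, add_apply, mul_add]
    exact finsum_add_distrib (A.finite_mul B i j) (A.finite_mul C i j)
  right_distrib A B C := by
    ext i j
    simp only [mul_apply, add_apply, add_mul]
    exact finsum_add_distrib (A.finite_mul C i j) (B.finite_mul C i j)
  zero_mul A := by ext i j; simp [mul_apply]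
  mul_zero A := by ext i j; simp [mul_apply]
  mul_assoc := mul_assoc_aux
  one_mul A := by
    ext i j
    rw [mul_apply_sum _ _ _ _ {i}] <;> simp +contextual [one_apply, eq_comm]
  mul_one A := by
    ext i j
    rw [mul_apply_sum _ _ _ _ {j}] <;> simp +contextual [one_apply]
  zsmul := fun n A => n • A
  neg_add_cancel A := neg_add_cancel A

theorem smul_mul_aux (t : ℂ) (A B : BandMat K) : (t • A) * B = t • (A * B) := by
  ext i j
  simp only [mul_apply, smul_apply, smul_mul_assoc]
  rw [smul_finsum]

theorem mul_smul_aux (t : ℂ) (A B : BandMat K) : A * (t • B) = t • (A * B) := by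
  ext i j
  simp only [mul_apply, smul_apply, mul_smul_comm]
  rw [smul_finsum]

instance : LieRing (BandMat K) := LieRing.ofAssociativeRing

theorem lie_def (A B : BandMat K) : ⁅A, B⁆ = A * B - B * A := rfl

instance : LieAlgebra ℂ (BandMat K) where
  lie_smul t A B := by simp only [lie_def, smul_mul_aux, mul_smul_aux, smul_sub]

/-- The trace (used for matrices with finitely many nonzero entries). -/
def trace (A : BandMat K) : K := ∑ᶠ i, A i i

variable (K) in
/-- `J = ∑_{i ≤ 0} E_{i,i}`. -/
def J : BandMat K := of (fun i j => if i = j ∧ i ≤ 0 then 1 else 0) ⟨0, fun i j h => by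
  rw [if_neg]
  rintro ⟨rfl, -⟩
  simp at h⟩

theorem J_mul (A : BandMat K) (i j : ℤ) : (J K * A) i j = if i ≤ 0 then A i j else 0 := by
  rw [mul_apply_sum _ _ _ _ {i}]
  · simp [J]
  · intro k hk
    simp only [Finset.mem_singleton] at hk
    simp [J, Ne.symm hk]

theorem mul_J (A : BandMat K) (i j : ℤ) : (A * J K) i j = if j ≤ 0 then A i j else 0 := by
  rw [mul_apply_sum _ _ _ _ {j}]
  · simp [J]
  · intro k hk
    simp only [Finset.mem_singleton] at hk
    simp [J, hk]

/-- All nonzero entries have their indices in `[-d, d]`. -/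
def InBox (A : BandMat K) (d : ℕ) : Prop :=
  ∀ i j : ℤ, A i j ≠ 0 → i ∈ Finset.Icc (-d : ℤ) d ∧ j ∈ Finset.Icc (-d : ℤ) d

theorem InBox.mono {A : BandMat K} {d e : ℕ} (h : A.InBox d) (hde : d ≤ e) : A.InBox e := by
  intro i j hij
  have := h i j hij
  simp only [Finset.mem_Icc] at this ⊢
  omega

theorem inBox_lie_J (A : BandMat K) : ∃ d, InBox ⁅J K, A⁆ d := by
  obtain ⟨d, hd⟩ := A.exists_band
  refine ⟨d, fun i j h => ?_⟩
  rw [lie_def, sub_apply, J_mul, mul_J] at h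
  have h1 : ¬ (d : ℤ) < |i - j| := fun hc => h (by simp [hd i j hc])
  rw [lt_abs] at h1
  simp only [Finset.mem_Icc]
  by_cases hi : i ≤ 0 <;> by_cases hj : j ≤ 0
  · simp [hi, hj] at h
  · omega
  · omega
  · simp [hi, hj] at h

theorem InBox.trace_mul {A : BandMat K} {d : ℕ} (h : A.InBox d) (B : BandMat K) :
    trace (A * B) = ∑ i ∈ Finset.Icc (-d : ℤ) d, ∑ k ∈ Finset.Icc (-d : ℤ) d, A i k * B k i := by
  have h1 : ∀ i, (A * B) i i = ∑ k ∈ Finset.Icc (-d : ℤ) d, A i k * B k i := fun i =>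
    mul_apply_sum _ _ _ _ _ fun k hk => by
      by_cases hA : A i k = 0
      · rw [hA, zero_mul]
      · exact absurd (h i k hA).2 hk
  rw [trace, finsum_eq_sum_of_support_subset (s := Finset.Icc (-d : ℤ) d)]
  · exact Finset.sum_congr rfl fun i _ => h1 i
  · intro i hi
    by_contra hc
    refine hi ?_
    dsimp only
    rw [h1]
    refine Finset.sum_eq_zero fun k _ => ?_
    by_cases hA : A i k = 0
    · rw [hA, zero_mul]
    · exact absurd (by simpa using (h i k hA).1) hc

theorem InBox.trace_mul_comm {A : BandMat K} {d : ℕ} (h : A.InBox d) (B : BandMat K) :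
    trace (A * B) = trace (B * A) := by
  have h1 : ∀ i, (B * A) i i = ∑ k ∈ Finset.Icc (-d : ℤ) d, A k i * B i k := fun i => by
    rw [mul_apply_sum B A i i (Finset.Icc (-d : ℤ) d)]
    · exact Finset.sum_congr rfl fun k _ => mul_comm _ _
    · intro k hk
      by_cases hA : A k i = 0
      · rw [hA, mul_zero]
      · exact absurd (h k i hA).1 hk
  rw [h.trace_mul, trace, finsum_eq_sum_of_support_subset (s := Finset.Icc (-d : ℤ) d)]
  · rw [Finset.sum_comm]
    exact Finset.sum_congr rfl fun i _ => (h1 i).symm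
  · intro i hi
    by_contra hc
    refine hi ?_
    dsimp only
    rw [h1]
    refine Finset.sum_eq_zero fun k _ => ?_
    by_cases hA : A k i = 0
    · rw [hA, zero_mul]
    · exact absurd (by simpa using (h k i hA).2) hc

theorem InBox.mul_band {A : BandMat K} {d : ℕ} (h : A.InBox d) (B : BandMat K) :
    ∃ e, InBox (A * B) e := by
  obtain ⟨b, hb⟩ := B.exists_band
  refine ⟨d + b, fun i j hij => ?_⟩
  rw [mul_apply] at hij
  obtain ⟨k, hk⟩ : ∃ k, A i k * B k j ≠ 0 := by
    by_contra hc
    push Not at hc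
    exact hij (by simp [hc])
  have h1 := h i k (left_ne_zero_of_mul hk)
  have h2 : ¬ (b : ℤ) < |k - j| := fun hc => right_ne_zero_of_mul hk (hb k j hc)
  rw [lt_abs] at h2
  simp only [Finset.mem_Icc, Nat.cast_add] at h1 ⊢
  omega

/-- The cocycle `C(A, B) = Tr([J, A] B)`. -/
def cocycleFun (A B : BandMat K) : K := trace (⁅J K, A⁆ * B)

theorem cocycleFun_add_left (A A2 B : BandMat K) :
    cocycleFun (A + A2) B = cocycleFun A B + cocycleFun A2 B := by
  obtain ⟨d, hd⟩ := A.inBox_lie_J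
  obtain ⟨e, he⟩ := A2.inBox_lie_J
  obtain ⟨f, hf⟩ := (A + A2).inBox_lie_J
  have hd := hd.mono (le_max_left d (max e f))
  have he := he.mono ((le_max_left e f).trans (le_max_right d (max e f)))
  have hf := hf.mono ((le_max_right e f).trans (le_max_right d (max e f)))
  rw [cocycleFun, cocycleFun, cocycleFun, hd.trace_mul, he.trace_mul, hf.trace_mul,
    ← Finset.sum_add_distrib]
  refine Finset.sum_congr rfl fun i _ => ?_
  rw [← Finset.sum_add_distrib]
  refine Finset.sum_congr rfl fun k _ => ?_
  rw [lie_add, add_apply, add_mul]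

theorem cocycleFun_smul_left (t : ℂ) (A B : BandMat K) :
    cocycleFun (t • A) B = t • cocycleFun A B := by
  rw [cocycleFun, cocycleFun, lie_smul, smul_mul_aux, trace, trace, smul_finsum]
  rfl

theorem cocycleFun_add_right (A B B2 : BandMat K) :
    cocycleFun A (B + B2) = cocycleFun A B + cocycleFun A B2 := by
  obtain ⟨d, hd⟩ := A.inBox_lie_J
  rw [cocycleFun, cocycleFun, cocycleFun, hd.trace_mul, hd.trace_mul, hd.trace_mul,
    ← Finset.sum_add_distrib]
  refine Finset.sum_congr rfl fun i _ => ?_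
  rw [← Finset.sum_add_distrib]
  refine Finset.sum_congr rfl fun k _ => ?_
  rw [add_apply, mul_add]

theorem cocycleFun_smul_right (t : ℂ) (A B : BandMat K) :
    cocycleFun A (t • B) = t • cocycleFun A B := by
  rw [cocycleFun, cocycleFun, mul_smul_aux, trace, trace, smul_finsum]
  rfl

theorem lie_J_apply (A : BandMat K) (i j : ℤ) :
    ⁅J K, A⁆ i j = ((if i ≤ 0 then 1 else 0) - (if j ≤ 0 then 1 else 0)) * A i j := by
  rw [lie_def, sub_apply, J_mul, mul_J]
  by_cases hi : i ≤ 0 <;> by_cases hj : j ≤ 0 <;> simp [hi, hj]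

theorem cocycleFun_skew (A B : BandMat K) : cocycleFun A B = -cocycleFun B A := by
  obtain ⟨d, hd⟩ := A.inBox_lie_J
  obtain ⟨e, he⟩ := B.inBox_lie_J
  have hd := hd.mono (le_max_left d e)
  have he := he.mono (le_max_right d e)
  rw [cocycleFun, cocycleFun, hd.trace_mul, he.trace_mul, Finset.sum_comm,
    ← Finset.sum_neg_distrib]
  refine Finset.sum_congr rfl fun i _ => ?_
  rw [← Finset.sum_neg_distrib]
  refine Finset.sum_congr rfl fun k _ => ?_
  rw [lie_J_apply, lie_J_apply]
  ring

theorem cocycleFun_alt (A : BandMat K) : cocycleFun A A = 0 := by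
  have h := cocycleFun_skew A A
  have h2 : (2 : ℂ) • cocycleFun A A = 0 := by
    rw [two_smul]
    nth_rewrite 2 [h]
    rw [add_neg_cancel]
  exact (smul_eq_zero_iff_right (two_ne_zero)).1 h2

theorem trace_mul_add {A A2 : BandMat K} {d e : ℕ} (h : A.InBox d) (h2 : A2.InBox e)
    (f : ℕ) (h3 : (A + A2).InBox f) : trace (A + A2) = trace A + trace A2 := by
  have hd := h.mono (le_max_left d (max e f))
  have he := h2.mono ((le_max_left e f).trans (le_max_right d (max e f)))
  have hf := h3.mono ((le_max_right e f).trans (le_max_right d (max e f)))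
  have h4 := hd.trace_mul 1
  have h5 := he.trace_mul 1
  have h6 := hf.trace_mul 1
  rw [mul_one] at h4 h5 h6
  rw [h4, h5, h6, ← Finset.sum_add_distrib]
  refine Finset.sum_congr rfl fun i _ => ?_
  rw [← Finset.sum_add_distrib]
  refine Finset.sum_congr rfl fun k _ => ?_
  rw [add_apply, add_mul]

theorem cocycleFun_mul (A B D : BandMat K) :
    cocycleFun (A * B) D = cocycleFun A (B * D) + cocycleFun B (D * A) := by
  have h1 : ⁅J K, A * B⁆ * D = ⁅J K, A⁆ * (B * D) + A * ⁅J K, B⁆ * D := by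
    simp only [lie_def]
    noncomm_ring
  obtain ⟨d, hd⟩ := A.inBox_lie_J
  obtain ⟨e, he⟩ := B.inBox_lie_J
  obtain ⟨f, hf⟩ := (A * B).inBox_lie_J
  obtain ⟨d1, hd1⟩ := hd.mul_band (B * D)
  obtain ⟨f1, hf1⟩ := hf.mul_band D
  have h2 : A * ⁅J K, B⁆ * D = ⁅J K, A * B⁆ * D + -(⁅J K, A⁆ * (B * D)) := by
    rw [h1]
    abel
  have h3 : ∃ g, InBox (A * ⁅J K, B⁆ * D) g := by
    refine ⟨max d1 f1, fun i j hij => ?_⟩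
    by_cases hc : (⁅J K, A⁆ * (B * D)) i j = 0
    · refine (hf1.mono (le_max_right d1 f1)) i j fun h => hij ?_
      rw [h2, add_apply, neg_apply, h, hc, neg_zero, add_zero]
    · exact (hd1.mono (le_max_left d1 f1)) i j hc
  obtain ⟨g, hg⟩ := h3
  rw [cocycleFun, cocycleFun, cocycleFun, h1, trace_mul_add hd1 hg f1 (h1 ▸ hf1), mul_assoc A,
    ← mul_assoc ⁅J K, B⁆]
  congr 1
  obtain ⟨e1, he1⟩ := he.mul_band D
  rw [← he1.trace_mul_comm A]

/-- The cocycle `C(A, B) = Tr([J, A] B)`. -/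
def cocycle : Cocycle (BandMat K) K where
  toBilin := LinearMap.mk₂ ℂ cocycleFun cocycleFun_add_left cocycleFun_smul_left
    cocycleFun_add_right cocycleFun_smul_right
  alt := cocycleFun_alt
  jacobi x y z := by
    have key : cocycleFun x (y * z) - cocycleFun x (z * y) = (cocycleFun (x * y) z
        - cocycleFun (y * x) z) + (cocycleFun y (x * z) - cocycleFun y (z * x)) := by
      rw [cocycleFun_mul x y z, cocycleFun_mul y x z]
      abel
    rw [lie_def, lie_def, lie_def, map_sub, map_sub, map_sub, LinearMap.sub_apply]
    exact key

theorem cocycle_apply (A B : BandMat K) : cocycle.toBilin A B = trace (⁅J K, A⁆ * B) := rfl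

end BandMat

end Band

/-- The Lie algebra of infinite matrices over `R_m` with finitely many nonzero diagonals. -/
abbrev GlInf (m : ℕ) : Type := BandMat (TruncPoly m)

/-- Its central extension by `R_m`. -/
abbrev GlHat (m : ℕ) : Type := CentralExt (BandMat.cocycle (K := TruncPoly m))

namespace BandMat

section Maps

variable {K : Type*} [CommRing K] [Algebra ℂ K]

/-- `A i j ↦ A (i - c) (j - c)`: the automorphism `E_{i,j} ↦ E_{i+c,j+c}`. -/
def shift (c : ℕ) : BandMat K →ₗ[ℂ] BandMat K where
  toFun A := of (fun i j => A (i - c) (j - c)) (by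
    obtain ⟨d, hd⟩ := A.exists_band
    exact ⟨d, fun i j h => hd _ _ (by simpa using h)⟩)
  map_add' _ _ := rfl
  map_smul' _ _ := rfl

@[simp] theorem shift_apply (c : ℕ) (A : BandMat K) (i j : ℤ) :
    shift c A i j = A (i - c) (j - c) := rfl

theorem shift_mul (c : ℕ) (A B : BandMat K) : shift c (A * B) = shift c A * shift c B := by
  ext i j
  rw [shift_apply, mul_apply, mul_apply]
  exact (finsum_comp_equiv (Equiv.subRight (c : ℤ))
    (f := fun k => A (i - c) k * B k (j - c))).symm

theorem trace_shift (c : ℕ) (A : BandMat K) : trace (shift c A) = trace A :=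
  finsum_comp_equiv (Equiv.subRight (c : ℤ)) (f := fun k => A k k)

variable (K) in
/-- `∑_{-c < i ≤ 0} E_{i,i}`. -/
def window (c : ℕ) : BandMat K :=
  of (fun i j => if i = j ∧ i ∈ Finset.Ioc (-c : ℤ) 0 then 1 else 0) ⟨0, fun i j h => by
    rw [if_neg]
    rintro ⟨rfl, -⟩
    simp at h⟩

theorem window_mul (c : ℕ) (A : BandMat K) (i j : ℤ) :
    (window K c * A) i j = if i ∈ Finset.Ioc (-c : ℤ) 0 then A i j else 0 := by
  rw [mul_apply_sum _ _ _ _ {i}]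
  · simp [window]
  · intro k hk
    simp only [Finset.mem_singleton] at hk
    simp [window, Ne.symm hk]

theorem inBox_window (c : ℕ) : InBox (window K c) c := by
  intro i j h
  have h2 : i = j ∧ i ∈ Finset.Ioc (-c : ℤ) 0 := by
    by_contra hc
    exact h (by rw [window, of_apply, if_neg hc])
  obtain ⟨rfl, h3⟩ := h2
  simp only [Finset.mem_Ioc, Finset.mem_Icc] at h3 ⊢
  omega

theorem trace_window_mul (c : ℕ) (A : BandMat K) :
    trace (window K c * A) = ∑ p ∈ Finset.Ioc (-c : ℤ) 0, A p p := by
  rw [trace, finsum_eq_sum_of_support_subset (s := Finset.Ioc (-c : ℤ) 0)]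
  · refine Finset.sum_congr rfl fun p hp => ?_
    rw [window_mul, if_pos hp]
  · intro p hp
    by_contra hc
    refine hp ?_
    dsimp only
    rw [window_mul, if_neg (by simpa using hc)]

theorem shift_J_sub (c : ℕ) : shift c (J K - window K c) = J K := by
  ext i j
  simp only [shift_apply, sub_apply, J, window, of_apply, Finset.mem_Ioc, sub_left_inj]
  by_cases h : i = j
  · subst h
    by_cases h1 : i ≤ 0
    · rw [if_pos ⟨rfl, by omega⟩, if_neg (by omega), if_pos ⟨rfl, h1⟩, sub_zero]
    · by_cases h2 : i - c ≤ 0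
      · rw [if_pos ⟨rfl, h2⟩, if_pos ⟨rfl, by omega⟩, if_neg (by tauto), sub_self]
      · rw [if_neg (by tauto), if_neg (by tauto), if_neg (by tauto), sub_self]
  · simp [h]

theorem cocycle_shift (c : ℕ) (A B : BandMat K) :
    cocycle.toBilin (shift c A) (shift c B) = cocycle.toBilin A B
      - ∑ p ∈ Finset.Ioc (-c : ℤ) 0, ⁅A, B⁆ p p := by
  have h1 : ⁅J K, shift c A⁆ * shift c B = shift c (⁅J K - window K c, A⁆ * B) := by
    rw [lie_def, lie_def, shift_mul, map_sub, shift_mul, shift_mul, shift_J_sub]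
  have h2 : ⁅J K, A⁆ * B = ⁅J K - window K c, A⁆ * B + ⁅window K c, A⁆ * B := by
    simp only [lie_def]
    noncomm_ring
  obtain ⟨d, hd⟩ := A.inBox_lie_J
  obtain ⟨d1, hd1⟩ := hd.mul_band B
  have hw := inBox_window (K := K) c
  obtain ⟨e1, he1⟩ := hw.mul_band (A * B)
  obtain ⟨e2, he2⟩ := hw.mul_band A
  have h3 : trace (A * window K c * B) = trace (window K c * (B * A)) := by
    have h4 : A * window K c * B = A * (window K c * B) := mul_assoc _ _ _
    obtain ⟨f, hf⟩ := hw.mul_band B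
    rw [h4, ← hf.trace_mul_comm A, mul_assoc]
  obtain ⟨f, hf⟩ := hw.mul_band (B * A)
  obtain ⟨f2, hf2⟩ := hw.mul_band B
  have hAw : ∃ g, InBox (A * window K c * B) g := by
    obtain ⟨a, ha⟩ := A.exists_band
    refine ⟨f2 + a, fun i j hij => ?_⟩
    rw [mul_assoc, mul_apply] at hij
    obtain ⟨k, hk⟩ : ∃ k, A i k * (window K c * B) k j ≠ 0 := by
      by_contra hc
      push Not at hc
      exact hij (by simp [hc])
    have h5 := hf2 k j (right_ne_zero_of_mul hk)
    have h6 : ¬ (a : ℤ) < |i - k| := fun hc => left_ne_zero_of_mul hk (ha i k hc)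
    rw [lt_abs] at h6
    simp only [Finset.mem_Icc, Nat.cast_add] at h5 ⊢
    omega
  obtain ⟨g, hg⟩ := hAw
  have inAdd : ∀ {X Y : BandMat K} {x y : ℕ}, X.InBox x → Y.InBox y →
      (X + Y).InBox (max x y) := by
    intro X Y x y hX hY i j hij
    by_cases hc : X i j = 0
    · refine hY.mono (le_max_right x y) i j fun h => hij ?_
      rw [add_apply, hc, h, add_zero]
    · exact hX.mono (le_max_left x y) i j hc
  have inNeg : ∀ {X : BandMat K} {x : ℕ}, X.InBox x → (-X).InBox x := by
    intro X x hX i j hij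
    exact hX i j fun h => hij (by rw [neg_apply, h, neg_zero])
  have trNeg : ∀ X : BandMat K, trace (-X) = -trace X := fun X => by
    simp only [trace, neg_apply, finsum_neg_distrib]
  have h7 : ⁅window K c, A⁆ * B = window K c * (A * B) + -(A * window K c * B) := by
    simp only [lie_def]
    noncomm_ring
  have h8 : trace (⁅window K c, A⁆ * B) = ∑ p ∈ Finset.Ioc (-c : ℤ) 0, ⁅A, B⁆ p p := by
    rw [h7, trace_mul_add he1 (inNeg hg) _ (inAdd he1 (inNeg hg)), trNeg, h3, trace_window_mul,
      trace_window_mul, ← sub_eq_add_neg, ← Finset.sum_sub_distrib]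
    rfl
  have hbox : (⁅window K c, A⁆ * B).InBox (max e1 g) := by
    rw [h7]
    exact inAdd he1 (inNeg hg)
  have h9 : ⁅J K - window K c, A⁆ * B = ⁅J K, A⁆ * B + -(⁅window K c, A⁆ * B) := by
    rw [h2]
    abel
  rw [cocycle_apply, cocycle_apply, h1, trace_shift, h9,
    trace_mul_add hd1 (inNeg hbox) _ (inAdd hd1 (inNeg hbox)), trNeg, h8, sub_eq_add_neg]

/-- Conjugation by the invertible diagonal matrix with entries `w i`. -/
def diagConj (w : ℤ → Kˣ) : BandMat K →ₗ[ℂ] BandMat K where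
  toFun A := of (fun i j => (w i : K) * A i j * ((w j)⁻¹ : Kˣ)) (by
    obtain ⟨d, hd⟩ := A.exists_band
    exact ⟨d, fun i j h => by simp [hd _ _ h]⟩)
  map_add' A B := by ext i j; simp [mul_add, add_mul]
  map_smul' t A := by ext i j; simp

@[simp] theorem diagConj_apply (w : ℤ → Kˣ) (A : BandMat K) (i j : ℤ) :
    diagConj w A i j = (w i : K) * A i j * ((w j)⁻¹ : Kˣ) := rfl

theorem diagConj_mul (w : ℤ → Kˣ) (A B : BandMat K) :
    diagConj w (A * B) = diagConj w A * diagConj w B := by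
  ext i j
  rw [diagConj_apply, mul_apply, mul_apply, mul_finsum' _ _ (A.finite_mul B i j),
    finsum_mul' _ _ ((A.finite_mul B i j).subset fun k hk h => hk (by simp [h]))]
  refine finsum_congr fun k => ?_
  rw [diagConj_apply, diagConj_apply]
  have h : ((w k)⁻¹ : Kˣ) * (w k : K) = 1 := Units.inv_mul _
  linear_combination (-(w i : K) * A i k * B k j * ((w j)⁻¹ : Kˣ)) * h

theorem cocycle_diagConj (w : ℤ → Kˣ) (A B : BandMat K) :
    cocycle.toBilin (diagConj w A) (diagConj w B) = cocycle.toBilin A B := by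
  have h1 : ⁅J K, diagConj w A⁆ = diagConj w ⁅J K, A⁆ := by
    ext i j
    rw [lie_J_apply, diagConj_apply, diagConj_apply, lie_J_apply]
    ring
  rw [cocycle_apply, cocycle_apply, h1, ← diagConj_mul, trace, trace]
  refine finsum_congr fun i => ?_
  rw [diagConj_apply, mul_comm, ← mul_assoc, Units.inv_mul, one_mul]

/-- The extension of `shift c` to the central extension. -/
def shiftHat (c : ℕ) : CentralExt (cocycle (K := K)) →ₗ⁅ℂ⁆ CentralExt (cocycle (K := K)) where
  toFun x := CentralExt.mk _ (shift c x.base)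
    (x.centre - ∑ p ∈ Finset.Ioc (-c : ℤ) 0, x.base p p)
  map_add' x y := by
    ext1
    · simp
    · simp only [map_add, CentralExt.centre_mk, add_apply, Finset.sum_add_distrib]
      abel
  map_smul' t x := by
    ext1
    · simp
    · simp [Finset.smul_sum, smul_sub]
  map_lie' {x y} := by
    ext1
    · simp [lie_def, shift_mul]
    · simp [cocycle_shift]

/-- The extension of `diagConj w` to the central extension. -/
def diagConjHat (w : ℤ → Kˣ) :
    CentralExt (cocycle (K := K)) →ₗ⁅ℂ⁆ CentralExt (cocycle (K := K)) where
  toFun x := CentralExt.mk _ (diagConj w x.base) x.centre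
  map_add' x y := by ext1 <;> simp
  map_smul' t x := by ext1 <;> simp
  map_lie' {x y} := by
    ext1
    · simp only [CentralExt.base_mk, CentralExt.base_lie, lie_def, map_sub, diagConj_mul]
    · simp [cocycle_diagConj]

end Maps

end BandMat

/-! ### The classical subalgebras and the principal gradation -/

theorem units_smul_finsum {K : Type*} [AddCommGroup K] (e : ℤˣ) (f : ℤ → K) :
    e • ∑ᶠ k, f k = ∑ᶠ k, e • f k := by
  rcases Int.units_eq_one_or e with rfl | rfl
  · simp
  · simp [Units.smul_def, finsum_neg_distrib]

/-- The matrices with `a_{i,j}(u) = - η^(i+j) a_{κ-j,κ-i}(-u)`, extended by `R_m`. -/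
def classical (κ : ℤ) (η : ℤˣ) (m : ℕ) : LieSubalgebra ℂ (GlHat m) where
  carrier := {x | ∀ i j : ℤ, x.base i j = -(η ^ (i + j) • negU m (x.base (κ - j) (κ - i)))}
  add_mem' := by
    intro x y hx hy i j
    rw [map_add, BandMat.add_apply, BandMat.add_apply, hx, hy, map_add, smul_add]
    abel
  zero_mem' := by
    intro i j
    simp
  smul_mem' := by
    intro t x hx i j
    rw [map_smul, BandMat.smul_apply, BandMat.smul_apply, hx i j, map_smul, smul_neg, smul_comm t]
  lie_mem' := by
    intro x y hx hy i j
    have key : ∀ (A B : GlInf m),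
        (∀ i j : ℤ, A i j = -(η ^ (i + j) • negU m (A (κ - j) (κ - i)))) →
        (∀ i j : ℤ, B i j = -(η ^ (i + j) • negU m (B (κ - j) (κ - i)))) →
        (A * B) i j = η ^ (i + j) • negU m ((B * A) (κ - j) (κ - i)) := by
      intro A B hA hB
      have h1 := AddMonoidHom.map_finsum (negU m : TruncPoly m →+ TruncPoly m)
        (B.finite_mul A (κ - j) (κ - i))
      have h2 : negU m ((B * A) (κ - j) (κ - i))
          = ∑ᶠ k, negU m (B (κ - j) k * A k (κ - i)) := h1
      rw [h2, units_smul_finsum, BandMat.mul_apply, ← finsum_comp_equiv (Equiv.subLeft κ)]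
      refine finsum_congr fun k => ?_
      rw [Equiv.subLeft_apply, hA i (κ - k), hB (κ - k) j, map_mul, sub_sub_cancel, neg_mul_neg,
        smul_mul_smul_comm, ← zpow_add, mul_comm (negU m (B _ _))]
      have h3 : i + (κ - k) + (κ - k + j) = (i + j) + 2 * (κ - k) := by ring
      rw [h3, zpow_add, zpow_mul, zpow_ofNat, Int.units_sq, one_zpow, mul_one]
    rw [CentralExt.base_lie, BandMat.lie_def, BandMat.sub_apply, key _ _ hx hy, key _ _ hy hx, BandMat.sub_apply,
      map_sub, smul_sub]
    abel

/-- `b̃_∞^{[m]}`. -/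
abbrev bTilde (m : ℕ) : LieSubalgebra ℂ (GlHat m) := classical 0 1 m

/-- `b_∞^{[m]}`. -/
abbrev bInf (m : ℕ) : LieSubalgebra ℂ (GlHat m) := classical 0 (-1) m

/-- `c_∞^{[m]}`. -/
abbrev cInf (m : ℕ) : LieSubalgebra ℂ (GlHat m) := classical 1 (-1) m

/-- `d_∞^{[m]}`. -/
abbrev dInf (m : ℕ) : LieSubalgebra ℂ (GlHat m) := classical 1 1 m

/-- The component of degree `d` of the principal gradation: `E_{i,j}` has degree `j - i` and the
centre has degree `0`. -/
def glDegree (m : ℕ) (d : ℤ) : Submodule ℂ (GlHat m) where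
  carrier := {x | (∀ i j : ℤ, j - i ≠ d → x.base i j = 0) ∧ (d ≠ 0 → x.centre = 0)}
  add_mem' := by
    rintro x y ⟨hx, hx2⟩ ⟨hy, hy2⟩
    exact ⟨fun i j h => by rw [map_add, BandMat.add_apply, hx i j h, hy i j h, add_zero],
      fun h => by rw [map_add, hx2 h, hy2 h, add_zero]⟩
  zero_mem' := ⟨fun i j _ => by simp, fun _ => by simp⟩
  smul_mem' := by
    rintro t x ⟨hx, hx2⟩
    exact ⟨fun i j h => by rw [map_smul, BandMat.smul_apply, hx i j h, smul_zero],
      fun h => by rw [map_smul, hx2 h, smul_zero]⟩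

/-! ### Matrix quantum pseudodifferential operators -/

section Quantum

/-- The space with basis `z^k T_q^n E_{i,j}`: an element assigns to `(k, n)` the matrix
coefficient of `z^k T_q^n`. -/
def QMat (_q : ℂˣ) (N : ℕ) : Type := (ℤ × ℤ) →₀ Matrix (Fin N) (Fin N) ℂ

namespace QMat

variable {q : ℂˣ} {N : ℕ}

instance : AddCommGroup (QMat q N) :=
  inferInstanceAs (AddCommGroup ((ℤ × ℤ) →₀ Matrix (Fin N) (Fin N) ℂ))

instance : Module ℂ (QMat q N) :=
  inferInstanceAs (Module ℂ ((ℤ × ℤ) →₀ Matrix (Fin N) (Fin N) ℂ))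

/-- The element `z^k T_q^n A`. -/
def mon (k n : ℤ) : Matrix (Fin N) (Fin N) ℂ →ₗ[ℂ] QMat q N :=
  Finsupp.lsingle (k, n)

/-- The linear map with prescribed values `f k n A` on the elements `z^k T_q^n A`. -/
def lift {W : Type*} [AddCommGroup W] [Module ℂ W]
    (f : ℤ → ℤ → Matrix (Fin N) (Fin N) ℂ →ₗ[ℂ] W) : QMat q N →ₗ[ℂ] W :=
  Finsupp.lsum ℂ fun p => f p.1 p.2

@[simp] theorem lift_mon {W : Type*} [AddCommGroup W] [Module ℂ W]
    (f : ℤ → ℤ → Matrix (Fin N) (Fin N) ℂ →ₗ[ℂ] W) (k n : ℤ) (A : Matrix (Fin N) (Fin N) ℂ) :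
    lift (q := q) f (mon k n A) = f k n A := by
  exact Finsupp.lsum_single ℂ (fun p : ℤ × ℤ => f p.1 p.2) (k, n) A

theorem induct {p : QMat q N → Prop} (h0 : p 0) (hadd : ∀ x y, p x → p y → p (x + y))
    (hmon : ∀ k n A, p (mon k n A)) (x : QMat q N) : p x :=
  Finsupp.induction_linear x h0 hadd fun a A => hmon a.1 a.2 A

/-- The product, `(z^k T_q^n A) (z^k' T_q^n' B) = q^(n k') z^(k+k') T_q^(n+n') A B`. -/
def mulLin : QMat q N →ₗ[ℂ] QMat q N →ₗ[ℂ] QMat q N :=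
  lift fun k n => LinearMap.flip <| lift fun k2 n2 =>
    LinearMap.mk₂ ℂ (fun B A => ((q ^ (n * k2) : ℂˣ) : ℂ) • mon (k + k2) (n + n2) (A * B))
      (by intros; rw [mul_add, map_add, smul_add])
      (by intros; rw [mul_smul_comm, map_smul, smul_comm])
      (by intros; rw [add_mul, map_add, smul_add])
      (by intros; rw [smul_mul_assoc, map_smul, smul_comm])

instance : Mul (QMat q N) := ⟨fun x y => mulLin x y⟩

theorem mul_def (x y : QMat q N) : x * y = mulLin x y := rfl

theorem mon_mul_mon (k n k2 n2 : ℤ) (A B : Matrix (Fin N) (Fin N) ℂ) :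
    (mon k n A * mon k2 n2 B : QMat q N)
      = ((q ^ (n * k2) : ℂˣ) : ℂ) • mon (k + k2) (n + n2) (A * B) := by
  simp [mul_def, mulLin]

instance : One (QMat q N) := ⟨mon 0 0 1⟩

theorem one_def : (1 : QMat q N) = mon 0 0 1 := rfl

theorem smul_mul_aux (t : ℂ) (x y : QMat q N) : (t • x) * y = t • (x * y) := by
  simp [mul_def]

theorem mul_smul_aux (t : ℂ) (x y : QMat q N) : x * (t • y) = t • (x * y) := by
  simp [mul_def]

theorem mul_assoc_aux (x y w : QMat q N) : x * y * w = x * (y * w) := by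
  induction x using induct with
  | h0 => simp [mul_def]
  | hadd x x2 h h2 => simp only [mul_def, map_add, LinearMap.add_apply] at *; rw [h, h2]
  | hmon k n A =>
    induction y using induct with
    | h0 => simp [mul_def]
    | hadd x x2 h h2 => simp only [mul_def, map_add, LinearMap.add_apply] at *; rw [h, h2]
    | hmon k2 n2 B =>
      induction w using induct with
      | h0 => simp [mul_def]
      | hadd x x2 h h2 => simp only [mul_def, map_add] at *; rw [h, h2]
      | hmon k3 n3 D =>
        rw [mon_mul_mon, mon_mul_mon, smul_mul_aux, mul_smul_aux, mon_mul_mon, mon_mul_mon,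
          smul_smul, smul_smul, mul_assoc, add_assoc, add_assoc, ← Units.val_mul,
          ← Units.val_mul, ← zpow_add, ← zpow_add]
        congr 3
        ring

instance : Ring (QMat q N) where
  __ := (inferInstance : AddCommGroup (QMat q N))
  left_distrib x y w := by simp only [mul_def, map_add]
  right_distrib x y w := by simp only [mul_def, map_add, LinearMap.add_apply]
  zero_mul x := by simp [mul_def]
  mul_zero x := by simp [mul_def]
  mul_assoc := mul_assoc_aux
  one_mul x := by
    induction x using induct with
    | h0 => simp [mul_def]
    | hadd x x2 h h2 => simp only [mul_def, map_add] at *; rw [h, h2]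
    | hmon k n A => simp [one_def, mon_mul_mon]
  mul_one x := by
    induction x using induct with
    | h0 => simp [mul_def]
    | hadd x x2 h h2 => simp only [mul_def, map_add, LinearMap.add_apply] at *; rw [h, h2]
    | hmon k n A => simp [one_def, mon_mul_mon]
  zsmul := fun n x => n • x
  neg_add_cancel x := neg_add_cancel x

instance : LieRing (QMat q N) := LieRing.ofAssociativeRing

theorem lie_def (x y : QMat q N) : ⁅x, y⁆ = x * y - y * x := rfl

instance : LieAlgebra ℂ (QMat q N) where
  lie_smul t x y := by simp only [lie_def, smul_mul_aux, mul_smul_aux, smul_sub]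

/-- The derivation `z d/dz`. -/
def deg : QMat q N →ₗ[ℂ] QMat q N := lift fun k n => (k : ℂ) • mon k n

/-- The trace of the coefficient of `z^0 T_q^0`. -/
def tr0 : QMat q N →ₗ[ℂ] ℂ :=
  lift fun k n => if k = 0 ∧ n = 0 then Matrix.traceLinearMap (Fin N) ℂ ℂ else 0

/-- The cocycle `ψ(x, y) = tr_0 tr ((z d/dz x) y)`. -/
def psi : QMat q N →ₗ[ℂ] QMat q N →ₗ[ℂ] ℂ :=
  (LinearMap.compr₂ mulLin tr0).comp deg

theorem psi_apply (x y : QMat q N) : psi x y = tr0 (deg x * y) := rfl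

/-- `ψ(z^k T_q^a A, z^k' T_q^b B) = δ_{k,-k'} k tr_0((q^(-k) T_q)^a T_q^b) tr(AB)`. -/
theorem psi_mon (k a k2 b : ℤ) (A B : Matrix (Fin N) (Fin N) ℂ) :
    psi (mon k a A : QMat q N) (mon k2 b B) = if k = -k2 then
      k * (if a + b = 0 then ((q ^ (-k * a) : ℂˣ) : ℂ) else 0) * (A * B).trace else 0 := by
  rw [psi_apply, deg, lift_mon, LinearMap.smul_apply, smul_mul_aux, mon_mul_mon, map_smul,
    map_smul, tr0, lift_mon]
  by_cases h : k = -k2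
  · subst h
    by_cases h2 : a + b = 0
    · simp [h2, mul_assoc, mul_comm a]
    · simp [h2]
  · have h3 : ¬ (k + k2 = 0) := fun h4 => h (by omega)
    simp [h, h3]

theorem deg_mul (x y : QMat q N) : deg (x * y) = deg x * y + x * deg y := by
  induction x using induct with
  | h0 => simp
  | hadd x x2 h h2 => rw [add_mul, map_add, h, h2, map_add, add_mul, add_mul]; abel
  | hmon k n A =>
    induction y using induct with
    | h0 => simp
    | hadd x x2 h h2 => rw [mul_add, map_add, h, h2, map_add, mul_add, mul_add]; abel
    | hmon k2 n2 B =>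
      simp only [deg, mon_mul_mon, map_smul, lift_mon, LinearMap.smul_apply, smul_mul_aux,
        mul_smul_aux, ← add_smul]
      rw [smul_comm]
      push_cast
      rfl

theorem tr0_mul_comm (x y : QMat q N) : tr0 (x * y) = tr0 (y * x) := by
  induction x using induct with
  | h0 => simp
  | hadd x x2 h h2 => rw [add_mul, map_add, h, h2, mul_add, map_add]
  | hmon k n A =>
    induction y using induct with
    | h0 => simp
    | hadd x x2 h h2 => rw [mul_add, map_add, h, h2, add_mul, map_add]
    | hmon k2 n2 B =>
      rw [mon_mul_mon, mon_mul_mon, map_smul, map_smul, tr0, lift_mon, lift_mon]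
      by_cases h : k + k2 = 0 ∧ n + n2 = 0
      · have hk : k2 = -k := by omega
        have hn : n2 = -n := by omega
        subst hk hn
        simp [Matrix.trace_mul_comm A B]
      · rw [if_neg h, if_neg (by omega)]
        simp

theorem tr0_deg (x : QMat q N) : tr0 (deg x) = 0 := by
  induction x using induct with
  | h0 => simp
  | hadd x x2 h h2 => rw [map_add, map_add, h, h2, add_zero]
  | hmon k n A =>
    simp only [deg, tr0, lift_mon, LinearMap.smul_apply, map_smul]
    by_cases h : k = 0
    · simp [h]
    · simp [h]

/-- The 2-cocycle `ψ`. -/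
def cocycle : Cocycle (QMat q N) ℂ where
  toBilin := psi
  alt x := by
    have h := tr0_deg (x * x)
    rw [deg_mul, map_add, tr0_mul_comm x (deg x), ← two_mul] at h
    exact (mul_eq_zero.1 h).resolve_left two_ne_zero
  jacobi x y w := by
    have hm : ∀ a b c : QMat q N, tr0 (deg (a * b) * c)
        = tr0 (deg a * (b * c)) + tr0 (deg b * (c * a)) := by
      intro a b c
      rw [deg_mul, add_mul, map_add, mul_assoc, mul_assoc, tr0_mul_comm a, mul_assoc]
    simp only [lie_def, map_sub, LinearMap.sub_apply, psi_apply, hm]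
    abel

/-- The anti-involution `σ(z^k T_q^n E_{i,j}) = ε^k q^(k(k-1)r/2) z^k (q^(1-k) T_q⁻¹)^n T_q^(kr)
E_{N+1-j,N+1-i}`. -/
def sigma (ε : ℤˣ) (r : ℤ) : QMat q N →ₗ[ℂ] QMat q N :=
  lift fun k n => (ε ^ k) • ((q ^ (k * (k - 1) / 2 * r + (1 - k) * n) : ℂˣ) : ℂ) •
    (mon k (k * r - n)).comp
      ((Matrix.reindexLinearEquiv ℂ ℂ Fin.revPerm Fin.revPerm).toLinearMap.comp
        (Matrix.transposeLinearEquiv (Fin N) (Fin N) ℂ ℂ).toLinearMap)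

theorem sigma_mon (ε : ℤˣ) (r k n : ℤ) (A : Matrix (Fin N) (Fin N) ℂ) :
    sigma ε r (mon k n A : QMat q N) = (ε ^ k) •
      ((q ^ (k * (k - 1) / 2 * r + (1 - k) * n) : ℂˣ) : ℂ) •
        mon k (k * r - n) (A.transpose.submatrix Fin.rev Fin.rev) := by
  rw [sigma, lift_mon]
  rfl

theorem half_add (k l : ℤ) :
    (k + l) * (k + l - 1) / 2 = k * (k - 1) / 2 + l * (l - 1) / 2 + k * l := by
  obtain ⟨a, ha⟩ : ∃ a, k * (k - 1) = 2 * a := by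
    have h := Int.even_mul_pred_self k
    rw [even_iff_exists_two_mul] at h
    exact h
  obtain ⟨b, hb⟩ : ∃ b, l * (l - 1) = 2 * b := by
    have h := Int.even_mul_pred_self l
    rw [even_iff_exists_two_mul] at h
    exact h
  have h3 : (k + l) * (k + l - 1) = 2 * (a + b + k * l) := by linear_combination ha + hb
  rw [ha, hb, h3]
  simp

theorem sigma_mul (ε : ℤˣ) (r : ℤ) (x y : QMat q N) :
    sigma ε r (x * y) = sigma ε r y * sigma ε r x := by
  induction x using induct with
  | h0 => simp
  | hadd x x2 h h2 => rw [add_mul, map_add, h, h2, map_add, mul_add]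
  | hmon k n A =>
    induction y using induct with
    | h0 => simp
    | hadd x x2 h h2 => rw [mul_add, map_add, h, h2, map_add, add_mul]
    | hmon k2 n2 B =>
      have hA : (B.transpose.submatrix Fin.rev Fin.rev) * (A.transpose.submatrix Fin.rev Fin.rev)
          = (A * B).transpose.submatrix Fin.rev Fin.rev := by
        rw [Matrix.transpose_mul]
        exact Matrix.submatrix_mul_equiv _ _ _ Fin.revPerm _
      have hs : ∀ (e : ℤˣ) (x y : QMat q N), (e • x) * y = e • (x * y) := by
        intro e x y
        rcases Int.units_eq_one_or e with rfl | rfl <;> simp [Units.smul_def]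
      have hs2 : ∀ (e : ℤˣ) (x y : QMat q N), x * (e • y) = e • (x * y) := by
        intro e x y
        rcases Int.units_eq_one_or e with rfl | rfl <;> simp [Units.smul_def]
      have hs3 : ∀ (e : ℤˣ) (t : ℂ) (x : QMat q N), t • (e • x) = e • (t • x) := by
        intro e t x
        rcases Int.units_eq_one_or e with rfl | rfl <;> simp [Units.smul_def]
      rw [mon_mul_mon, map_smul, sigma_mon, sigma_mon, sigma_mon, hs, hs2, smul_mul_aux,
        mul_smul_aux, mon_mul_mon, hA, hs3, smul_smul, smul_smul, smul_smul, smul_smul,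
        ← zpow_add, ← Units.val_mul, ← Units.val_mul, ← Units.val_mul, ← zpow_add,
        ← zpow_add, ← zpow_add, add_comm k2 k, half_add]
      congr 3
      · congr 1
        ring
      · congr 1
        ring

end QMat

/-- The Lie algebra `S_{q,N}^{ε,r}` of the elements with `σ(x) = -x`. -/
def qFixed (q : ℂˣ) (N : ℕ) (ε : ℤˣ) (r : ℤ) : LieSubalgebra ℂ (QMat q N) where
  carrier := {x | QMat.sigma ε r x = -x}
  add_mem' := by
    intro x y hx hy
    rw [Set.mem_ofPred_eq] at *
    rw [map_add, hx, hy, neg_add]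
  zero_mem' := by simp
  smul_mem' := by
    intro t x hx
    rw [Set.mem_ofPred_eq] at *
    rw [map_smul, hx, smul_neg]
  lie_mem' := by
    intro x y hx hy
    have hx : QMat.sigma ε r x = -x := hx
    have hy : QMat.sigma ε r y = -y := hy
    change QMat.sigma ε r ⁅x, y⁆ = -⁅x, y⁆
    rw [QMat.lie_def, map_sub, QMat.sigma_mul, QMat.sigma_mul, hx, hy]
    noncomm_ring

/-- The restriction of a cocycle to a subalgebra. -/
def Cocycle.restrict {L Z : Type*} [LieRing L] [LieAlgebra ℂ L] [AddCommGroup Z] [Module ℂ Z]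
    (c : Cocycle L Z) (S : LieSubalgebra ℂ L) : Cocycle S Z where
  toBilin := c.toBilin.compl₁₂ S.subtype S.subtype
  alt x := c.alt x
  jacobi x y z := c.jacobi x y z

/-- The central extension of `S_{q,N}^{ε,r}` by `ℂ C` defined by `ψ`. -/
abbrev QHat (q : ℂˣ) (N : ℕ) (ε : ℤˣ) (r : ℤ) : Type :=
  CentralExt ((QMat.cocycle (q := q) (N := N)).restrict (qFixed q N ε r))

end Quantum

/-! ### The homomorphism to infinite matrices -/

theorem support_step {K : Type*} [CommRing K] (k : ℤ) (W : ℤ → K) : (Function.support fun l : ℤ =>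
    ((if l ≤ 0 then 1 else 0) - (if l + k ≤ 0 then 1 else 0)) * W l).Finite := by
  refine (Set.finite_Icc (-|k|) |k|).subset fun l hl => ?_
  by_contra hc
  refine hl ?_
  rw [Set.mem_Icc, not_and_or] at hc
  have h1 := abs_le.1 (le_refl |k|)
  have h2 : l ≤ 0 ↔ l + k ≤ 0 := by omega
  simp [h2]

theorem sum_step {K : Type*} [CommRing K] (k : ℤ) (D : ℤ → K) : ∑ᶠ l : ℤ,
    ((if l ≤ 0 then 1 else 0) - (if l + k ≤ 0 then 1 else 0)) * (D l - D (l - 1))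
      = D 0 - D (-k) := by
  have step : ∀ k : ℤ, ∑ᶠ l : ℤ,
      ((if l ≤ 0 then 1 else 0) - (if l + (k + 1) ≤ 0 then 1 else 0)) * (D l - D (l - 1))
      = (∑ᶠ l : ℤ, ((if l ≤ 0 then 1 else 0) - (if l + k ≤ 0 then 1 else 0))
        * (D l - D (l - 1))) + (D (-k) - D (-k - 1)) := by
    intro k
    have h1 : D (-k) - D (-k - 1) = ∑ᶠ l : ℤ, if l = -k then D l - D (l - 1) else 0 := by
      rw [finsum_eq_single _ (-k)]
      · simp
      · intro l hl
        simp [hl]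
    rw [h1, ← finsum_add_distrib (support_step k _)]
    · refine finsum_congr fun l => ?_
      by_cases hl : l = -k
      · subst hl
        have h2 : ¬ (-k + (k + 1) ≤ 0) := by omega
        have h3 : -k + k ≤ 0 := by omega
        simp only [h2, h3, if_true, if_false]
        ring
      · have h2 : l + (k + 1) ≤ 0 ↔ l + k ≤ 0 := by omega
        simp [h2, hl]
    · refine (Set.finite_singleton (-k)).subset fun l hl => ?_
      by_contra hc
      exact hl (if_neg hc)
  induction k using Int.induction_on with
  | zero => simp
  | succ k ih =>
    rw [step, ih]
    have : (-(k + 1 : ℤ)) = -(k : ℤ) - 1 := by ring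
    rw [this]
    ring
  | pred k ih =>
    have h := step (-(k : ℤ) - 1)
    rw [sub_add_cancel, ih] at h
    rw [eq_sub_of_add_eq h.symm, neg_neg]
    have h2 : -(-(k : ℤ) - 1) - 1 = k := by ring
    rw [h2]
    ring

section Blocks

variable (N : ℕ) [NeZero N]

/-- Every integer is uniquely `p = l N - i` with `0 ≤ i < N`; this is `l`. -/
def blk (p : ℤ) : ℤ := -((-p) / (N : ℤ))

/-- Every integer is uniquely `p = l N - i` with `0 ≤ i < N`; this is `i`. -/
def pos (p : ℤ) : Fin N := ⟨((-p) % (N : ℤ)).toNat, by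
  have h0 : (0 : ℤ) < N := by exact_mod_cast Nat.pos_of_neZero N
  have h1 := Int.emod_nonneg (-p) h0.ne'
  have h2 := Int.emod_lt_of_pos (-p) h0
  omega⟩

theorem pos_val (p : ℤ) : ((pos N p : ℕ) : ℤ) = (-p) % (N : ℤ) := by
  have h0 : (0 : ℤ) < N := by exact_mod_cast Nat.pos_of_neZero N
  exact Int.toNat_of_nonneg (Int.emod_nonneg (-p) h0.ne')

theorem blk_mul_sub (p : ℤ) : blk N p * N - (pos N p : ℕ) = p := by
  rw [pos_val, blk]
  have := Int.mul_ediv_add_emod (-p) N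
  linarith

theorem blk_pos_unique {p l : ℤ} {i : Fin N} (h : l * N - (i : ℕ) = p) :
    blk N p = l ∧ pos N p = i := by
  have h0 : (0 : ℤ) < N := by exact_mod_cast Nat.pos_of_neZero N
  have hi : ((i : ℕ) : ℤ) < N := by exact_mod_cast i.2
  have h1 : -p = (i : ℕ) + (-l) * N := by linarith
  constructor
  · rw [blk, h1, Int.add_mul_ediv_right _ _ h0.ne', Int.ediv_eq_zero_of_lt (by positivity) hi]
    ring
  · apply Fin.ext
    have h2 := pos_val N p
    rw [h1, Int.add_mul_emod_self_right, Int.emod_eq_of_lt (by positivity) hi] at h2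
    exact_mod_cast h2

/-- The bijection `p ↦ (l, i)`. -/
def blkEquiv : ℤ ≃ ℤ × Fin N where
  toFun p := (blk N p, pos N p)
  invFun x := x.1 * N - (x.2 : ℕ)
  left_inv p := blk_mul_sub N p
  right_inv _ := Prod.ext (blk_pos_unique N rfl).1 (blk_pos_unique N rfl).2

theorem blk_nonpos (p : ℤ) : blk N p ≤ 0 ↔ p ≤ 0 := by
  have h0 : (0 : ℤ) < N := by exact_mod_cast Nat.pos_of_neZero N
  rw [blk, neg_nonpos, Int.ediv_nonneg_iff_of_pos h0]
  omega

theorem blk_mirror (p e : ℤ) : blk N (1 + (e - 1) * N - p) = e - blk N p ∧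
    pos N (1 + (e - 1) * N - p) = (pos N p).rev := by
  apply blk_pos_unique
  have h := blk_mul_sub N p
  have h2 : (((pos N p).rev : ℕ) : ℤ) = N - 1 - (pos N p : ℕ) := by
    rw [Fin.val_rev]
    have := (pos N p).2
    omega
  rw [h2]
  linear_combination -h

variable {N} {K : Type*} [CommRing K] [Algebra ℂ K]

/-- The block matrix whose blocks at `(l - k, l)` are `F(l) A`, and zero otherwise. -/
def blockMat (k : ℤ) (F : ℤ → K) (A : Matrix (Fin N) (Fin N) ℂ) : BandMat K :=
  BandMat.of (fun p p2 => if blk N p2 - blk N p = k then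
      A (pos N p) (pos N p2) • F (blk N p2) else 0)
    ⟨(k.natAbs + 1) * N, fun p p2 h => by
      rw [if_neg]
      intro hk
      have h1 := blk_mul_sub N p
      have h2 := blk_mul_sub N p2
      have h3 : ((pos N p : ℕ) : ℤ) < N := by exact_mod_cast (pos N p).2
      have h4 : ((pos N p2 : ℕ) : ℤ) < N := by exact_mod_cast (pos N p2).2
      have h5 : p2 - p = k * N + ((pos N p : ℕ) - (pos N p2 : ℕ) : ℤ) := by
        linear_combination h1 - h2 + N * hk
      have h6 : |p - p2| ≤ |k| * N + N := by
        rw [abs_sub_comm, h5]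
        refine (abs_add_le _ _).trans (add_le_add (by simp [abs_mul]) ?_)
        rw [abs_le]
        omega
      push_cast at h
      linarith⟩

theorem blockMat_apply (k : ℤ) (F : ℤ → K) (A : Matrix (Fin N) (Fin N) ℂ) (p p2 : ℤ) :
    blockMat k F A p p2 = if blk N p2 - blk N p = k then
      A (pos N p) (pos N p2) • F (blk N p2) else 0 := rfl

theorem blockMat_mul (k k2 : ℤ) (F G : ℤ → K) (A B : Matrix (Fin N) (Fin N) ℂ) :
    blockMat k F A * blockMat k2 G B
      = blockMat (k + k2) (fun l => F (l - k2) * G l) (A * B) := by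
  ext p p2
  rw [BandMat.mul_apply_sum _ _ _ _ (Finset.univ.map
    ((Function.Embedding.sectR (blk N p + k) (Fin N)).trans (blkEquiv N).symm.toEmbedding))]
  · rw [Finset.sum_map]
    have hb : ∀ j : Fin N, blk N ((blkEquiv N).symm (blk N p + k, j)) = blk N p + k := fun j =>
      (blk_pos_unique N rfl).1
    have hp : ∀ j : Fin N, pos N ((blkEquiv N).symm (blk N p + k, j)) = j := fun j =>
      (blk_pos_unique N rfl).2
    simp only [Function.Embedding.trans_apply, Function.Embedding.sectR_apply,
      Equiv.coe_toEmbedding, blockMat_apply, hb, hp, add_sub_cancel_left, if_true]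
    by_cases h : blk N p2 - (blk N p + k) = k2
    · have h2 : blk N p2 - blk N p = k + k2 := by omega
      have h3 : blk N p2 - k2 = blk N p + k := by omega
      simp only [if_pos h, if_pos h2, h3, Matrix.mul_apply, Finset.sum_smul, smul_mul_smul_comm]
    · have h2 : ¬ blk N p2 - blk N p = k + k2 := by omega
      simp [h, h2]
  · intro x hx
    rw [blockMat_apply, if_neg, zero_mul]
    intro h
    refine hx ?_
    rw [Finset.mem_map]
    refine ⟨pos N x, Finset.mem_univ _, ?_⟩
    have h2 : blk N p + k = blk N x := by omega
    simp only [Function.Embedding.trans_apply, Function.Embedding.sectR_apply,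
      Equiv.coe_toEmbedding, h2]
    exact (blkEquiv N).symm_apply_apply x

theorem lie_J_blockMat (k : ℤ) (F : ℤ → K) (A : Matrix (Fin N) (Fin N) ℂ) :
    ⁅BandMat.J K, blockMat k F A⁆ = blockMat k
      (fun l => ((if l - k ≤ 0 then 1 else 0) - (if l ≤ 0 then 1 else 0)) * F l) A := by
  ext p p2
  rw [BandMat.lie_J_apply, blockMat_apply, blockMat_apply]
  by_cases h : blk N p2 - blk N p = k
  · have h2 : blk N p2 - k = blk N p := by omega
    simp only [if_pos h, h2, blk_nonpos, mul_smul_comm]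
  · simp only [if_neg h, mul_zero]

theorem trace_blockMat (H : ℤ → K) (hH : (Function.support H).Finite)
    (A : Matrix (Fin N) (Fin N) ℂ) :
    BandMat.trace (blockMat 0 H A) = A.trace • ∑ᶠ l, H l := by
  have h1 : BandMat.trace (blockMat 0 H A)
      = ∑ᶠ x : ℤ × Fin N, A x.2 x.2 • H x.1 := by
    rw [BandMat.trace, ← finsum_comp_equiv (blkEquiv N)]
    refine finsum_congr fun p => ?_
    rw [blockMat_apply, sub_self, if_pos rfl]
    rfl
  rw [h1, finsum_eq_sum_of_support_subset (s := hH.toFinset ×ˢ Finset.univ),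
    finsum_eq_sum_of_support_subset (s := hH.toFinset), Finset.sum_product, Finset.smul_sum]
  · refine Finset.sum_congr rfl fun l _ => ?_
    rw [Matrix.trace, Finset.sum_smul]
    rfl
  · simp
  · rintro ⟨l, i⟩ h
    have h2 : H l ≠ 0 := fun hc => h (by simp [hc])
    simpa using h2

theorem cocycle_blockMat_ne (k k2 : ℤ) (h : k + k2 ≠ 0) (F G : ℤ → K)
    (A B : Matrix (Fin N) (Fin N) ℂ) :
    BandMat.cocycle.toBilin (blockMat k F A) (blockMat k2 G B) = 0 := by
  rw [BandMat.cocycle_apply, lie_J_blockMat, blockMat_mul, BandMat.trace]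
  refine finsum_eq_zero_of_forall_eq_zero fun p => ?_
  rw [blockMat_apply, if_neg]
  omega

theorem cocycle_blockMat_neg (k : ℤ) (F G : ℤ → K) (A B : Matrix (Fin N) (Fin N) ℂ) :
    BandMat.cocycle.toBilin (blockMat k F A) (blockMat (-k) G B) = (A * B).trace •
      ∑ᶠ l : ℤ, ((if l ≤ 0 then 1 else 0) - (if l + k ≤ 0 then 1 else 0)) *
        (F (l + k) * G l) := by
  rw [BandMat.cocycle_apply, lie_J_blockMat, blockMat_mul, add_neg_cancel]
  have h1 : (fun l : ℤ => (((if l - -k - k ≤ 0 then (1 : K) else 0)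
      - (if l - -k ≤ 0 then 1 else 0)) * F (l - -k)) * G l)
      = fun l : ℤ => ((if l ≤ 0 then 1 else 0) - (if l + k ≤ 0 then 1 else 0)) *
        (F (l + k) * G l) := by
    funext l
    rw [sub_neg_eq_add, add_sub_cancel_right, mul_assoc]
  rw [h1, trace_blockMat _ (support_step k _)]

end Blocks

section Phi

variable {q : ℂˣ} {N : ℕ} [NeZero N] {ℓ : ℂ}

/-- `z^k T_q^n E_{i,j} ↦ ∑_l (s q^(-l+u))^n E_{(l-k)N-i+1, lN-j+1}` with `s = q^a`. -/
def phiMat (q : ℂˣ) (N : ℕ) [NeZero N] (ℓ a : ℂ) (m : ℕ) : QMat q N →ₗ[ℂ] GlInf m :=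
  QMat.lift fun k n =>
    { toFun := fun A => blockMat k (fun l => qpow ℓ m n (a - l)) A
      map_add' := fun A B => by
        ext p p2
        simp only [BandMat.add_apply, blockMat_apply, Matrix.add_apply, add_smul]
        split_ifs <;> simp
      map_smul' := fun t A => by
        ext p p2
        simp only [BandMat.smul_apply, blockMat_apply, Matrix.smul_apply, smul_assoc,
          RingHom.id_apply]
        split_ifs <;> simp }

theorem phiMat_mon (a : ℂ) (m : ℕ) (k n : ℤ) (A : Matrix (Fin N) (Fin N) ℂ) :
    phiMat q N ℓ a m (QMat.mon k n A) = blockMat k (fun l => qpow ℓ m n (a - l)) A :=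
  QMat.lift_mon _ _ _ _

/-- The value in the centre: `(1 - q^n)⁻¹ q^(n(a+u)) tr A` on `z^0 T_q^n A`, `n ≠ 0`, and zero on
the other `z^k T_q^n A`. -/
def phiCentre (q : ℂˣ) (N : ℕ) (ℓ a : ℂ) (m : ℕ) : QMat q N →ₗ[ℂ] TruncPoly m :=
  QMat.lift fun k n => if k = 0 ∧ n ≠ 0 then
    (Matrix.traceLinearMap (Fin N) ℂ ℂ).smulRight
      ((1 - ((q ^ n : ℂˣ) : ℂ))⁻¹ • qpow ℓ m n a) else 0

theorem exp_int (hℓ : Complex.exp ℓ = q) (n c : ℤ) :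
    Complex.exp ((n : ℂ) * ℓ * c) = ((q ^ (n * c) : ℂˣ) : ℂ) := by
  rw [Units.val_zpow_eq_zpow_val, ← hℓ, ← Complex.exp_int_mul]
  congr 1
  push_cast
  ring

theorem qpow_int (hℓ : Complex.exp ℓ = q) (m : ℕ) (n c : ℤ) (b : ℂ) :
    qpow ℓ m n (b + c) = ((q ^ (n * c) : ℂˣ) : ℂ) • qpow ℓ m n b := by
  rw [qpow_shift, exp_int hℓ]

theorem blockMat_smul {K : Type*} [CommRing K] [Algebra ℂ K] (k : ℤ) (t : ℂ) (F : ℤ → K)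
    (A : Matrix (Fin N) (Fin N) ℂ) :
    blockMat k (fun l => t • F l) A = t • blockMat k F A := by
  ext p p2
  rw [BandMat.smul_apply, blockMat_apply, blockMat_apply, smul_ite, smul_zero, smul_comm]

theorem phiMat_mul (hℓ : Complex.exp ℓ = q) (a : ℂ) (m : ℕ) (x y : QMat q N) :
    phiMat q N ℓ a m (x * y) = phiMat q N ℓ a m x * phiMat q N ℓ a m y := by
  induction x using QMat.induct with
  | h0 => simp
  | hadd x x2 h h2 => rw [add_mul, map_add, h, h2, map_add, add_mul]
  | hmon k n A =>
    induction y using QMat.induct with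
    | h0 => simp
    | hadd x x2 h h2 => rw [mul_add, map_add, h, h2, map_add, mul_add]
    | hmon k2 n2 B =>
      rw [QMat.mon_mul_mon, map_smul, phiMat_mon, phiMat_mon, phiMat_mon, blockMat_mul,
        ← blockMat_smul]
      congr 1
      funext l
      have h1 : a - ((l - k2 : ℤ) : ℂ) = (a - l) + k2 := by push_cast; ring
      rw [h1, qpow_int hℓ, smul_mul_assoc, ← qpow_add, Int.cast_add]

theorem one_sub_zpow_ne (hq : ‖(q : ℂ)‖ ≠ 1) {n : ℤ} (hn : n ≠ 0) :
    1 - ((q ^ n : ℂˣ) : ℂ) ≠ 0 := by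
  intro h
  have h1 : ‖(q : ℂ)‖ ^ n = 1 := by
    rw [← norm_zpow, ← Units.val_zpow_eq_zpow_val, ← sub_eq_zero.1 h, norm_one]
  rcases zpow_eq_one_iff_of_ne_zero₀ hn |>.1 h1 with h2 | h2
  · exact hq h2
  · have := norm_nonneg (q : ℂ)
    linarith [h2.1]

theorem phiMat_cocycle (hℓ : Complex.exp ℓ = q) (hq : ‖(q : ℂ)‖ ≠ 1) (a : ℂ) (m : ℕ)
    (x y : QMat q N) :
    BandMat.cocycle.toBilin (phiMat q N ℓ a m x) (phiMat q N ℓ a m y)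
      = phiCentre q N ℓ a m ⁅x, y⁆ + QMat.cocycle.toBilin x y • 1 := by
  induction x using QMat.induct with
  | h0 => simp
  | hadd x x2 h h2 =>
    rw [add_lie, map_add, map_add, map_add, map_add, LinearMap.add_apply, LinearMap.add_apply,
      h, h2, add_smul]
    abel
  | hmon k n A =>
    induction y using QMat.induct with
    | h0 => simp
    | hadd x x2 h h2 =>
      rw [lie_add, map_add, map_add, map_add, map_add, h, h2, add_smul]
      abel
    | hmon k2 n2 B =>
      rw [phiMat_mon, phiMat_mon, QMat.lie_def, QMat.mon_mul_mon, QMat.mon_mul_mon, map_sub,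
        map_smul, map_smul, phiCentre, QMat.lift_mon, QMat.lift_mon]
      have hψ := QMat.psi_mon (q := q) k n k2 n2 A B
      change QMat.cocycle.toBilin _ _ = _ at hψ
      rw [hψ]
      by_cases hk : k + k2 = 0
      · obtain rfl : k2 = -k := by omega
        rw [cocycle_blockMat_neg]
        have hFG : ∀ l : ℤ, qpow ℓ m n (a - ((l + k : ℤ) : ℂ)) * qpow ℓ m n2 (a - l)
            = ((q ^ (-(n * k) - (n + n2) * l) : ℂˣ) : ℂ) • qpow ℓ m (n + n2 : ℤ) a := by
          intro l
          have h1 : a - ((l + k : ℤ) : ℂ) = a + ((-(l + k) : ℤ) : ℂ) := by push_cast; ring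
          have h2 : a - (l : ℂ) = a + ((-l : ℤ) : ℂ) := by push_cast; ring
          rw [h1, h2, qpow_int hℓ, qpow_int hℓ, smul_mul_smul_comm, ← qpow_add, Int.cast_add,
            ← Units.val_mul, ← zpow_add]
          congr 3
          ring
        by_cases hn : n + n2 = 0
        · obtain rfl : n2 = -n := by omega
          have hs := sum_step k fun l : ℤ =>
            (l : ℂ) • ((q ^ (-(n * k)) : ℂˣ) : ℂ) • (1 : TruncPoly m)
          have e : ∀ l : ℤ, qpow ℓ m n (a - ((l + k : ℤ) : ℂ)) * qpow ℓ m (-n : ℤ) (a - l)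
              = (l : ℂ) • ((q ^ (-(n * k)) : ℂˣ) : ℂ) • (1 : TruncPoly m)
                - ((l - 1 : ℤ) : ℂ) • ((q ^ (-(n * k)) : ℂˣ) : ℂ) • (1 : TruncPoly m) := by
            intro l
            rw [hFG, add_neg_cancel, zero_mul, sub_zero, ← sub_smul, Int.cast_zero, qpow_zero]
            push_cast
            rw [sub_sub_cancel, one_smul]
          simp only [e]
          rw [hs, if_neg (by omega), if_neg (by omega), if_pos (by omega), if_pos hn,
            LinearMap.zero_apply, LinearMap.zero_apply, smul_zero, smul_zero, sub_zero, zero_add,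
            ← sub_smul, smul_smul, smul_smul, neg_mul, mul_comm n k]
          congr 1
          push_cast
          ring
        · have hnz : n2 + n ≠ 0 := by omega
          set c : ℂ := (1 - ((q ^ (n + n2) : ℂˣ) : ℂ))⁻¹ with hc
          have hc1 : c * (1 - ((q ^ (n + n2) : ℂˣ) : ℂ)) = 1 :=
            inv_mul_cancel₀ (one_sub_zpow_ne hq hn)
          have hs := sum_step k fun l : ℤ => (c * ((q ^ (-(n * k) - (n + n2) * l) : ℂˣ) : ℂ)) •
            qpow ℓ m (n + n2 : ℤ) a
          have e : ∀ l : ℤ, qpow ℓ m n (a - ((l + k : ℤ) : ℂ)) * qpow ℓ m n2 (a - l)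
              = (c * ((q ^ (-(n * k) - (n + n2) * l) : ℂˣ) : ℂ)) • qpow ℓ m (n + n2 : ℤ) a
              - (c * ((q ^ (-(n * k) - (n + n2) * (l - 1)) : ℂˣ) : ℂ)) •
                qpow ℓ m (n + n2 : ℤ) a := by
            intro l
            rw [hFG, ← sub_smul]
            congr 1
            have h3 : -(n * k) - (n + n2) * (l - 1) = (-(n * k) - (n + n2) * l) + (n + n2) := by
              ring
            rw [h3, zpow_add, Units.val_mul]
            linear_combination (-((q ^ (-(n * k) - (n + n2) * l) : ℂˣ) : ℂ)) * hc1
          simp only [e]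
          rw [hs, if_pos ⟨hk, hn⟩, if_pos ⟨by omega, hnz⟩, add_comm n2 n, ← hc]
          simp only [hn, if_false, mul_zero, zero_mul, neg_neg, if_true, zero_smul, add_zero,
            LinearMap.smulRight_apply, Matrix.traceLinearMap_apply, smul_smul, ← sub_smul]
          congr 1
          rw [Matrix.trace_mul_comm B A]
          have h4 : -(n * k) - (n + n2) * -k = n2 * k := by ring
          have h5 : -(n * k) - (n + n2) * 0 = n * -k := by ring
          rw [h4, mul_neg n k, sub_zero]
          ring
      · have hk2 : ¬ (k2 + k = 0) := by omega
        have hk3 : ¬ (k = -k2) := by omega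
        rw [cocycle_blockMat_ne _ _ hk]
        simp [hk, hk2, hk3]

/-- The homomorphism extended to the central extensions. -/
def phiHat (hℓ : Complex.exp ℓ = q) (hq : ‖(q : ℂ)‖ ≠ 1) (a : ℂ) (m : ℕ) (ε : ℤˣ) (r : ℤ) :
    QHat q N ε r →ₗ⁅ℂ⁆ GlHat m where
  toFun x := CentralExt.mk _ (phiMat q N ℓ a m x.base)
    (phiCentre q N ℓ a m x.base + x.centre • 1)
  map_add' x y := by
    ext1
    · simp
    · have h : phiCentre q N ℓ a m ((x + y).base : QMat q N)
          = phiCentre q N ℓ a m x.base + phiCentre q N ℓ a m y.base := by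
        rw [← map_add]
        rfl
      simp only [map_add, CentralExt.centre_mk, add_smul] at h ⊢
      rw [h]
      abel
  map_smul' t x := by
    ext1
    · simp
    · simp [smul_smul]
  map_lie' {x y} := by
    ext1
    · simp [BandMat.lie_def, QMat.lie_def, phiMat_mul hℓ]
    · simp only [CentralExt.base_lie, CentralExt.centre_lie, CentralExt.centre_mk,
        CentralExt.base_mk, phiMat_cocycle hℓ hq]
      rfl

end Phi

section Special

variable {q : ℂˣ} {N : ℕ} [NeZero N] {ℓ : ℂ}

/-- For `l = blk (x - c)`: the sign `ε^l η^x` if `x > 0`, and `1` otherwise. -/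
def signAt (N : ℕ) (ε η : ℤˣ) (c : ℕ) (x : ℤ) : ℤˣ :=
  if 0 < x then ε ^ blk N (x - c) * η ^ x else 1

/-- The diagonal entry `± q^(r l (a + u - (l + 1) / 2) / 2)`, where `l = blk (x - c)`. -/
def weightAt (N : ℕ) (ℓ : ℂ) (ε η : ℤˣ) (r : ℤ) (a : ℂ) (m c : ℕ) (x : ℤ) : (TruncPoly m)ˣ :=
  Units.map (Int.castRingHom (TruncPoly m)).toMonoidHom (signAt N ε η c x) *
    qpowUnit ℓ m (r * blk N (x - c) / 2) (a - (blk N (x - c) + 1) / 2)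

theorem signAt_mirror (ε η : ℤˣ) (c : ℕ) (κ e : ℤ) (hκ : κ = 0 ∨ κ = 1)
    (h : κ - 2 * c = 1 + (e - 1) * N) (h1 : κ = 1 → η * ε ^ e = 1) (h0 : κ = 0 → e = 0)
    (i j : ℤ) : ε ^ (blk N (j - c) - blk N (i - c)) * (signAt N ε η c i * signAt N ε η c j)
      = η ^ (i + j) * (signAt N ε η c (κ - j) * signAt N ε η c (κ - i)) := by
  have hm : ∀ x : ℤ, blk N (κ - x - c) = e - blk N (x - c) := fun x => by
    rw [← (blk_mirror N (x - c) e).1]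
    congr 1
    linear_combination h
  have hsub : ∀ (s : ℤˣ) (x y : ℤ), s ^ (x - y) = s ^ x * s ^ y := fun s x y => by
    rw [zpow_sub, Int.units_inv_eq_self]
  have hz : κ = 0 → blk N (0 - c) = 0 := fun hk => by
    have h2 := hm 0
    rw [hk, h0 hk] at h2
    simp only [sub_zero] at h2
    omega
  simp only [signAt, hm, hsub, zpow_add]
  rcases hκ with rfl | rfl
  · have key : ∀ x : ℤ, x = 0 → ε ^ blk N (x - c) = 1 ∧ η ^ x = 1 := by
      rintro x rfl
      rw [hz rfl]
      simp
    have hi := key i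
    have hj := key j
    rw [h0 rfl, zpow_zero, zpow_zero]
    generalize ε ^ blk N (i - c) = E1 at *
    generalize ε ^ blk N (j - c) = E2 at *
    generalize η ^ i = H1 at *
    generalize η ^ j = H2 at *
    by_cases ei : i = 0 <;> by_cases ej : j = 0
    all_goals
      simp only [ei, ej, forall_const, false_imp_iff] at hi hj
      try rw [hi.1, hi.2]
      try rw [hj.1, hj.2]
      split_ifs <;> first
        | (exfalso; omega)
        | (clear * -
           decide +revert)
  · have h1 := h1 rfl
    rw [zpow_one]
    generalize ε ^ blk N (i - c) = E1 at *
    generalize ε ^ blk N (j - c) = E2 at *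
    generalize η ^ i = H1 at *
    generalize η ^ j = H2 at *
    generalize ε ^ e = E at *
    split_ifs <;> first
      | (exfalso; omega)
      | (clear * - h1
         revert h1 E E1 E2 H1 H2 η
         decide)

theorem qpow_base (m : ℕ) (n b : ℂ) :
    qpow ℓ m n b = Complex.exp (n * ℓ * b) • qpow ℓ m n 0 := by
  rw [← qpow_shift, zero_add]

theorem qpow_triple (m : ℕ) (n1 b1 n2 b2 n3 b3 t : ℂ) (s1 s3 : ℤ) :
    (s1 * qpow ℓ m n1 b1) * (t • qpow ℓ m n2 b2) * (s3 * qpow ℓ m n3 b3)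
      = ((s1 * s3 : ℤ) * t * Complex.exp (ℓ * (n1 * b1 + n2 * b2 + n3 * b3))) •
        qpow ℓ m (n1 + n2 + n3) 0 := by
  have hs : ∀ (s : ℤ) (x : TruncPoly m), (s : TruncPoly m) * x = (s : ℂ) • x := fun s x => by
    rw [← zsmul_eq_mul, Int.cast_smul_eq_zsmul]
  rw [qpow_base m n1, qpow_base m n2, qpow_base m n3, hs, hs, qpow_add, qpow_add]
  simp only [smul_mul_assoc, mul_smul_comm, smul_smul]
  congr 1
  rw [show ℓ * (n1 * b1 + n2 * b2 + n3 * b3) = n1 * ℓ * b1 + n2 * ℓ * b2 + n3 * ℓ * b3 by ring,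
    Complex.exp_add, Complex.exp_add]
  push_cast
  ring

theorem weightAt_val (N : ℕ) (ε η : ℤˣ) (r : ℤ) (a : ℂ) (m c : ℕ) (x : ℤ) :
    (weightAt N ℓ ε η r a m c x : TruncPoly m) = ((signAt N ε η c x : ℤ) : TruncPoly m) *
      qpow ℓ m (r * blk N (x - c) / 2) (a - (blk N (x - c) + 1) / 2) := rfl

theorem weightAt_inv (N : ℕ) (ε η : ℤˣ) (r : ℤ) (a : ℂ) (m c : ℕ) (x : ℤ) :
    (((weightAt N ℓ ε η r a m c x)⁻¹ : (TruncPoly m)ˣ) : TruncPoly m)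
      = ((signAt N ε η c x : ℤ) : TruncPoly m) *
        qpow ℓ m (-(r * blk N (x - c) / 2)) (a - (blk N (x - c) + 1) / 2) := by
  rw [weightAt, mul_inv, ← map_inv, Int.units_inv_eq_self]
  rfl

theorem phi_mirror (hℓ : Complex.exp ℓ = q) (ε η : ℤˣ) (r : ℤ) (a : ℂ) (m c : ℕ) (κ e : ℤ)
    (ha : a = (e + 1) / 2) (hκ : κ = 0 ∨ κ = 1)
    (h : κ - 2 * c = 1 + (e - 1) * N) (h1 : κ = 1 → η * ε ^ e = 1) (h0 : κ = 0 → e = 0)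
    (x : QMat q N) (i j : ℤ) :
    BandMat.diagConj (weightAt N ℓ ε η r a m c) (BandMat.shift c
      (phiMat q N ℓ a m (QMat.sigma ε r x))) i j
    = η ^ (i + j) • negU m (BandMat.diagConj (weightAt N ℓ ε η r a m c)
      (BandMat.shift c (phiMat q N ℓ a m x)) (κ - j) (κ - i)) := by
  induction x using QMat.induct with
  | h0 => simp
  | hadd x y hx hy => simp only [map_add, BandMat.add_apply, smul_add] at *; rw [hx, hy]
  | hmon k n A =>
    have hm : ∀ x : ℤ, κ - x - c = 1 + (e - 1) * N - (x - c) := fun x => by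
      linear_combination h
    have hU : ∀ (s : ℤˣ) (M : QMat q N), s • M = ((s : ℤ) : ℂ) • M := fun s M => by
      rw [Units.smul_def, Int.cast_smul_eq_zsmul]
    have hU2 : ∀ (s : ℤˣ) (M : TruncPoly m), s • M = ((s : ℤ) : ℂ) • M := fun s M => by
      rw [Units.smul_def, Int.cast_smul_eq_zsmul]
    have hsign := signAt_mirror (N := N) ε η c κ e hκ h h1 h0 i j
    rw [QMat.sigma_mon, hU, smul_smul, map_smul, map_smul, map_smul, BandMat.smul_apply,
      phiMat_mon, phiMat_mon]
    simp only [BandMat.diagConj_apply, BandMat.shift_apply, blockMat_apply, hm,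
      (blk_mirror N _ e).1, (blk_mirror N _ e).2]
    by_cases hk : blk N (j - c) - blk N (i - c) = k
    · have hk2 : e - blk N (i - c) - (e - blk N (j - c)) = k := by omega
      rw [if_pos hk, if_pos hk2, weightAt_val, weightAt_inv, weightAt_val, weightAt_inv,
        qpow_triple, qpow_triple, map_smul, negU_qpow, hU2, smul_smul, smul_smul, neg_zero]
      simp only [hm, (blk_mirror N _ e).1]
      rw [Units.ext_iff] at hsign
      simp only [Units.val_mul] at hsign
      generalize hl : blk N (i - c) = l at *
      generalize hl2 : blk N (j - c) = l2 at *
      subst hk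
      congr 1
      · obtain ⟨w, hw⟩ : ∃ w, (l2 - l) * (l2 - l - 1) = 2 * w := by
          have h := Int.even_mul_pred_self (l2 - l)
          rw [even_iff_exists_two_mul] at h
          exact h
        rw [hw, Int.mul_ediv_cancel_left _ two_ne_zero]
        have hq : ∀ z : ℤ, ((q ^ z : ℂˣ) : ℂ) = Complex.exp (ℓ * z) := fun z => by
          rw [Units.val_zpow_eq_zpow_val, ← hℓ, ← Complex.exp_int_mul, mul_comm]
        rw [hq]
        have hs : ((((ε ^ (l2 - l) : ℤˣ) : ℤ) : ℂ) * ((signAt N ε η c i : ℤ)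
            * (signAt N ε η c j : ℤ) : ℤ)) = (((η ^ (i + j) : ℤˣ) : ℤ) : ℂ) *
              ((signAt N ε η c (κ - j) : ℤ) * (signAt N ε η c (κ - i) : ℤ) : ℤ) := by
          exact_mod_cast hsign
        have hA : A.transpose.submatrix Fin.rev Fin.rev (pos N (i - c)) (pos N (j - c))
          = A (pos N (j - c)).rev (pos N (i - c)).rev := rfl
        have hw2 : ((l2 : ℂ) - l) * (l2 - l - 1) = 2 * w := by exact_mod_cast hw
        rw [hA]
        have h9 : ∀ P Q R S T E F G : ℂ, P * Q = R * S → E * F = G →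
            P * E * (Q * T * F) = R * (S * T * G) := by
          intro P Q R S T E F G e1 e2
          linear_combination (T * E * F) * e1 + (R * S * T) * e2
        refine h9 _ _ _ _ _ _ _ _ hs ?_
        rw [← Complex.exp_add, ← mul_add]
        congr 2
        have he : (e : ℂ) = 2 * a - 1 := by rw [ha]; ring
        push_cast
        rw [he]
        linear_combination (-(r : ℂ) / 2) * hw2
      · congr 1
        push_cast
        ring
    · have hk2 : ¬ (e - blk N (i - c) - (e - blk N (j - c)) = k) := by omega
      rw [if_neg hk, if_neg hk2]
      simp

end Special

section Target

/-- The sign `η` of the subalgebra containing the image, for `a = 1` and `a = 1/2`. -/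
def etaOf (N : ℕ) (ε : ℤˣ) (a : ℂ) : ℤˣ := if a = 1 then ε else if Even N then 1 else ε

/-- The index shift: the integer part of `N / 2` for `a = 1/2`, and zero otherwise. -/
def shiftOf (N : ℕ) (a : ℂ) : ℕ := if a = 1 / 2 then N / 2 else 0

/-- The subalgebra `g^{[m]}` of `gl_∞^{[m]}` (centrally extended) attached to `a`: of type `d` or
`c` for `a = 1`; of type `d` (`N` even) or of type `b̃` or `b` (`N` odd) for `a = 1/2`; everything
for the other values of `a`. -/
def targetAlg (N : ℕ) (ε : ℤˣ) (a : ℂ) (m : ℕ) : LieSubalgebra ℂ (GlHat m) :=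
  if a = 1 then (if ε = 1 then dInf m else cInf m)
  else if a = 1 / 2 then (if Even N then dInf m else if ε = 1 then bTilde m else bInf m)
  else ⊤

/-- The component of degree `d` of the principal gradation of `g^{[m]}`. -/
def targetDegree (N : ℕ) (ε : ℤˣ) (a : ℂ) (m : ℕ) (d : ℤ) :
    Submodule ℂ (targetAlg N ε a m) :=
  (glDegree m d).comap (targetAlg N ε a m).toSubmodule.subtype

/-- The central element of `g^{[m]}` given by `z ∈ R_m`. -/
def targetCentre (N : ℕ) (ε : ℤˣ) (a : ℂ) (m : ℕ) (z : TruncPoly m) : targetAlg N ε a m :=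
  ⟨CentralExt.mk _ 0 z, by
    rw [targetAlg]
    split_ifs
    all_goals first
      | exact LieSubalgebra.mem_top _
      | (intro i j; simp)⟩

/-- The direct sum `g^{[m]} = ⊕_i g^{[m_i]}`. -/
abbrev TargetSum (N : ℕ) (ε : ℤˣ) {M : ℕ} (a : Fin M → ℂ) (m : Fin M → ℕ) : Type :=
  ∀ i, targetAlg N ε (a i) (m i)

/-- The component of degree `d` of the direct sum. -/
def sumDegree (N : ℕ) (ε : ℤˣ) {M : ℕ} (a : Fin M → ℂ) (m : Fin M → ℕ) (d : ℤ) :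
    Submodule ℂ (TargetSum N ε a m) :=
  Submodule.pi Set.univ fun i => targetDegree N ε (a i) (m i) d

variable {q : ℂˣ} {N : ℕ} [NeZero N] {ℓ : ℂ}

/-- For `a = 1` and `a = 1/2`: shift of indices followed by a diagonal conjugation. -/
def adjustHat (N : ℕ) [NeZero N] (ℓ : ℂ) (ε : ℤˣ) (r : ℤ) (a : ℂ) (m : ℕ) :
    GlHat m →ₗ⁅ℂ⁆ GlHat m :=
  if a = 1 ∨ a = 1 / 2 then
    (BandMat.diagConjHat (weightAt N ℓ ε (etaOf N ε a) r a m (shiftOf N a))).comp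
      (BandMat.shiftHat (shiftOf N a))
  else LieHom.id

theorem phi_mem (hℓ : Complex.exp ℓ = q) (hq : ‖(q : ℂ)‖ ≠ 1) (ε : ℤˣ) (r : ℤ) (a : ℂ) (m : ℕ)
    (x : QHat q N ε r) :
    adjustHat N ℓ ε r a m (phiHat hℓ hq a m ε r x) ∈ targetAlg N ε a m := by
  have key : ∀ (κ e : ℤ), (a = 1 ∨ a = 1 / 2) → a = (e + 1) / 2 → (κ = 0 ∨ κ = 1) →
      κ - 2 * (shiftOf N a : ℤ) = 1 + (e - 1) * N → (κ = 1 → etaOf N ε a * ε ^ e = 1) →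
      (κ = 0 → e = 0) → adjustHat N ℓ ε r a m (phiHat hℓ hq a m ε r x)
        ∈ classical κ (etaOf N ε a) m := by
    intro κ e hs ha hκ h h1 h0 i j
    rw [adjustHat, if_pos hs]
    have hm := phi_mirror (N := N) hℓ ε (etaOf N ε a) r a m (shiftOf N a) κ e ha hκ h h1 h0
      x.base i j
    have hx : QMat.sigma ε r (x.base : QMat q N) = -x.base := x.base.2
    rw [hx, map_neg, map_neg, map_neg, BandMat.neg_apply, neg_eq_iff_eq_neg] at hm
    exact hm
  rw [targetAlg]
  by_cases h1 : a = 1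
  · have h2 : ¬ ((1 : ℂ) = 1 / 2) := by norm_num
    have hk := key 1 1 (Or.inl h1) (by rw [h1]; norm_num) (Or.inr rfl)
      (by rw [shiftOf, h1, if_neg h2]; simp)
      (by intro _; rw [etaOf, if_pos h1, zpow_one, Int.units_mul_self]) (by simp)
    rw [if_pos h1]
    rw [etaOf, if_pos h1] at hk
    split_ifs with h3
    · rw [show dInf m = classical 1 ε m by rw [h3]]
      exact hk
    · rw [show cInf m = classical 1 ε m by
        rw [(Int.units_eq_one_or ε).resolve_left h3]]
      exact hk
  · rw [if_neg h1]
    by_cases h2 : a = 1 / 2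
    · rw [if_pos h2]
      by_cases hN : Even N
      · have hk := key 1 0 (Or.inr h2) (by rw [h2]; norm_num) (Or.inr rfl)
          (by
            rw [shiftOf, if_pos h2]
            obtain ⟨t, ht⟩ := hN
            omega)
          (by intro _; rw [etaOf, if_neg h1, if_pos hN, zpow_zero, one_mul]) (by simp)
        rw [etaOf, if_neg h1, if_pos hN] at hk
        rwa [if_pos hN]
      · have hk := key 0 0 (Or.inr h2) (by rw [h2]; norm_num) (Or.inl rfl)
          (by
            rw [shiftOf, if_pos h2]
            obtain ⟨t, ht⟩ := Nat.not_even_iff_odd.1 hN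
            omega)
          (by simp) (by simp)
        rw [etaOf, if_neg h1, if_neg hN] at hk
        rw [if_neg hN]
        split_ifs with h3
        · rw [show bTilde m = classical 0 ε m by rw [h3]]
          exact hk
        · rw [show bInf m = classical 0 ε m by
            rw [(Int.units_eq_one_or ε).resolve_left h3]]
          exact hk
    · rw [if_neg h2]
      exact LieSubalgebra.mem_top _

/-- The homomorphism to `g^{[m]}` for a single `a`. -/
def phiOne (hℓ : Complex.exp ℓ = q) (hq : ‖(q : ℂ)‖ ≠ 1) (ε : ℤˣ) (r : ℤ) (a : ℂ) (m : ℕ) :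
    QHat q N ε r →ₗ⁅ℂ⁆ targetAlg N ε a m where
  toFun x := ⟨adjustHat N ℓ ε r a m (phiHat hℓ hq a m ε r x), phi_mem hℓ hq ε r a m x⟩
  map_add' x y := Subtype.ext (by simp)
  map_smul' t x := Subtype.ext (by simp)
  map_lie' {x y} := Subtype.ext (by simp)

/-- The homomorphism `φ` to the direct sum. -/
def phi (hℓ : Complex.exp ℓ = q) (hq : ‖(q : ℂ)‖ ≠ 1) (ε : ℤˣ) (r : ℤ) {M : ℕ} (a : Fin M → ℂ)
    (m : Fin M → ℕ) : QHat q N ε r →ₗ⁅ℂ⁆ TargetSum N ε a m :=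
  lieHomPi fun i => phiOne hℓ hq ε r (a i) (m i)

end Target

/-- `x ∈ ℤ + τ⁻¹ ℤ`, where `τ = ℓ / (2 π i)`. -/
def InLattice (ℓ x : ℂ) : Prop :=
  ∃ b c : ℤ, x = b + c * (ℓ / (2 * Real.pi * Complex.I))⁻¹

end

end QPDO

open QPDO

/-!
Let `g` be the direct sum of the target algebras. Both claims follow once the subspaces stable under
the image of `φ` are known to be stable under the components of degree `d ≠ 0` of `g`. That this is
the case rests on two facts.

Quasifinite modules are smooth (`IsSmooth`): given a vector `v` and a degree `d ≠ 0`, all elements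
of degree `d` whose entries vanish at finitely many suitable places kill `v`. Indeed the element
`D` of degree zero with the diagonal entries `(l - κ/2)³` belongs to each target algebra, and `ad D`
multiplies the entry at `(l, l + d)` by a quadratic polynomial in `l` (`exists_forall_eq_aeval_ad`).
On the other hand, degree `d` acts between finite-dimensional components, so that some `p ≠ 0` has
the property that `p(ad D) y` kills `v` for all `y` of degree `d`
(`IsQuasifinite.exists_aeval_ad_lie_eq_zero`). An `x` of degree `d` which vanishes at the finitely
many places where `p(ad D)` is not invertible has the form `p(ad D) y`.

The image of `φ` is dense: an arbitrary element of degree `d ≠ 0` of `g` agrees at any given finite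
set of places with an element of the image (`exists_phi_apply_eq`). The entries of the image of
`z^k f(T_q) E_{i,j}` are the values of `f` at `q^(a - l + u)`, that is, the `m`-jets of `f` at the
points `q^(a - l)`, and polynomials with prescribed jets at distinct points exist
(`exists_mem_qDegree_forall_phiMat_eq`). The anti-involution `σ` turns the parameter `a` into
`2 - a` and reflects the places (`exists_phiMat_sigma_eq`). For `a ∈ {1, 1/2}` this is the symmetry
that defines the target algebra; for the other values the points belonging to `a` and to `2 - a` are
distinct, so that both values can be prescribed. Together, the two facts show that a subspace of a
smooth module which is stable under the image of `φ` is stable under all degrees `d ≠ 0` of `g`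
(`lie_mem_of_mem_sumDegree`).

Since the component of degree zero is commutative, such a subspace is stable under `[g, g]`. The
entries of a diagonal matrix can be summed up to solve `h(l) - h(l - k) = d(l)`, and so every
element of degree zero is a bracket up to a central one (`exists_eq_lie_add_targetCentre`); the
central elements are brackets as well, except for the odd powers of `u` in the summands with
`a ∈ {1, 1/2}` (`exists_lie_eq_targetCentre`).

A tensor product of quasifinite modules need not be quasifinite, but it is smooth
(`isSmooth_piTensorProduct`). Quasifinite modules have countable dimension, so by Schur's lemma in
the form of Dixmier (`IsIrreducibleSet.exists_eq_algebraMap`) the centre acts by scalars on each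
irreducible factor, and a submodule for the image of `φ` is one for `g`. By Jacobson's density
theorem the tensor product is irreducible over `g` (`eq_bot_or_eq_top_of_tensorAt_mem`).
-/

namespace QPDO

/-! ### Schur's lemma in countable dimension and tensor products of irreducible modules -/

section Irreducible

open Polynomial Cardinal

/-- The linear operators that leave a subspace invariant. -/
def stabilizerSubalgebra {V : Type*} [AddCommGroup V] [Module ℂ V] (W : Submodule ℂ V) :
    Subalgebra ℂ (Module.End ℂ V) where
  carrier := {f | ∀ v ∈ W, f v ∈ W}
  mul_mem' hf hg v hv := hf _ (hg v hv)
  add_mem' hf hg v hv := W.add_mem (hf v hv) (hg v hv)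
  algebraMap_mem' c v hv := by
    rw [Module.algebraMap_end_apply]
    exact W.smul_mem c hv

/-- A set of operators is irreducible if it has no invariant subspaces except the trivial ones. -/
def IsIrreducibleSet {V : Type*} [AddCommGroup V] [Module ℂ V] (S : Set (Module.End ℂ V)) : Prop :=
  ∀ W : Submodule ℂ V, S ⊆ stabilizerSubalgebra W → W = ⊥ ∨ W = ⊤

variable {V : Type*} [AddCommGroup V] [Module ℂ V] {S : Set (Module.End ℂ V)}

theorem IsIrreducibleSet.bijective_of_commute (hS : IsIrreducibleSet S) {T : Module.End ℂ V}
    (hT : ∀ s ∈ S, Commute s T) (h0 : T ≠ 0) : Function.Bijective T := by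
  have hc : ∀ s ∈ S, ∀ v, s (T v) = T (s v) := fun s hs v => DFunLike.congr_fun (hT s hs).eq v
  constructor
  · rw [← LinearMap.ker_eq_bot]
    refine (hS (LinearMap.ker T) fun s hs v hv => ?_).resolve_right fun h => ?_
    · rw [LinearMap.mem_ker] at hv ⊢
      rw [← hc s hs, hv, map_zero]
    · exact h0 (LinearMap.ker_eq_top.1 h)
  · rw [← LinearMap.range_eq_top]
    refine (hS (LinearMap.range T) fun s hs v hv => ?_).resolve_left fun h => ?_
    · obtain ⟨w, rfl⟩ := hv
      exact ⟨s w, (hc s hs w).symm⟩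
    · exact h0 (LinearMap.range_eq_bot.1 h)

/-- Dixmier's form of Schur's lemma. If `T - μ` were invertible for all `μ`, then the uncountably
many vectors `(T - μ)⁻¹ v` would be linearly independent. -/
theorem IsIrreducibleSet.exists_eq_algebraMap (hS : IsIrreducibleSet S)
    (hV : Module.rank ℂ V ≤ ℵ₀) {T : Module.End ℂ V} (hT : ∀ s ∈ S, Commute s T) :
    ∃ c : ℂ, T = algebraMap ℂ _ c := by
  by_contra! hne
  have hu : ∀ c : ℂ, IsUnit (T - algebraMap ℂ (Module.End ℂ V) c) := fun c => by
    rw [Module.End.isUnit_iff]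
    exact hS.bijective_of_commute
      (fun s hs => (hT s hs).sub_right (Algebra.commutes c s).symm) (sub_ne_zero.2 (hne c))
  have hspec : ∀ c : ℂ, c ∉ spectrum ℂ T := fun c hc =>
    spectrum.mem_iff.1 hc (by rw [← neg_sub]; exact (hu c).neg)
  have hpoly : ∀ p : ℂ[X], p ≠ 0 → IsUnit (aeval T p) := by
    intro p hp
    rw [(IsAlgClosed.splits p).eq_prod_roots, map_mul, aeval_C]
    refine IsUnit.mul ?_ ?_
    · exact (IsUnit.mk0 _ (leadingCoeff_ne_zero.2 hp)).map _
    · by_contra hc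
      obtain ⟨c, hc, -⟩ := spectrum.exists_mem_of_not_isUnit_aeval_prod hc
      exact hspec c hc
  have hnt : Nontrivial V := by
    by_contra hc
    rw [not_nontrivial_iff_subsingleton] at hc
    exact hne 0 (Subsingleton.elim _ _)
  obtain ⟨v, hv⟩ := exists_ne (0 : V)
  choose U hU using hu
  have hli : LinearIndependent ℂ fun c : ℂ => ((U c)⁻¹ : (Module.End ℂ V)ˣ).1 v := by
    rw [linearIndependent_iff']
    intro s g hg i hi
    by_contra hgi
    -- Multiply the relation by `∏ (T - k)`: this gives `p(T) v = 0` for a nonzero polynomial `p`.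
    set p : ℂ[X] := ∑ j ∈ s, C (g j) * ∏ k ∈ s.erase j, (X - C k) with hp
    have hev : p.eval i ≠ 0 := by
      rw [hp, eval_finsetSum, Finset.sum_eq_single_of_mem i hi]
      · rw [eval_mul, eval_C, eval_prod]
        refine mul_ne_zero hgi (Finset.prod_ne_zero_iff.2 fun k hk => ?_)
        rw [eval_sub, eval_X, eval_C]
        exact sub_ne_zero.2 (Finset.ne_of_mem_erase hk).symm
      · intro j _ hji
        rw [eval_mul, eval_prod, Finset.prod_eq_zero (Finset.mem_erase.2 ⟨hji.symm, hi⟩), mul_zero]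
        simp
    have hp0 : p ≠ 0 := fun h => hev (by rw [h, eval_zero])
    have hpv : aeval T p v = 0 := by
      have h1 := congrArg (aeval T (∏ k ∈ s, (X - C k))) hg
      rw [map_zero, map_sum] at h1
      rw [← h1, hp, map_sum, LinearMap.sum_apply]
      refine Finset.sum_congr rfl fun j hj => ?_
      have h2 : (X - C j) * ∏ k ∈ s.erase j, (X - C k) = ∏ k ∈ s, (X - C k : ℂ[X]) :=
        Finset.mul_prod_erase s (fun k => (X - C k : ℂ[X])) hj
      have h3 : (T - algebraMap ℂ _ j) * ((U j)⁻¹ : (Module.End ℂ V)ˣ).1 = 1 := by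
        rw [← hU j, Units.mul_inv]
      rw [← h2, map_mul, aeval_C, Module.End.mul_apply, Module.algebraMap_end_apply, map_smul,
        mul_comm (X - C j), map_mul, map_sub, aeval_X, aeval_C, ← Module.End.mul_apply (f := _ * _),
        mul_assoc, h3, mul_one]
    have := ((Module.End.isUnit_iff _).1 (hpoly p hp0)).1
    exact hv (this (by rw [hpv, map_zero]))
  have h1 := hli.cardinal_lift_le_rank
  rw [Cardinal.mk_complex] at h1
  have h2 := h1.trans (Cardinal.lift_le.2 hV)
  rw [Cardinal.lift_aleph0, Cardinal.lift_continuum] at h2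
  exact absurd h2 (not_le.2 Cardinal.aleph0_lt_continuum)

/-- Jacobson density: the algebra generated by an irreducible set of operators contains, for every
operator and every finite set of vectors, an element that agrees with the operator there. -/
theorem IsIrreducibleSet.exists_mem_adjoin [Nontrivial V] (hS : IsIrreducibleSet S)
    (hV : Module.rank ℂ V ≤ ℵ₀) (g : Module.End ℂ V) (s : Finset V) :
    ∃ f ∈ Algebra.adjoin ℂ S, ∀ v ∈ s, f v = g v := by
  set A := Algebra.adjoin ℂ S with hA
  have hsimple : IsSimpleModule A V := by
    refine { exists_pair_ne := ⟨⊥, ⊤, bot_ne_top⟩, eq_bot_or_eq_top := fun W => ?_ }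
    rcases hS (W.restrictScalars ℂ) fun f hf v hv =>
      W.smul_mem (⟨f, Algebra.subset_adjoin hf⟩ : A) hv with h | h
    · left
      exact (Submodule.restrictScalars_eq_bot_iff _ _ _).1 h
    · right
      exact (Submodule.restrictScalars_eq_top_iff _ _ _).1 h
  have hcomm : ∀ t : Module.End A V, ∃ c : ℂ, ∀ v, t v = c • v := by
    intro t
    obtain ⟨c, hc⟩ := hS.exists_eq_algebraMap hV (T := t.restrictScalars ℂ) fun f hf => by
      ext v
      exact (t.map_smul (⟨f, Algebra.subset_adjoin hf⟩ : A) v).symm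
    refine ⟨c, fun v => ?_⟩
    have := DFunLike.congr_fun hc v
    rwa [Module.algebraMap_end_apply] at this
  let G : Module.End (Module.End A V) V :=
    { toFun := g
      map_add' := map_add g
      map_smul' := fun t v => by
        obtain ⟨c, hc⟩ := hcomm t
        rw [RingHom.id_apply, Module.End.smul_def, Module.End.smul_def, hc, hc, map_smul] }
  obtain ⟨f, hf⟩ := jacobson_density G s
  exact ⟨f, f.2, fun v hv => (hf v hv).symm⟩

end Irreducible

section TensorIrreducible

open scoped TensorProduct

variable {ι : Type*} {V : ι → Type*} [∀ i, AddCommGroup (V i)] [∀ i, Module ℂ (V i)]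

/-- Projecting each factor onto a line isolates one coordinate of a tensor. -/
theorem map_eq_repr_smul_tprod [Fintype ι] {κ : ι → Type*} (b : ∀ i, Module.Basis (κ i) ℂ (V i))
    (w : ⨂[ℂ] i, V i) (p : ∀ i, κ i) (v : ∀ i, V i) (f : ∀ i, Module.End ℂ (V i))
    (h : ∀ k ∈ ((Basis.piTensorProduct b).repr w).support, ∀ i,
      f i (b i (k i)) = ((b i).coord (p i)).smulRight (v i) (b i (k i))) :
    PiTensorProduct.map f w = (Basis.piTensorProduct b).repr w p • PiTensorProduct.tprod ℂ v := by
  classical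
  have hterm : ∀ k ∈ ((Basis.piTensorProduct b).repr w).support,
      PiTensorProduct.map f (Basis.piTensorProduct b k)
        = if k = p then PiTensorProduct.tprod ℂ v else 0 := by
    intro k hk
    rw [Basis.piTensorProduct_apply, PiTensorProduct.map_tprod]
    split_ifs with hkp
    · subst hkp
      congr 1
      funext i
      rw [h k hk i]
      simp
    · obtain ⟨i, hi⟩ := Function.ne_iff.1 hkp
      refine (PiTensorProduct.tprod ℂ).map_coord_zero i ?_
      rw [h k hk i]
      simp [hi]
  conv_lhs => rw [← (Basis.piTensorProduct b).linearCombination_repr w,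
    Finsupp.linearCombination_apply, Finsupp.sum, map_sum]
  rw [Finset.sum_congr rfl fun k hk => by rw [map_smul, hterm k hk]]
  simp only [smul_ite, smul_zero, Finset.sum_ite_eq', Finsupp.mem_support_iff]
  split_ifs with hp
  · rfl
  · rw [not_not.1 hp, zero_smul]

variable [DecidableEq ι]

theorem tensorAt_mem_of_mem_adjoin {W : Submodule ℂ (⨂[ℂ] i, V i)} {i : ι}
    {S : Set (Module.End ℂ (V i))} (h : ∀ f ∈ S, tensorAt V i f ∈ stabilizerSubalgebra W)
    {f : Module.End ℂ (V i)} (hf : f ∈ Algebra.adjoin ℂ S) :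
    tensorAt V i f ∈ stabilizerSubalgebra W := by
  induction hf using Algebra.adjoin_induction with
  | mem f hf => exact h f hf
  | algebraMap c =>
    have h1 : tensorAt V i 1 = 1 := by
      rw [tensorAt_eq, Pi.mulSingle_one, map_one]
    rw [Algebra.algebraMap_eq_smul_one, map_smul, h1]
    exact Subalgebra.smul_mem _ (one_mem _) c
  | add f g _ _ hf hg => rw [map_add]; exact add_mem hf hg
  | mul f g _ _ hf hg => rw [tensorAt_mul]; exact mul_mem hf hg

variable [Fintype ι]

theorem map_mem_of_tensorAt_mem {W : Submodule ℂ (⨂[ℂ] i, V i)} {f : ∀ i, Module.End ℂ (V i)}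
    (h : ∀ i, tensorAt V i (f i) ∈ stabilizerSubalgebra W) :
    PiTensorProduct.map f ∈ stabilizerSubalgebra W := by
  have h1 : f ∈ (stabilizerSubalgebra W).toSubmonoid.comap
      (PiTensorProduct.mapMonoidHom (R := ℂ) (s := V)) := by
    rw [← Finset.noncommProd_mulSingle f]
    exact Submonoid.noncommProd_mem _ _ _ _ fun i _ => h i
  exact h1

/-- A nonzero invariant subspace of the tensor product contains all pure tensors: by density,
projecting each factor onto a line detects a nonzero coordinate of an element. -/
theorem eq_bot_or_eq_top_of_tensorAt_mem [∀ i, Nontrivial (V i)]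
    {S : ∀ i, Set (Module.End ℂ (V i))} (hS : ∀ i, IsIrreducibleSet (S i))
    (hV : ∀ i, Module.rank ℂ (V i) ≤ Cardinal.aleph0) {W : Submodule ℂ (⨂[ℂ] i, V i)}
    (hW : ∀ i, ∀ f ∈ S i, tensorAt V i f ∈ stabilizerSubalgebra W) : W = ⊥ ∨ W = ⊤ := by
  classical
  refine or_iff_not_imp_left.2 fun hne => ?_
  obtain ⟨w, hw, hw0⟩ := W.exists_mem_ne_zero_of_ne_bot hne
  obtain ⟨κ, b⟩ : ∃ κ : ι → Type _, Nonempty (∀ i, Module.Basis (κ i) ℂ (V i)) :=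
    ⟨_, ⟨fun i => Module.Basis.ofVectorSpace ℂ (V i)⟩⟩
  obtain ⟨b⟩ := b
  obtain ⟨p, hp⟩ : ∃ p, (Basis.piTensorProduct b).repr w p ≠ 0 := by
    by_contra! hc
    exact hw0 ((Basis.piTensorProduct b).repr.map_eq_zero_iff.1 (Finsupp.ext hc))
  rw [eq_top_iff, ← PiTensorProduct.span_tprod_eq_top, Submodule.span_le]
  rintro _ ⟨v, rfl⟩
  choose f hf hfv using fun i => (hS i).exists_mem_adjoin (hV i)
    (((b i).coord (p i)).smulRight (v i))
    (((Basis.piTensorProduct b).repr w).support.image fun k => b i (k i))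
  have hmem := map_mem_of_tensorAt_mem (fun i => tensorAt_mem_of_mem_adjoin (hW i) (hf i)) w hw
  rw [map_eq_repr_smul_tprod b w p v f fun k hk i =>
    hfv i _ (Finset.mem_image_of_mem _ hk)] at hmem
  exact (Submodule.smul_mem_iff _ hp).1 hmem

end TensorIrreducible

theorem IsQuasifinite.rank_le_aleph0 {L : Type*} [LieRing L] [LieAlgebra ℂ L]
    {gr : ℤ → Submodule ℂ L} {V : Type*} [AddCommGroup V] [Module ℂ V] [LieRingModule L V]
    (h : IsQuasifinite gr V) : Module.rank ℂ V ≤ Cardinal.aleph0 := by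
  obtain ⟨grV, hi, -, hf⟩ := h
  have b := hi.collectedBasis fun j => Module.finBasis ℂ (grV j)
  rw [← Cardinal.lift_le_aleph0, ← b.mk_eq_rank, Cardinal.lift_le_aleph0]
  exact Cardinal.mk_le_aleph0

/-! ### Quasifinite modules -/

section Quasifinite

open Polynomial

theorem map_aeval_of_intertwines {V W : Type*} [AddCommGroup V] [Module ℂ V] [AddCommGroup W]
    [Module ℂ W] (f : V →ₗ[ℂ] W) {A : Module.End ℂ V} {B : Module.End ℂ W}
    (h : ∀ x, f (A x) = B (f x)) (p : ℂ[X]) (x : V) : f (aeval A p x) = aeval B p (f x) := by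
  induction p using Polynomial.induction_on' generalizing x with
  | add p q hp hq => simp only [map_add, LinearMap.add_apply, hp, hq]
  | monomial n c =>
    have hn : ∀ n : ℕ, ∀ x, f ((A ^ n) x) = (B ^ n) (f x) := by
      intro n
      induction n with
      | zero => intro x; rfl
      | succ n ih => intro x; rw [pow_succ, pow_succ, Module.End.mul_apply, ih, h]; rfl
    simp only [aeval_monomial, Module.End.mul_apply, Module.algebraMap_end_apply, map_smul, hn]

/-- On `Hom(V_j, V_{j+k})`, which is finite-dimensional, the commutator with `D` satisfies a
polynomial equation; hence the elements `p(ad D) x` annihilate a given vector, for a suitable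
`p ≠ 0` and all `x` of degree `k`. -/
theorem IsQuasifinite.exists_aeval_ad_lie_eq_zero {L : Type*} [LieRing L] [LieAlgebra ℂ L]
    {gr : ℤ → Submodule ℂ L} {V : Type*} [AddCommGroup V] [Module ℂ V] [LieRingModule L V]
    [LieModule ℂ L V] (h : IsQuasifinite gr V) {D : L} (hD : D ∈ gr 0) {k : ℤ}
    (hDk : ∀ x ∈ gr k, ⁅D, x⁆ ∈ gr k) (v : V) :
    ∃ p : ℂ[X], p ≠ 0 ∧ ∀ x ∈ gr k, ⁅aeval (LieAlgebra.ad ℂ L D) p x, v⁆ = 0 := by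
  obtain ⟨grV, hi, hgr, hf⟩ := h
  have hv : v ∈ ⨆ j, grV j := by rw [hi.submodule_iSup_eq_top]; trivial
  induction hv using Submodule.iSup_induction' with
  | zero => exact ⟨1, one_ne_zero, fun x _ => lie_zero _⟩
  | add v w _ _ hv hw =>
    obtain ⟨p, hp, hpv⟩ := hv
    obtain ⟨p2, hp2, hpw⟩ := hw
    have hstab : ∀ p : ℂ[X], ∀ x ∈ gr k, aeval (LieAlgebra.ad ℂ L D) p x ∈ gr k := by
      intro p x hx
      have := map_aeval_of_intertwines (gr k).subtype
        (A := (LieAlgebra.ad ℂ L D).restrict hDk) (B := LieAlgebra.ad ℂ L D) (fun _ => rfl) p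
        ⟨x, hx⟩
      exact this ▸ Subtype.property _
    refine ⟨p * p2, mul_ne_zero hp hp2, fun x hx => ?_⟩
    rw [lie_add]
    nth_rewrite 1 [map_mul]
    rw [mul_comm p, map_mul, Module.End.mul_apply, Module.End.mul_apply, hpv _ (hstab _ _ hx),
      hpw _ (hstab _ _ hx), add_zero]
  | mem j v hv =>
    have hDV : ∀ i, ∀ w ∈ grV i, LieModule.toEnd ℂ L V D w ∈ grV i := fun i w hw => by
      have := hgr 0 i D hD w hw
      rwa [zero_add] at this
    let D0 : Module.End ℂ (grV j) := (LieModule.toEnd ℂ L V D).restrict (hDV j)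
    let D1 : Module.End ℂ (grV (k + j)) := (LieModule.toEnd ℂ L V D).restrict (hDV (k + j))
    let C : Module.End ℂ (grV j →ₗ[ℂ] grV (k + j)) :=
      LinearMap.llcomp ℂ (grV j) (grV (k + j)) (grV (k + j)) D1 - LinearMap.lcomp ℂ _ D0
    let ρ : gr k →ₗ[ℂ] grV j →ₗ[ℂ] grV (k + j) :=
      { toFun := fun x => (LieModule.toEnd ℂ L V x).restrict (hgr k j x x.2)
        map_add' := fun x y => by ext w; exact add_lie (x : L) (y : L) (w : V)
        map_smul' := fun t x => by ext w; exact smul_lie t (x : L) (w : V) }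
    have hρ : ∀ x, ρ ((LieAlgebra.ad ℂ L D).restrict hDk x) = C (ρ x) := by
      intro x
      ext w
      exact lie_lie D (x : L) (w : V)
    refine ⟨minpoly ℂ C, minpoly.ne_zero (Algebra.IsIntegral.isIntegral C), fun x hx => ?_⟩
    have h1 := map_aeval_of_intertwines ρ hρ (minpoly ℂ C) ⟨x, hx⟩
    have h0 : aeval C (minpoly ℂ C) (ρ ⟨x, hx⟩) = 0 := by
      have h := minpoly.aeval ℂ C
      exact DFunLike.congr_fun h _
    rw [h0] at h1
    have h2 := map_aeval_of_intertwines (gr k).subtype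
        (A := (LieAlgebra.ad ℂ L D).restrict hDk) (B := LieAlgebra.ad ℂ L D) (fun _ => rfl)
        (minpoly ℂ C) ⟨x, hx⟩
    have h3 := congrArg Subtype.val (DFunLike.congr_fun h1 ⟨v, hv⟩)
    rw [Submodule.subtype_apply, Submodule.subtype_apply] at h2
    rw [← h2]
    exact h3

end Quasifinite

/-! ### The classical subalgebras -/

/-- The hypotheses of `phi_mirror` on the axis `κ` and on `e`, together with the identification of
the target algebra as the classical algebra with the same axis. -/
theorem exists_targetAlg_eq_classical (N : ℕ) [NeZero N] (ε : ℤˣ) {a : ℂ}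
    (ha : a = 1 ∨ a = 1 / 2) : ∃ κ e : ℤ, (κ = 0 ∨ κ = 1) ∧ a = (e + 1) / 2 ∧
      κ - 2 * (shiftOf N a : ℤ) = 1 + (e - 1) * N ∧ (κ = 1 → etaOf N ε a * ε ^ e = 1) ∧
      (κ = 0 → e = 0) ∧ ∀ m, targetAlg N ε a m = classical κ (etaOf N ε a) m := by
  have h2 : ¬ ((1 : ℂ) = 1 / 2) := by norm_num
  rcases ha with rfl | rfl
  · refine ⟨1, 1, Or.inr rfl, by norm_num, by simp [shiftOf],
      fun _ => by rw [etaOf, if_pos rfl, zpow_one, Int.units_mul_self], by simp, fun m => ?_⟩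
    rw [targetAlg, etaOf, if_pos rfl, if_pos rfl]
    rcases Int.units_eq_one_or ε with rfl | rfl
    · simp
    · simp [show ¬ (-1 : ℤˣ) = 1 by decide]
  · by_cases hN : Even N
    · refine ⟨1, 0, Or.inr rfl, by norm_num, ?_, fun _ => ?_, by simp, fun m => ?_⟩
      · rw [shiftOf, if_pos rfl]
        obtain ⟨t, ht⟩ := hN
        omega
      · rw [etaOf, if_neg (Ne.symm h2), if_pos hN, zpow_zero, one_mul]
      · rw [targetAlg, etaOf, if_neg (Ne.symm h2), if_neg (Ne.symm h2), if_pos rfl, if_pos hN,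
          if_pos hN]
    · refine ⟨0, 0, Or.inl rfl, by norm_num, ?_, by simp, by simp, fun m => ?_⟩
      · rw [shiftOf, if_pos rfl]
        obtain ⟨t, ht⟩ := Nat.not_even_iff_odd.1 hN
        omega
      · rw [targetAlg, etaOf, if_neg (Ne.symm h2), if_neg (Ne.symm h2), if_pos rfl, if_neg hN,
          if_neg hN]
        rcases Int.units_eq_one_or ε with rfl | rfl
        · simp
        · simp [show ¬ (-1 : ℤˣ) = 1 by decide]

theorem targetAlg_eq_top (N : ℕ) (ε : ℤˣ) {a : ℂ} (ha : ¬ (a = 1 ∨ a = 1 / 2)) (m : ℕ) :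
    targetAlg N ε a m = ⊤ := by
  rw [not_or] at ha
  rw [targetAlg, if_neg ha.1, if_neg ha.2]

theorem mem_classical {κ : ℤ} {η : ℤˣ} {m : ℕ} {x : GlHat m} : x ∈ classical κ η m ↔
    ∀ i j : ℤ, x.base i j = -(η ^ (i + j) • negU m (x.base (κ - j) (κ - i))) := Iff.rfl

/-- The matrix with the entries `g i j • A i j`. -/
def BandMat.scale {K : Type*} [CommRing K] [Algebra ℂ K] (g : ℤ → ℤ → ℂ) (A : BandMat K) :
    BandMat K :=
  BandMat.of (fun i j => g i j • A i j) (by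
    obtain ⟨d, hd⟩ := A.exists_band
    exact ⟨d, fun i j h => by rw [hd i j h, smul_zero]⟩)

theorem BandMat.scale_apply {K : Type*} [CommRing K] [Algebra ℂ K] (g : ℤ → ℤ → ℂ)
    (A : BandMat K) (i j : ℤ) : BandMat.scale g A i j = g i j • A i j := rfl

/-- The symmetry axis of `g^{[m]}`: the entries at `(i, j)` and at `(κ - j, κ - i)` determine each
other. For values of `a` without symmetry any `κ` will do. -/
theorem exists_axis (N : ℕ) [NeZero N] (ε : ℤˣ) (a : ℂ) : ∃ κ : ℤ, ∀ m,
    (∀ g : ℤ → ℤ → ℂ, (∀ i j, g (κ - j) (κ - i) = g i j) → ∀ x ∈ targetAlg N ε a m, ∀ z,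
      CentralExt.mk _ (BandMat.scale g x.base) z ∈ targetAlg N ε a m) ∧
    ∀ g : ℤ → ℂ, (∀ i, g (κ - i) = -g i) →
      CentralExt.mk _ (BandMat.scale (fun i _ => g i) 1) 0 ∈ targetAlg N ε a m := by
  by_cases ha : a = 1 ∨ a = 1 / 2
  · obtain ⟨κ, e, -, -, -, -, -, ht⟩ := exists_targetAlg_eq_classical N ε ha
    refine ⟨κ, fun m => ?_⟩
    rw [ht]
    refine ⟨fun g hg x hx z => ?_, fun g hg => ?_⟩
    · rw [mem_classical] at hx ⊢
      intro i j
      rw [CentralExt.base_mk, BandMat.scale_apply, BandMat.scale_apply, hg, map_smul, hx i j,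
        smul_neg, smul_comm]
    · rw [mem_classical]
      intro i j
      rw [CentralExt.base_mk, BandMat.scale_apply, BandMat.scale_apply, BandMat.one_apply,
        BandMat.one_apply]
      by_cases hij : i = j
      · subst hij
        rw [if_pos rfl, if_pos rfl, hg, map_smul, map_one, ← two_mul, zpow_mul, zpow_ofNat,
          Int.units_sq, one_zpow, one_smul, neg_smul, neg_neg]
      · rw [if_neg hij, if_neg (by omega), smul_zero, smul_zero, map_zero, smul_zero, neg_zero]
  · exact ⟨0, fun m => by
      rw [targetAlg_eq_top N ε ha]
      exact ⟨fun _ _ _ _ _ => LieSubalgebra.mem_top _, fun _ _ => LieSubalgebra.mem_top _⟩⟩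

/-! ### The principal gradation -/

theorem mem_targetDegree {N : ℕ} {ε : ℤˣ} {a : ℂ} {m : ℕ} {d : ℤ} {x : targetAlg N ε a m} :
    x ∈ targetDegree N ε a m d ↔ (∀ i j : ℤ, j - i ≠ d → (x : GlHat m).base i j = 0) ∧
      (d ≠ 0 → (x : GlHat m).centre = 0) := Iff.rfl

theorem mem_sumDegree {N : ℕ} {ε : ℤˣ} {M : ℕ} {a : Fin M → ℂ} {m : Fin M → ℕ} {d : ℤ}
    {x : TargetSum N ε a m} :
    x ∈ sumDegree N ε a m d ↔ ∀ i, x i ∈ targetDegree N ε (a i) (m i) d := by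
  simp [sumDegree, Submodule.mem_pi]

theorem cocycle_apply_of_entries {K : Type*} [CommRing K] [Algebra ℂ K] {A B : BandMat K}
    {d e : ℤ} (hA : ∀ i j, j - i ≠ d → A i j = 0) (hB : ∀ i j, j - i ≠ e → B i j = 0)
    (h : d = 0 ∨ d + e ≠ 0) : BandMat.cocycle.toBilin A B = 0 := by
  rw [BandMat.cocycle_apply, BandMat.trace]
  refine finsum_eq_zero_of_forall_eq_zero fun i => ?_
  rw [BandMat.mul_apply]
  refine finsum_eq_zero_of_forall_eq_zero fun k => ?_
  rw [BandMat.lie_J_apply]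
  by_cases h1 : k - i = d
  · by_cases h2 : i - k = e
    · obtain rfl : i = k := by omega
      rw [sub_self, zero_mul, zero_mul]
    · rw [hB _ _ h2, mul_zero]
  · rw [hA _ _ h1, mul_zero, zero_mul]

theorem lie_mem_glDegree {m : ℕ} {d e : ℤ} {x y : GlHat m} (hx : x ∈ glDegree m d)
    (hy : y ∈ glDegree m e) : ⁅x, y⁆ ∈ glDegree m (d + e) := by
  have hmul : ∀ (A B : GlInf m) (d e : ℤ), (∀ i j, j - i ≠ d → A i j = 0) →
      (∀ i j, j - i ≠ e → B i j = 0) → ∀ i j, j - i ≠ d + e → (A * B) i j = 0 := by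
    intro A B d e hA hB i j h
    rw [BandMat.mul_apply]
    refine finsum_eq_zero_of_forall_eq_zero fun k => ?_
    by_cases h1 : k - i = d
    · rw [hB k j (by omega), mul_zero]
    · rw [hA _ _ h1, zero_mul]
  refine ⟨fun i j h => ?_, fun h => ?_⟩
  · rw [CentralExt.base_lie, BandMat.lie_def, BandMat.sub_apply, hmul _ _ d e hx.1 hy.1 i j h,
      hmul _ _ e d hy.1 hx.1 i j (by omega), sub_zero]
  · rw [CentralExt.centre_lie]
    exact cocycle_apply_of_entries hx.1 hy.1 (Or.inr h)

theorem lie_eq_zero_of_mem_glDegree_zero {m : ℕ} {x y : GlHat m} (hx : x ∈ glDegree m 0)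
    (hy : y ∈ glDegree m 0) : ⁅x, y⁆ = 0 := by
  ext1
  · ext i j
    have hmul : ∀ (A B : GlInf m), (∀ i j, j - i ≠ 0 → A i j = 0) →
        (A * B) i j = A i i * B i j := by
      intro A B hA
      rw [BandMat.mul_apply_sum _ _ _ _ {i}, Finset.sum_singleton]
      intro k hk
      rw [hA _ _ (sub_ne_zero.2 (by simpa using hk)), zero_mul]
    rw [CentralExt.base_lie, BandMat.lie_def, BandMat.sub_apply, hmul _ _ hx.1, hmul _ _ hy.1]
    by_cases hij : i = j
    · subst hij
      rw [mul_comm, sub_self]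
      rfl
    · rw [hx.1 i j (by omega), hy.1 i j (by omega), mul_zero, mul_zero, sub_zero]
      rfl
  · rw [CentralExt.centre_lie]
    exact cocycle_apply_of_entries hx.1 hy.1 (Or.inl rfl)

section SumDegree

variable {N : ℕ} {ε : ℤˣ} {M : ℕ} {a : Fin M → ℂ} {m : Fin M → ℕ}

theorem lie_mem_targetDegree {a : ℂ} {m : ℕ} {d e : ℤ} {x y : targetAlg N ε a m}
    (hx : x ∈ targetDegree N ε a m d) (hy : y ∈ targetDegree N ε a m e) :
    ⁅x, y⁆ ∈ targetDegree N ε a m (d + e) :=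
  lie_mem_glDegree (x := (x : GlHat m)) (y := (y : GlHat m)) hx hy

theorem lie_mem_sumDegree {d e : ℤ} {x y : TargetSum N ε a m} (hx : x ∈ sumDegree N ε a m d)
    (hy : y ∈ sumDegree N ε a m e) : ⁅x, y⁆ ∈ sumDegree N ε a m (d + e) := by
  rw [mem_sumDegree] at *
  exact fun i => lie_mem_targetDegree (hx i) (hy i)

theorem lie_eq_zero_of_mem_sumDegree_zero {x y : TargetSum N ε a m}
    (hx : x ∈ sumDegree N ε a m 0) (hy : y ∈ sumDegree N ε a m 0) : ⁅x, y⁆ = 0 := by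
  rw [mem_sumDegree] at *
  funext i
  exact Subtype.ext (lie_eq_zero_of_mem_glDegree_zero (hx i) (hy i))

theorem iSup_sumDegree [NeZero N] : ⨆ d, sumDegree N ε a m d = ⊤ := by
  rw [eq_top_iff]
  intro x _
  choose κ hκ using fun i => exists_axis N ε (a i)
  let comp : ℤ → TargetSum N ε a m := fun d i =>
    ⟨CentralExt.mk _ (BandMat.scale (fun p p2 => if p2 - p = d then 1 else 0)
        (x i : GlHat (m i)).base)
      (if d = 0 then (x i : GlHat (m i)).centre else 0),
      (hκ i (m i)).1 _ (fun p p2 => by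
        rw [show κ i - p - (κ i - p2) = p2 - p by ring]) _ (x i).2 _⟩
  choose b hb using fun i => (x i : GlHat (m i)).base.exists_band
  let B : ℕ := Finset.univ.sup b
  have hx : x = ∑ d ∈ Finset.Icc (-B : ℤ) B, comp d := by
    funext i
    rw [Finset.sum_apply]
    apply Subtype.ext
    rw [← LieSubalgebra.coe_incl, map_sum]
    ext1
    · ext p p2
      have hsum : ∀ (s : Finset ℤ) (f : ℤ → GlHat (m i)),
          (∑ d ∈ s, f d).base p p2 = ∑ d ∈ s, (f d).base p p2 := by
        intro s f
        induction s using Finset.induction_on with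
        | empty => simp
        | insert d s hd ih => rw [Finset.sum_insert hd, Finset.sum_insert hd, map_add,
            BandMat.add_apply, ih]
      rw [hsum]
      simp only [comp, LieSubalgebra.coe_incl, CentralExt.base_mk, BandMat.scale_apply, ite_smul,
        one_smul, zero_smul, Finset.sum_ite_eq, Finset.mem_Icc]
      split_ifs with h
      · rfl
      · refine hb i p p2 ?_
        have : b i ≤ B := Finset.le_sup (Finset.mem_univ i)
        rw [lt_abs]
        omega
    · rw [map_sum]
      simp only [comp, LieSubalgebra.coe_incl, CentralExt.centre_mk, Finset.sum_ite_eq',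
        Finset.mem_Icc]
      rw [if_pos (by omega)]
  rw [hx]
  refine Submodule.sum_mem _ fun d _ => Submodule.mem_iSup_of_mem d ?_
  rw [mem_sumDegree]
  intro i
  rw [mem_targetDegree]
  refine ⟨fun p p2 h => ?_, fun h => ?_⟩
  · simp only [comp, CentralExt.base_mk, BandMat.scale_apply, if_neg h, zero_smul]
  · simp only [comp, CentralExt.centre_mk, if_neg h]

end SumDegree

/-! ### Smoothness of quasifinite modules -/

section Smooth

open Polynomial

theorem cocycle_apply_of_diagonal {K : Type*} [CommRing K] [Algebra ℂ K] {A : BandMat K}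
    (hA : ∀ i j, i ≠ j → A i j = 0) (B : BandMat K) : BandMat.cocycle.toBilin A B = 0 := by
  rw [BandMat.cocycle_apply, BandMat.trace]
  refine finsum_eq_zero_of_forall_eq_zero fun i => ?_
  rw [BandMat.mul_apply]
  refine finsum_eq_zero_of_forall_eq_zero fun k => ?_
  rw [BandMat.lie_J_apply]
  by_cases h : i = k
  · subst h
    rw [sub_self, zero_mul, zero_mul]
  · rw [hA _ _ h, mul_zero, zero_mul]

theorem base_lie_scale_one {m : ℕ} (g : ℤ → ℂ) (z : TruncPoly m) (x : GlHat m) (i j : ℤ) :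
    ⁅(CentralExt.mk _ (BandMat.scale (fun i _ => g i) 1) z : GlHat m), x⁆.base i j
      = (g i - g j) • x.base i j := by
  rw [CentralExt.base_lie, CentralExt.base_mk, BandMat.lie_def, BandMat.sub_apply,
    BandMat.mul_apply_sum _ _ _ _ {i}, BandMat.mul_apply_sum _ _ _ _ {j}, Finset.sum_singleton,
    Finset.sum_singleton, BandMat.scale_apply, BandMat.scale_apply, BandMat.one_apply,
    BandMat.one_apply, if_pos rfl, if_pos rfl, smul_mul_assoc, one_mul, mul_smul_comm, mul_one,
    sub_smul]
  · intro k hk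
    rw [BandMat.scale_apply, BandMat.one_apply, if_neg (by simpa using hk), smul_zero, mul_zero]
  · intro k hk
    rw [BandMat.scale_apply, BandMat.one_apply, if_neg (by simpa [eq_comm] using hk), smul_zero,
      zero_mul]

theorem finite_setOf_eval_cube_sub_cube {p : ℂ[X]} (hp : p ≠ 0) {d : ℤ} (hd : d ≠ 0) (c : ℂ) :
    {l : ℤ | p.eval (((l : ℂ) - c) ^ 3 - (((l + d : ℤ) : ℂ) - c) ^ 3) = 0}.Finite := by
  have hdc : (d : ℂ) ≠ 0 := by exact_mod_cast hd
  set E : ℂ[X] := C (-3 * d : ℂ) * X ^ 2 + C (6 * d * c - 3 * d ^ 2 : ℂ) * X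
    + C (-3 * d * c ^ 2 + 3 * d ^ 2 * c - d ^ 3 : ℂ) with hE
  have hdeg : E.natDegree = 2 := natDegree_quadratic (mul_ne_zero (by norm_num) hdc)
  have hpE : p.comp E ≠ 0 := by
    intro h
    rcases comp_eq_zero_iff.1 h with h | ⟨-, h⟩
    · exact hp h
    · rw [h, natDegree_C] at hdeg
      omega
  refine ((p.comp E).roots.toFinset.finite_toSet.preimage
    (Int.cast_injective (α := ℂ)).injOn).subset fun l hl => ?_
  rw [Set.mem_preimage, Finset.mem_coe, Multiset.mem_toFinset, mem_roots hpE, IsRoot.def, eval_comp]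
  have h1 : E.eval (l : ℂ) = ((l : ℂ) - c) ^ 3 - (((l + d : ℤ) : ℂ) - c) ^ 3 := by
    rw [hE]
    simp only [eval_add, eval_mul, eval_C, eval_pow, eval_X]
    push_cast
    ring
  rw [h1]
  exact hl

/-- Take for `D` the diagonal matrix with the entries `(l - κ/2)³`. Then `ad D` multiplies the
entry at `(l, l + d)` by a quadratic polynomial in `l`, so that `p(ad D)` is invertible on the
matrices of degree `d` away from finitely many places. -/
theorem exists_forall_eq_aeval_ad (N : ℕ) [NeZero N] (ε : ℤˣ) (a : ℂ) (m : ℕ) :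
    ∃ D ∈ targetDegree N ε a m 0, ∀ d : ℤ, d ≠ 0 → ∀ p : ℂ[X], p ≠ 0 → ∃ F : Finset ℤ,
      ∀ x ∈ targetDegree N ε a m d, (∀ l ∈ F, (x : GlHat m).base l (l + d) = 0) →
        ∃ y ∈ targetDegree N ε a m d, aeval (LieAlgebra.ad ℂ _ D) p y = x := by
  obtain ⟨κ, hκ⟩ := exists_axis N ε a
  obtain ⟨hscale, hdiag⟩ := hκ m
  let g : ℤ → ℂ := fun l => ((l : ℂ) - κ / 2) ^ 3
  have hg : ∀ l, g (κ - l) = -g l := fun l => by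
    simp only [g]
    push_cast
    ring
  let D : targetAlg N ε a m := ⟨_, hdiag g hg⟩
  have hDoff : ∀ i j : ℤ, i ≠ j → (D : GlHat m).base i j = 0 := fun i j hij => by
    change BandMat.scale _ 1 i j = 0
    rw [BandMat.scale_apply, BandMat.one_apply, if_neg hij, smul_zero]
  refine ⟨D, ⟨fun i j h => hDoff i j (by omega), fun h => absurd rfl h⟩, fun d hd p hp => ?_⟩
  refine ⟨(finite_setOf_eval_cube_sub_cube hp hd (κ / 2)).toFinset, fun x hx hxF => ?_⟩
  rw [mem_targetDegree] at hx
  let y : targetAlg N ε a m := ⟨_, hscale (fun i j => (p.eval (g i - g j))⁻¹) (fun i j => by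
    rw [hg, hg, neg_sub_neg]) x x.2 0⟩
  have hbase : ∀ i j, (aeval (LieAlgebra.ad ℂ _ D) p y : targetAlg N ε a m).1.base i j
      = p.eval (g i - g j) • y.1.base i j := by
    intro i j
    let f : targetAlg N ε a m →ₗ[ℂ] TruncPoly m :=
      { toFun := fun x => x.1.base i j
        map_add' := fun _ _ => rfl
        map_smul' := fun _ _ => rfl }
    have h := map_aeval_of_intertwines f (A := LieAlgebra.ad ℂ _ D)
      (B := algebraMap ℂ _ (g i - g j)) (fun w => by
        rw [Module.algebraMap_end_apply]
        exact base_lie_scale_one g 0 w.1 i j) p y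
    rw [aeval_algebraMap_apply, Module.algebraMap_end_apply, coe_aeval_eq_eval] at h
    exact h
  have hcentre : (aeval (LieAlgebra.ad ℂ _ D) p y : targetAlg N ε a m).1.centre = 0 := by
    have h := map_aeval_of_intertwines
      ((CentralExt.centre).comp (targetAlg N ε a m).toSubmodule.subtype)
      (A := LieAlgebra.ad ℂ _ D) (B := 0) (fun w => cocycle_apply_of_diagonal hDoff _) p y
    have hy : ((CentralExt.centre).comp (targetAlg N ε a m).toSubmodule.subtype) y = 0 := rfl
    rw [hy, map_zero] at h
    exact h
  refine ⟨y, ⟨fun i j h => ?_, fun _ => rfl⟩, Subtype.ext (CentralExt.ext ?_ ?_)⟩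
  · change BandMat.scale _ _ i j = 0
    rw [BandMat.scale_apply, hx.1 i j h, smul_zero]
  · ext i j
    rw [hbase]
    change _ • BandMat.scale _ _ i j = _
    rw [BandMat.scale_apply]
    by_cases hij : j - i = d
    · obtain rfl : j = i + d := by omega
      by_cases h0 : p.eval (g i - g (i + d)) = 0
      · rw [h0, zero_smul, hxF]
        exact (Set.Finite.mem_toFinset _).2 h0
      · rw [smul_smul, mul_inv_cancel₀ h0, one_smul]
    · rw [hx.1 i j hij, smul_zero, smul_zero]
  · rw [hcentre, hx.2 hd]

/-- A module over the direct sum is smooth if every vector is killed by those elements of degree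
`d ≠ 0` which vanish at finitely many places, depending on `d` and on the vector. -/
def IsSmooth (N : ℕ) (ε : ℤˣ) {M : ℕ} (a : Fin M → ℂ) (m : Fin M → ℕ) (V : Type*) [AddCommGroup V]
    [Module ℂ V] [LieRingModule (TargetSum N ε a m) V] : Prop :=
  ∀ (v : V) (d : ℤ), d ≠ 0 → ∃ F : Finset ℤ, ∀ x ∈ sumDegree N ε a m d,
    (∀ i, ∀ l ∈ F, (x i : GlHat (m i)).base l (l + d) = 0) → ⁅x, v⁆ = 0

variable {N : ℕ} {ε : ℤˣ} {M : ℕ} {a : Fin M → ℂ} {m : Fin M → ℕ}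

theorem lie_tprod {V : Fin M → Type*} [∀ i, AddCommGroup (V i)] [∀ i, Module ℂ (V i)]
    [∀ i, LieRingModule (targetAlg N ε (a i) (m i)) (V i)]
    [∀ i, LieModule ℂ (targetAlg N ε (a i) (m i)) (V i)] (x : TargetSum N ε a m) (v : ∀ i, V i) :
    ⁅x, PiTensorProduct.tprod ℂ v⁆
      = ∑ i, PiTensorProduct.tprod ℂ (Function.update v i ⁅x i, v i⁆) := by
  change tensorAction V x (PiTensorProduct.tprod ℂ v) = _
  simp only [tensorAction, LinearMap.coe_mk, AddHom.coe_mk, LinearMap.sum_apply]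
  refine Finset.sum_congr rfl fun i _ => ?_
  simp only [tensorAt, LinearMap.coe_mk, AddHom.coe_mk, PiTensorProduct.map_tprod]
  congr 1
  funext j
  by_cases h : j = i
  · subst h
    simp
  · simp [h]

variable [NeZero N]

theorem IsQuasifinite.isSmooth {V : Type*} [AddCommGroup V] [Module ℂ V]
    [LieRingModule (TargetSum N ε a m) V] [LieModule ℂ (TargetSum N ε a m) V]
    (h : IsQuasifinite (sumDegree N ε a m) V) : IsSmooth N ε a m V := by
  intro v d hd
  choose D hD hDp using fun i => exists_forall_eq_aeval_ad N ε (a i) (m i)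
  have hD0 : (D : TargetSum N ε a m) ∈ sumDegree N ε a m 0 := mem_sumDegree.2 hD
  obtain ⟨p, hp, hpv⟩ := h.exists_aeval_ad_lie_eq_zero hD0 (k := d) (fun x hx => by
    have := lie_mem_sumDegree hD0 hx
    rwa [zero_add] at this) v
  choose F hF using fun i => hDp i d hd p hp
  refine ⟨Finset.univ.biUnion F, fun x hx hxF => ?_⟩
  choose y hy hyx using fun i => hF i (x i) (mem_sumDegree.1 hx i) fun l hl =>
    hxF i l (Finset.mem_biUnion.2 ⟨i, Finset.mem_univ i, hl⟩)
  have hxy : aeval (LieAlgebra.ad ℂ (TargetSum N ε a m) D) p y = x := by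
    funext i
    rw [← hyx i]
    exact map_aeval_of_intertwines
      (LinearMap.proj (R := ℂ) (φ := fun i => targetAlg N ε (a i) (m i)) i)
      (A := LieAlgebra.ad ℂ (TargetSum N ε a m) D) (B := LieAlgebra.ad ℂ _ (D i))
      (fun _ => rfl) p y
  rw [← hxy]
  exact hpv y (mem_sumDegree.2 hy)

theorem isSmooth_piTensorProduct {V : Fin M → Type*} [∀ i, AddCommGroup (V i)]
    [∀ i, Module ℂ (V i)] [∀ i, LieRingModule (targetAlg N ε (a i) (m i)) (V i)]
    [∀ i, LieModule ℂ (targetAlg N ε (a i) (m i)) (V i)]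
    (h : ∀ i, IsQuasifinite (targetDegree N ε (a i) (m i)) (V i)) :
    IsSmooth N ε a m (PiTensorProduct ℂ V) := by
  intro v d hd
  induction v using PiTensorProduct.induction_on with
  | smul_tprod c v =>
    have key : ∀ i, ∃ F : Finset ℤ, ∀ x ∈ targetDegree N ε (a i) (m i) d,
        (∀ l ∈ F, (x : GlHat (m i)).base l (l + d) = 0) → ⁅x, v i⁆ = 0 := by
      intro i
      obtain ⟨D, hD, hDp⟩ := exists_forall_eq_aeval_ad N ε (a i) (m i)
      obtain ⟨p, hp, hpv⟩ := (h i).exists_aeval_ad_lie_eq_zero hD (k := d) (fun x hx => by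
        have := lie_mem_targetDegree hD hx
        rwa [zero_add] at this) (v i)
      obtain ⟨F, hF⟩ := hDp d hd p hp
      refine ⟨F, fun x hx hxF => ?_⟩
      obtain ⟨y, hy, rfl⟩ := hF x hx hxF
      exact hpv y hy
    choose F hF using key
    refine ⟨Finset.univ.biUnion F, fun x hx hxF => ?_⟩
    rw [lie_smul, lie_tprod, Finset.sum_eq_zero, smul_zero]
    intro i _
    refine (PiTensorProduct.tprod ℂ).map_coord_zero i ?_
    rw [Function.update_self]
    exact hF i (x i) (mem_sumDegree.1 hx i) fun l hl =>
      hxF i l (Finset.mem_biUnion.2 ⟨i, Finset.mem_univ i, hl⟩)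
  | add v w hv hw =>
    obtain ⟨F, hF⟩ := hv
    obtain ⟨G, hG⟩ := hw
    refine ⟨F ∪ G, fun x hx hxF => ?_⟩
    rw [lie_add, hF x hx fun i l hl => hxF i l (Finset.mem_union_left _ hl),
      hG x hx fun i l hl => hxF i l (Finset.mem_union_right _ hl), add_zero]

end Smooth

/-! ### Interpolation by Laurent polynomials in `T_q` -/

section TruncPoly

open Polynomial

theorem TruncPoly.exists_eq_algebraMap_add (m : ℕ) (z : TruncPoly m) :
    ∃ (c : ℂ) (z2 : TruncPoly m), z = algebraMap ℂ _ c + uu m * z2 := by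
  induction z using AdjoinRoot.induction_on with
  | ih f =>
    refine ⟨f.coeff 0, AdjoinRoot.mk _ f.divX, ?_⟩
    conv_lhs => rw [← divX_mul_X_add f]
    rw [map_add, map_mul, AdjoinRoot.mk_C, AdjoinRoot.mk_X, uu, mul_comm, add_comm]
    rfl

/-- If `t` differs from a constant by a unit multiple of `u`, then `t` generates `R_m`. -/
theorem TruncPoly.aeval_surjective {m : ℕ} {t c : TruncPoly m} {P : ℂ} (hc : IsUnit c)
    (ht : t = algebraMap ℂ _ P + uu m * c) (z : TruncPoly m) : ∃ f : ℂ[X], aeval t f = z := by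
  obtain ⟨c, rfl⟩ := hc
  have key : ∀ n : ℕ, ∃ (f : ℂ[X]) (z2 : TruncPoly m), z = aeval t f + uu m ^ n * z2 := by
    intro n
    induction n with
    | zero => exact ⟨0, z, by simp⟩
    | succ n ih =>
      obtain ⟨f, z2, hz⟩ := ih
      obtain ⟨s, z3, hz3⟩ := TruncPoly.exists_eq_algebraMap_add m
        (((c⁻¹ : (TruncPoly m)ˣ) : TruncPoly m) ^ n * z2)
      refine ⟨f + C s * (X - C P) ^ n, (c : TruncPoly m) ^ n * z3, ?_⟩
      have h1 : aeval t (X - C P) = uu m * c := by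
        rw [map_sub, aeval_X, aeval_C, ht, add_sub_cancel_left]
      have h2 : (c : TruncPoly m) ^ n * ((c⁻¹ : (TruncPoly m)ˣ) : TruncPoly m) ^ n = 1 := by
        rw [← mul_pow, Units.mul_inv, one_pow]
      rw [map_add, map_mul, map_pow, aeval_C, h1, hz]
      linear_combination (uu m ^ n * (c : TruncPoly m) ^ n) * hz3 - (uu m ^ n * z2) * h2
  obtain ⟨f, z2, hz⟩ := key (m + 1)
  exact ⟨f, by rw [hz, uu_pow, zero_mul, add_zero]⟩

theorem exists_sum_smul_pow_eq {R : Type*} [CommRing R] [Algebra ℂ R] {x : R} {m : ℕ}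
    (hx : x ^ (m + 1) = 0) (c : ℕ → ℂ) : ∃ s : R, ∑ j ∈ Finset.range (m + 1), c j • x ^ j
      = algebraMap ℂ R (c 0) + x * (algebraMap ℂ R (c 1) + x * s) := by
  refine ⟨∑ j ∈ Finset.range m, c (j + 2) • x ^ j, ?_⟩
  have h : ∑ j ∈ Finset.range (m + 1), c j • x ^ j = ∑ j ∈ Finset.range (m + 2), c j • x ^ j := by
    rw [Finset.sum_range_succ _ (m + 1), hx, smul_zero, add_zero]
  rw [h, Finset.sum_range_succ', Finset.sum_range_succ', mul_add, Finset.mul_sum, Finset.mul_sum]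
  simp only [Algebra.smul_def, pow_zero, mul_one, zero_add, pow_one]
  rw [add_comm, mul_comm x, add_comm (Finset.sum _ _)]
  congr 2
  refine Finset.sum_congr rfl fun j _ => ?_
  ring

theorem exists_qpow_one_eq {ℓ : ℂ} (hℓ : ℓ ≠ 0) (m : ℕ) (b : ℂ) : ∃ c : TruncPoly m, IsUnit c ∧
    qpow ℓ m 1 b = algebraMap ℂ _ (Complex.exp (ℓ * b)) + uu m * c := by
  obtain ⟨s, hs⟩ := exists_sum_smul_pow_eq (uu_pow m)
    fun j => (1 * ℓ) ^ j / (j.factorial : ℂ)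
  refine ⟨algebraMap ℂ _ (Complex.exp (ℓ * b)) * (algebraMap ℂ _ ℓ + uu m * s), ?_, ?_⟩
  · refine IsUnit.mul ((IsUnit.mk0 _ (Complex.exp_ne_zero _)).map _) ?_
    exact IsNilpotent.isUnit_add_left_of_commute
      ((Commute.all _ _).isNilpotent_mul_right ⟨m + 1, uu_pow m⟩) ((IsUnit.mk0 _ hℓ).map _)
      (Commute.all _ _)
  · rw [qpow, hs, Algebra.smul_def]
    simp only [one_mul, pow_zero, pow_one, Nat.factorial_zero, Nat.factorial_one, Nat.cast_one,
      div_one, map_one]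
    ring

theorem qpow_natCast (ℓ : ℂ) (m n : ℕ) (b : ℂ) : qpow ℓ m n b = qpow ℓ m 1 b ^ n := by
  induction n with
  | zero => rw [Nat.cast_zero, qpow_zero, pow_zero]
  | succ n ih => rw [Nat.cast_succ, qpow_add, ih, ← pow_succ]

/-- A polynomial with a prescribed value at `t`, a nilpotent perturbation of `P`, which vanishes to
order `K` at finitely many other points. -/
theorem exists_aeval_eq_of_isNilpotent_sub {R : Type*} [CommRing R] [Algebra ℂ R] {t : R} {P : ℂ}
    (ht : IsNilpotent (t - algebraMap ℂ R P)) (hsurj : ∀ z : R, ∃ f : ℂ[X], aeval t f = z) (K : ℕ)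
    (z : R) {S : Finset ℂ} (hS : P ∉ S) :
    ∃ f : ℂ[X], aeval t f = z ∧ ∀ Q ∈ S, (X - C Q) ^ K ∣ f := by
  have hu : IsUnit (aeval t (∏ Q ∈ S, (X - C Q) ^ K)) := by
    rw [map_prod, IsUnit.prod_iff]
    intro Q hQ
    rw [map_pow, map_sub, aeval_X, aeval_C, ← sub_add_sub_cancel _ (algebraMap ℂ R P), ← map_sub]
    refine IsUnit.pow _ (IsNilpotent.isUnit_add_right_of_commute ht ?_ (Commute.all _ _))
    exact (IsUnit.mk0 _ (sub_ne_zero.2 fun h : P = Q => hS (by rw [h]; exact hQ))).map _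
  obtain ⟨w, hw⟩ := hu.exists_left_inv
  obtain ⟨g, hg⟩ := hsurj (z * w)
  refine ⟨g * ∏ P ∈ S, (X - C P) ^ K, ?_, fun P hP =>
    (Finset.dvd_prod_of_mem (fun P => (X - C P) ^ K) hP).trans (dvd_mul_left _ _)⟩
  rw [map_mul, hg, mul_assoc, hw, mul_one]

theorem exists_aeval_qpow_eq {ℓ : ℂ} (hℓ : ℓ ≠ 0) (m K : ℕ) (b : ℂ) (z : TruncPoly m)
    (S : Finset ℂ) (hS : Complex.exp (ℓ * b) ∉ S) :
    ∃ f : ℂ[X], aeval (qpow ℓ m 1 b) f = z ∧ ∀ P ∈ S, (X - C P) ^ K ∣ f := by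
  obtain ⟨c, hc, ht⟩ := exists_qpow_one_eq hℓ m b
  refine exists_aeval_eq_of_isNilpotent_sub ?_ (TruncPoly.aeval_surjective hc ht) K z hS
  rw [ht, add_sub_cancel_left]
  exact (Commute.all _ _).isNilpotent_mul_right ⟨m + 1, uu_pow m⟩

theorem aeval_qpow_eq_zero {ℓ : ℂ} (hℓ : ℓ ≠ 0) {m K : ℕ} (hK : m < K) (b : ℂ) {f : ℂ[X]}
    (hf : (X - C (Complex.exp (ℓ * b))) ^ K ∣ f) : aeval (qpow ℓ m 1 b) f = 0 := by
  obtain ⟨c, -, ht⟩ := exists_qpow_one_eq hℓ m b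
  obtain ⟨g, rfl⟩ := hf
  rw [map_mul, map_pow, map_sub, aeval_X, aeval_C, ht, add_sub_cancel_left, mul_pow,
    pow_eq_zero_of_le hK (uu_pow m), zero_mul, zero_mul]

end TruncPoly

section Lattice

theorem ne_zero_of_exp_eq {q : ℂˣ} {ℓ : ℂ} (hℓ : Complex.exp ℓ = q) (hq : ‖(q : ℂ)‖ ≠ 1) :
    ℓ ≠ 0 := by
  rintro rfl
  rw [Complex.exp_zero] at hℓ
  rw [← hℓ, norm_one] at hq
  exact hq rfl

theorem InLattice.add_int {ℓ x : ℂ} (h : InLattice ℓ x) (n : ℤ) : InLattice ℓ (x + n) := by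
  obtain ⟨b, c, rfl⟩ := h
  exact ⟨b + n, c, by push_cast; ring⟩

theorem InLattice.neg {ℓ x : ℂ} (h : InLattice ℓ x) : InLattice ℓ (-x) := by
  obtain ⟨b, c, rfl⟩ := h
  exact ⟨-b, -c, by push_cast; ring⟩

theorem inLattice_of_exp_eq {ℓ : ℂ} (hℓ : ℓ ≠ 0) {x y : ℂ}
    (h : Complex.exp (ℓ * x) = Complex.exp (ℓ * y)) : InLattice ℓ (x - y) := by
  obtain ⟨n, hn⟩ := Complex.exp_eq_exp_iff_exists_int.1 h
  refine ⟨0, n, ?_⟩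
  rw [inv_div]
  have h2 : ℓ * (x - y) = n * (2 * Real.pi * Complex.I) := by linear_combination hn
  field_simp
  push_cast
  linear_combination h2

end Lattice

section QDegree

open Polynomial

variable {q : ℂˣ} {N : ℕ}

/-- The component of degree `d` of the algebra of matrix quantum pseudodifferential operators; it
is mapped to the matrices of degree `d`. With indices in `{0, …, N - 1}` the degree of
`z^k T_q^n E_{i,j}` is `k N + i - j`. -/
noncomputable def qDegree (q : ℂˣ) (N : ℕ) (d : ℤ) : Submodule ℂ (QMat q N) :=
  Submodule.span ℂ {x | ∃ (k n : ℤ) (i j : Fin N), k * N + (i : ℕ) - (j : ℕ) = d ∧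
    x = QMat.mon k n (Matrix.single i j 1)}

theorem sigma_mem_qDegree (ε : ℤˣ) (r : ℤ) {d : ℤ} {x : QMat q N} (hx : x ∈ qDegree q N d) :
    QMat.sigma ε r x ∈ qDegree q N d := by
  induction hx using Submodule.span_induction with
  | zero => rw [map_zero]; exact zero_mem _
  | add x y _ _ hx hy => rw [map_add]; exact add_mem hx hy
  | smul c x _ hx => rw [map_smul]; exact Submodule.smul_mem _ c hx
  | mem x hx =>
    obtain ⟨k, n, i, j, hd, rfl⟩ := hx
    have hA : (Matrix.single i j (1 : ℂ)).transpose.submatrix Fin.rev Fin.rev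
        = Matrix.single j.rev i.rev 1 := by
      ext p p2
      simp only [Matrix.submatrix_apply, Matrix.transpose_apply, Matrix.single_apply]
      congr 1
      rw [eq_comm (a := i), eq_comm (a := j), Fin.rev_eq_iff, Fin.rev_eq_iff, and_comm,
        eq_comm (a := p), eq_comm (a := p2)]
    rw [QMat.sigma_mon, hA, Units.smul_def, ← Int.cast_smul_eq_zsmul ℂ]
    refine Submodule.smul_mem _ _ (Submodule.smul_mem _ _ (Submodule.subset_span
      ⟨k, _, _, _, ?_, rfl⟩))
    rw [Fin.val_rev, Fin.val_rev]
    have := i.2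
    have := j.2
    omega

theorem phiCentre_eq_zero_of_mem_qDegree (ℓ a : ℂ) (m : ℕ) {d : ℤ} (hd : d ≠ 0) {x : QMat q N}
    (hx : x ∈ qDegree q N d) : phiCentre q N ℓ a m x = 0 := by
  induction hx using Submodule.span_induction with
  | zero => rw [map_zero]
  | add x y _ _ hx hy => rw [map_add, hx, hy, add_zero]
  | smul c x _ hx => rw [map_smul, hx, smul_zero]
  | mem x hx =>
    obtain ⟨k, n, i, j, rfl, rfl⟩ := hx
    rw [phiCentre, QMat.lift_mon]
    split_ifs with h
    · rw [h.1, zero_mul, zero_add, sub_ne_zero] at hd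
      have hij : i ≠ j := fun h => hd (by rw [h])
      rw [LinearMap.smulRight_apply, Matrix.traceLinearMap_apply,
        Matrix.trace_single_eq_of_ne _ _ _ hij, zero_smul]
    · rfl

/-- `z^k f(T_q) A` for a polynomial `f`. -/
noncomputable def polyMon (k : ℤ) (A : Matrix (Fin N) (Fin N) ℂ) (f : ℂ[X]) : QMat q N :=
  ∑ n ∈ f.support, f.coeff n • QMat.mon k n A

theorem polyMon_mem_qDegree {k d : ℤ} {i j : Fin N} (h : k * N + (i : ℕ) - (j : ℕ) = d)
    (f : ℂ[X]) : polyMon (q := q) k (Matrix.single i j 1) f ∈ qDegree q N d :=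
  Submodule.sum_mem _ fun n _ => Submodule.smul_mem _ _
    (Submodule.subset_span ⟨k, n, i, j, h, rfl⟩)

variable [NeZero N]

theorem phiMat_apply_eq_zero_of_mem_qDegree (ℓ a : ℂ) (m : ℕ) {d : ℤ} {x : QMat q N}
    (hx : x ∈ qDegree q N d) (p p2 : ℤ) (hp : p2 - p ≠ d) : phiMat q N ℓ a m x p p2 = 0 := by
  induction hx using Submodule.span_induction with
  | zero => rw [map_zero]; rfl
  | add x y _ _ hx hy => rw [map_add, BandMat.add_apply, hx, hy, add_zero]
  | smul c x _ hx => rw [map_smul, BandMat.smul_apply, hx, smul_zero]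
  | mem x hx =>
    obtain ⟨k, n, i, j, rfl, rfl⟩ := hx
    rw [phiMat_mon, blockMat_apply]
    split_ifs with h
    · rw [Matrix.single_apply, if_neg, zero_smul]
      rintro ⟨rfl, rfl⟩
      refine hp ?_
      have h1 := blk_mul_sub N p
      have h2 := blk_mul_sub N p2
      rw [← h]
      linear_combination h1 - h2
    · rfl

/-- Up to a factor independent of `y`, the image of `σ(y)` for the parameter `a` is the mirror
image of the image of `y` for the parameter `2 - a`. -/
theorem exists_phiMat_sigma_eq {ℓ : ℂ} (hℓ : Complex.exp ℓ = q) (ε : ℤˣ) (r : ℤ) (a : ℂ) (m : ℕ) :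
    ∃ c : ℤ → ℤ → TruncPoly m, ∀ (y : QMat q N) (p p2 : ℤ),
      phiMat q N ℓ a m (QMat.sigma ε r y) p p2
        = c p p2 * negU m (phiMat q N ℓ (2 - a) m y (1 - p2) (1 - p)) := by
  let k : ℤ → ℤ → ℤ := fun p p2 => blk N p2 - blk N p
  refine ⟨fun p p2 => ((ε ^ k p p2 : ℤˣ) : ℂ) •
    ((q ^ (k p p2 * (k p p2 - 1) / 2 * r) : ℂˣ) : ℂ) •
      qpow ℓ m ((k p p2 * r : ℤ) : ℂ) (a - blk N p2),
    fun y p p2 => ?_⟩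
  induction y using QMat.induct with
  | h0 => simp
  | hadd x y hx hy => simp only [map_add, BandMat.add_apply, mul_add]; rw [hx, hy]
  | hmon k0 n A =>
    have hm : ∀ x : ℤ, blk N (1 - x) = 1 - blk N x ∧ pos N (1 - x) = (pos N x).rev := fun x => by
      have h := blk_mirror N x 1
      rwa [sub_self, zero_mul, add_zero] at h
    rw [QMat.sigma_mon, Units.smul_def, ← Int.cast_smul_eq_zsmul ℂ, map_smul, map_smul,
      BandMat.smul_apply, BandMat.smul_apply, phiMat_mon, phiMat_mon, blockMat_apply,
      blockMat_apply, (hm p).1, (hm p2).1, (hm p).2, (hm p2).2,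
      show 1 - blk N p - (1 - blk N p2) = blk N p2 - blk N p by ring]
    by_cases hk : blk N p2 - blk N p = k0
    · rw [if_pos hk, if_pos hk, map_smul, negU_qpow]
      subst hk
      have h1 : -(2 - a - ((1 - blk N p : ℤ) : ℂ)) = (a - blk N p2) + ((k p p2 - 1 : ℤ) : ℂ) := by
        simp only [k]
        push_cast
        ring
      have h2 : ((-n : ℤ) : ℂ) = -(n : ℂ) := by push_cast; ring
      have h3 : ((((blk N p2 - blk N p) * r - n : ℤ)) : ℂ)
          = ((k p p2 * r : ℤ) : ℂ) + ((-n : ℤ) : ℂ) := by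
        simp only [k]
        push_cast
        ring
      rw [h1, ← h2, qpow_int hℓ, h3, qpow_add]
      simp only [smul_mul_assoc, mul_smul_comm, smul_smul, Matrix.submatrix_apply,
        Matrix.transpose_apply]
      congr 1
      rw [show (k p p2) * (k p p2 - 1) / 2 * r
          = (blk N p2 - blk N p) * ((blk N p2 - blk N p) - 1) / 2 * r from rfl,
        zpow_add, Units.val_mul, show -n * (k p p2 - 1) = (1 - (blk N p2 - blk N p)) * n by
          simp only [k]; ring]
      simp only [k]
      ring
    · rw [if_neg hk, if_neg hk]
      simp

theorem phiMat_polyMon (ℓ a : ℂ) (m : ℕ) (k : ℤ) (A : Matrix (Fin N) (Fin N) ℂ) (f : ℂ[X]) :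
    phiMat q N ℓ a m (polyMon k A f)
      = blockMat k (fun l => aeval (qpow ℓ m 1 (a - l)) f) A := by
  have hsum : ∀ (s : Finset ℕ) (g : ℕ → GlInf m) (p p2 : ℤ),
      (∑ n ∈ s, g n) p p2 = ∑ n ∈ s, g n p p2 := by
    intro s g p p2
    induction s using Finset.induction_on with
    | empty => simp
    | insert d s hd ih => rw [Finset.sum_insert hd, Finset.sum_insert hd, BandMat.add_apply, ih]
  ext p p2
  rw [polyMon, map_sum, hsum, blockMat_apply]
  simp only [map_smul, BandMat.smul_apply, phiMat_mon, blockMat_apply]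
  split_ifs with h
  · rw [aeval_eq_sum_range, Finset.smul_sum,
      Finset.sum_subset (Finset.subset_iff.2 fun n hn => Finset.mem_range_succ_iff.2
        (le_natDegree_of_mem_supp n hn))]
    · refine Finset.sum_congr rfl fun n _ => ?_
      rw [Int.cast_natCast, qpow_natCast, smul_comm]
    · intro n _ hn
      rw [notMem_support_iff.1 hn, zero_smul]
  · simp

/-- Elements of a given degree can be found with prescribed values at finitely many places,
simultaneously for finitely many parameters that are incongruent modulo `ℤ + τ⁻¹ ℤ`: the points
`q^(b_i - l)` are then distinct, and polynomials with prescribed jets at distinct points exist. -/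
theorem exists_mem_qDegree_forall_phiMat_eq {ℓ : ℂ} (hℓ : Complex.exp ℓ = q) (hq : ‖(q : ℂ)‖ ≠ 1)
    {ι : Type*} [Fintype ι] (b : ι → ℂ) (m : ι → ℕ)
    (hb : ∀ i j, i ≠ j → ¬ InLattice ℓ (b i - b j)) (d : ℤ) (F : Finset ℤ)
    (Y : ∀ i, ℤ → TruncPoly (m i)) : ∃ y ∈ qDegree q N d, ∀ i, ∀ p ∈ F,
      phiMat q N ℓ (b i) (m i) y p (p + d) = Y i p := by
  classical
  have hℓ0 := ne_zero_of_exp_eq hℓ hq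
  have single : ∀ (i0 : ι) (p0 : ℤ), ∃ y ∈ qDegree q N d,
      phiMat q N ℓ (b i0) (m i0) y p0 (p0 + d) = Y i0 p0 ∧ ∀ i, ∀ p ∈ F, (i ≠ i0 ∨ p ≠ p0) →
        phiMat q N ℓ (b i) (m i) y p (p + d) = 0 := by
    intro i0 p0
    set k := blk N (p0 + d) - blk N p0 with hk
    let P : ι → ℤ → ℂ := fun i p => Complex.exp (ℓ * (b i - blk N (p + d)))
    -- A zero of order exceeding all `m i` at the other points makes the other entries vanish.
    obtain ⟨f, hf, hfS⟩ := exists_aeval_qpow_eq hℓ0 (m i0) (Finset.univ.sup m + 1)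
      (b i0 - blk N (p0 + d)) (Y i0 p0)
      (((Finset.univ ×ˢ F).image fun x => P x.1 x.2).erase (P i0 p0)) (Finset.notMem_erase _ _)
    refine ⟨polyMon k (Matrix.single (pos N p0) (pos N (p0 + d)) 1) f,
      polyMon_mem_qDegree ?_ f, ?_, fun i p hp hne => ?_⟩
    · have h1 := blk_mul_sub N p0
      have h2 := blk_mul_sub N (p0 + d)
      rw [hk]
      linear_combination h2 - h1
    · rw [phiMat_polyMon, blockMat_apply, if_pos hk.symm, Matrix.single_apply_same, one_smul, hf]
    · rw [phiMat_polyMon, blockMat_apply]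
      by_cases hpos : pos N p = pos N p0
      · have h1 := blk_mul_sub N p0
        have h2 := blk_mul_sub N (p0 + d)
        have h3 := blk_mul_sub N p
        rw [hpos] at h3
        obtain ⟨h4, h5⟩ := blk_pos_unique N (p := p + d)
          (l := blk N (p0 + d) + blk N p - blk N p0) (i := pos N (p0 + d))
          (by linear_combination h2 + h3 - h1)
        have hPne : P i p ≠ P i0 p0 := by
          intro hP
          have hL := inLattice_of_exp_eq hℓ0 hP
          by_cases hi : i = i0
          · subst hi
            have hpp : p ≠ p0 := hne.resolve_left fun h => h rfl
            have hblk : blk N p ≠ blk N p0 := by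
              intro h
              rw [h] at h3
              exact hpp (h3.symm.trans h1)
            have hne2 : blk N (p + d) - blk N (p0 + d) ≠ 0 := by omega
            refine one_sub_zpow_ne hq hne2 ?_
            have h6 := exp_int hℓ 1 (blk N (p + d) - blk N (p0 + d))
            have h7 : ((1 : ℤ) : ℂ) * ℓ * ((blk N (p + d) - blk N (p0 + d) : ℤ) : ℂ)
                = ℓ * (b i - blk N (p0 + d)) - ℓ * (b i - blk N (p + d)) := by
              push_cast
              ring
            rw [one_mul, h7, Complex.exp_sub] at h6
            rw [← h6, sub_eq_zero, eq_comm, div_eq_one_iff_eq (Complex.exp_ne_zero _)]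
            exact hP.symm
          · refine hb i i0 hi ?_
            have h6 := hL.add_int (blk N (p + d) - blk N (p0 + d))
            convert h6 using 1
            push_cast
            ring
        have hmem : P i p ∈ ((Finset.univ ×ˢ F).image fun x => P x.1 x.2).erase (P i0 p0) :=
          Finset.mem_erase.2 ⟨hPne, Finset.mem_image.2 ⟨(i, p), by simpa using hp, rfl⟩⟩
        rw [aeval_qpow_eq_zero hℓ0 (Nat.lt_succ_of_le (Finset.le_sup (Finset.mem_univ i))) _
          (hfS _ hmem), smul_zero, ite_self]
      · have hz : Matrix.single (pos N p0) (pos N (p0 + d)) (1 : ℂ) (pos N p) (pos N (p + d))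
            = 0 := by
          rw [Matrix.single_apply, if_neg fun h => hpos h.1.symm]
        rw [hz, zero_smul, ite_self]
  choose y hy hyd hy0 using single
  refine ⟨∑ i, ∑ p ∈ F, y i p, Submodule.sum_mem _ fun i _ => Submodule.sum_mem _ fun p _ => hy i p,
    fun i p hp => ?_⟩
  let E : QMat q N →ₗ[ℂ] TruncPoly (m i) :=
    { toFun := fun x => phiMat q N ℓ (b i) (m i) x p (p + d)
      map_add' := fun x y => by rw [map_add]; rfl
      map_smul' := fun t x => by rw [map_smul]; rfl }
  change E _ = _
  rw [map_sum, Finset.sum_eq_single_of_mem i (Finset.mem_univ i), map_sum,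
    Finset.sum_eq_single_of_mem p hp]
  · exact hyd i p
  · intro p0 _ h
    exact hy0 i p0 i p hp (Or.inr h.symm)
  · intro i0 _ h
    rw [map_sum]
    exact Finset.sum_eq_zero fun p0 _ => hy0 i0 p0 i p hp (Or.inl h.symm)

end QDegree

/-! ### Density of the image -/

section Density

variable {q : ℂˣ} {N : ℕ} {ℓ : ℂ}

theorem sigma_sigma (ε : ℤˣ) (r : ℤ) (x : QMat q N) :
    QMat.sigma ε r (QMat.sigma ε r x) = x := by
  induction x using QMat.induct with
  | h0 => simp
  | hadd x y hx hy => rw [map_add, map_add, hx, hy]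
  | hmon k n A =>
    have hA : (A.transpose.submatrix Fin.rev Fin.rev).transpose.submatrix Fin.rev Fin.rev = A := by
      ext i j
      simp
    have hk : k * (k - 1) / 2 * r + (1 - k) * n + (k * (k - 1) / 2 * r + (1 - k) * (k * r - n))
        = 0 := by
      obtain ⟨w, hw⟩ : ∃ w, k * (k - 1) = 2 * w := by
        have h := Int.even_mul_pred_self k
        rw [even_iff_exists_two_mul] at h
        exact h
      rw [hw, Int.mul_ediv_cancel_left _ two_ne_zero]
      linear_combination (-r) * hw
    rw [QMat.sigma_mon, Units.smul_def, ← Int.cast_smul_eq_zsmul ℂ, map_smul, map_smul,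
      QMat.sigma_mon, hA, Units.smul_def, ← Int.cast_smul_eq_zsmul ℂ, smul_smul, smul_smul,
      smul_smul, sub_sub_cancel]
    have h1 : (((ε ^ k : ℤˣ) : ℤ) : ℂ) * (((ε ^ k : ℤˣ) : ℤ) : ℂ) = 1 := by
      rw [← Int.cast_mul, ← Units.val_mul, Int.units_mul_self, Units.val_one, Int.cast_one]
    have h2 : ((q ^ (k * (k - 1) / 2 * r + (1 - k) * n) : ℂˣ) : ℂ)
        * ((q ^ (k * (k - 1) / 2 * r + (1 - k) * (k * r - n)) : ℂˣ) : ℂ) = 1 := by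
      rw [← Units.val_mul, ← zpow_add, hk, zpow_zero, Units.val_one]
    conv_rhs => rw [← one_smul ℂ (QMat.mon k n A)]
    congr 1
    linear_combination (((ε ^ k : ℤˣ) : ℤ) : ℂ) ^ 2 * h2 + h1

/-- The antisymmetrization `y - σ(y)`. -/
noncomputable def antisymm (ε : ℤˣ) (r : ℤ) (y : QMat q N) : QHat q N ε r :=
  CentralExt.mk _ ⟨y - QMat.sigma ε r y, by
    change QMat.sigma ε r (y - QMat.sigma ε r y) = -(y - QMat.sigma ε r y)
    rw [map_sub, sigma_sigma, neg_sub]⟩ 0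

variable [NeZero N]

theorem phiHat_antisymm (hℓ : Complex.exp ℓ = q) (hq : ‖(q : ℂ)‖ ≠ 1) (ε : ℤˣ) (r : ℤ) (a : ℂ)
    (m : ℕ) {d : ℤ} (hd : d ≠ 0) {y : QMat q N} (hy : y ∈ qDegree q N d) :
    phiHat hℓ hq a m ε r (antisymm ε r y)
      = CentralExt.mk _ (phiMat q N ℓ a m (y - QMat.sigma ε r y)) 0 := by
  refine CentralExt.ext rfl ?_
  change phiCentre q N ℓ a m (y - QMat.sigma ε r y) + (0 : ℂ) • 1 = 0
  rw [phiCentre_eq_zero_of_mem_qDegree ℓ a m hd (sub_mem hy (sigma_mem_qDegree ε r hy)), zero_smul,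
    add_zero]

/-- The matrix of the image of `y`, after the adjustment made for the special values of `a`. -/
noncomputable def adjustedMat (ℓ : ℂ) (ε : ℤˣ) (r : ℤ) (a : ℂ) (m : ℕ) (y : QMat q N) : GlInf m :=
  BandMat.diagConj (weightAt N ℓ ε (etaOf N ε a) r a m (shiftOf N a))
    (BandMat.shift (shiftOf N a) (phiMat q N ℓ a m y))

theorem phiOne_antisymm_of_special (hℓ : Complex.exp ℓ = q) (hq : ‖(q : ℂ)‖ ≠ 1) (ε : ℤˣ) (r : ℤ)
    {a : ℂ} (ha : a = 1 ∨ a = 1 / 2) (m : ℕ) {d : ℤ} (hd : d ≠ 0) {y : QMat q N}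
    (hy : y ∈ qDegree q N d) : (phiOne hℓ hq ε r a m (antisymm ε r y) : GlHat m)
      = CentralExt.mk _ (adjustedMat ℓ ε r a m y - adjustedMat ℓ ε r a m (QMat.sigma ε r y)) 0 := by
  change adjustHat N ℓ ε r a m (phiHat hℓ hq a m ε r (antisymm ε r y)) = _
  rw [phiHat_antisymm hℓ hq ε r a m hd hy, adjustHat, if_pos ha, LieHom.comp_apply]
  refine CentralExt.ext ?_ ?_
  · change BandMat.diagConj _ (BandMat.shift _ (phiMat q N ℓ a m (y - QMat.sigma ε r y))) = _
    rw [map_sub, map_sub, map_sub]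
    rfl
  · change (0 : TruncPoly m) - ∑ p ∈ _, phiMat q N ℓ a m (y - QMat.sigma ε r y) p p = 0
    rw [zero_sub, neg_eq_zero]
    refine Finset.sum_eq_zero fun p _ => ?_
    exact phiMat_apply_eq_zero_of_mem_qDegree ℓ a m (sub_mem hy (sigma_mem_qDegree ε r hy)) p p
      (by omega)

theorem phiOne_antisymm_of_generic (hℓ : Complex.exp ℓ = q) (hq : ‖(q : ℂ)‖ ≠ 1) (ε : ℤˣ) (r : ℤ)
    {a : ℂ} (ha : ¬ (a = 1 ∨ a = 1 / 2)) (m : ℕ) {d : ℤ} (hd : d ≠ 0) {y : QMat q N}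
    (hy : y ∈ qDegree q N d) : (phiOne hℓ hq ε r a m (antisymm ε r y) : GlHat m)
      = CentralExt.mk _ (phiMat q N ℓ a m y - phiMat q N ℓ a m (QMat.sigma ε r y)) 0 := by
  change adjustHat N ℓ ε r a m (phiHat hℓ hq a m ε r (antisymm ε r y)) = _
  rw [phiHat_antisymm hℓ hq ε r a m hd hy, adjustHat, if_neg ha, map_sub]
  rfl

theorem adjustedMat_apply (ε : ℤˣ) (r : ℤ) (a : ℂ) (m : ℕ) (y : QMat q N) (p p2 : ℤ) :
    adjustedMat ℓ ε r a m y p p2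
      = (weightAt N ℓ ε (etaOf N ε a) r a m (shiftOf N a) p : TruncPoly m)
        * phiMat q N ℓ a m y (p - shiftOf N a) (p2 - shiftOf N a)
        * ((weightAt N ℓ ε (etaOf N ε a) r a m (shiftOf N a) p2)⁻¹ : (TruncPoly m)ˣ) := rfl

theorem phiOne_antisymm_mem (hℓ : Complex.exp ℓ = q) (hq : ‖(q : ℂ)‖ ≠ 1) (ε : ℤˣ) (r : ℤ)
    (a : ℂ) (m : ℕ) {d : ℤ} (hd : d ≠ 0) {y : QMat q N} (hy : y ∈ qDegree q N d) :
    phiOne hℓ hq ε r a m (antisymm ε r y) ∈ targetDegree N ε a m d := by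
  have hσ := sigma_mem_qDegree ε r hy
  rw [mem_targetDegree]
  by_cases ha : a = 1 ∨ a = 1 / 2
  · rw [phiOne_antisymm_of_special hℓ hq ε r ha m hd hy]
    refine ⟨fun i j h => ?_, fun _ => rfl⟩
    rw [CentralExt.base_mk, BandMat.sub_apply, adjustedMat_apply, adjustedMat_apply,
      phiMat_apply_eq_zero_of_mem_qDegree ℓ a m hy _ _ (by omega),
      phiMat_apply_eq_zero_of_mem_qDegree ℓ a m hσ _ _ (by omega), mul_zero, zero_mul, sub_zero]
  · rw [phiOne_antisymm_of_generic hℓ hq ε r ha m hd hy]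
    refine ⟨fun i j h => ?_, fun _ => rfl⟩
    rw [CentralExt.base_mk, BandMat.sub_apply, phiMat_apply_eq_zero_of_mem_qDegree ℓ a m hy _ _ h,
      phiMat_apply_eq_zero_of_mem_qDegree ℓ a m hσ _ _ h, sub_zero]

/-- The part of degree `d ≠ 0` of an element of the direct sum agrees at any finite set of places
with an element of degree `d` of the image. For the special values of `a` the antisymmetrization of
some `y` that is mapped to `x / 2` at these places and their mirror images does this. For the other
values `y` is mapped to `x`, and the mirror image, which involves the parameter `2 - a`, is made
zero at the relevant places. -/
theorem exists_phi_apply_eq (hℓ : Complex.exp ℓ = q) (hq : ‖(q : ℂ)‖ ≠ 1) (ε : ℤˣ) (r : ℤ) {M : ℕ}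
    {a : Fin M → ℂ} {m : Fin M → ℕ} (hdiff : ∀ i j, i ≠ j → ¬ InLattice ℓ (a i - a j))
    (hsum : ∀ i j, i ≠ j → ¬ InLattice ℓ (a i + a j))
    (hself : ∀ i, InLattice ℓ (2 * a i) → a i = 1 ∨ a i = 1 / 2) {d : ℤ} (hd : d ≠ 0)
    (x : TargetSum N ε a m) (F : Finset ℤ) :
    ∃ s : QHat q N ε r, phi hℓ hq ε r a m s ∈ sumDegree N ε a m d ∧ ∀ i, ∀ p ∈ F,
      (phi hℓ hq ε r a m s i : GlHat (m i)).base p (p + d)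
        = (x i : GlHat (m i)).base p (p + d) := by
  classical
  let G := {i : Fin M // ¬ (a i = 1 ∨ a i = 1 / 2)}
  let b : Fin M ⊕ G → ℂ := Sum.elim a fun i => 2 - a i.1
  let mm : Fin M ⊕ G → ℕ := Sum.elim m fun i => m i.1
  have hb : ∀ i j, i ≠ j → ¬ InLattice ℓ (b i - b j) := by
    have mixed : ∀ (i : Fin M) (j : G), ¬ InLattice ℓ (a i + a j.1) := by
      intro i j h
      by_cases hij : i = j.1
      · rw [hij, ← two_mul] at h
        exact j.2 (hself _ h)
      · exact hsum i j.1 hij h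
    rintro (i | i) (j | j) hij h
    · exact hdiff i j (fun h => hij (by rw [h])) h
    · refine mixed i j ?_
      have := h.add_int 2
      convert this using 1
      simp only [b, Sum.elim_inl, Sum.elim_inr]
      push_cast
      ring
    · refine mixed j i ?_
      have := h.neg.add_int 2
      convert this using 1
      simp only [b, Sum.elim_inl, Sum.elim_inr]
      push_cast
      ring
    · refine hdiff i.1 j.1 (fun h => hij (by rw [Subtype.ext h])) ?_
      have := h.neg
      convert this using 1
      simp only [b, Sum.elim_inr]
      ring
  let w : ∀ i, ℤ → (TruncPoly (m i))ˣ := fun i =>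
    weightAt N ℓ ε (etaOf N ε (a i)) r (a i) (m i) (shiftOf N (a i))
  let c : Fin M → ℤ := fun i => shiftOf N (a i)
  let Y0 : ∀ i, ℤ → TruncPoly (m i) := fun i p => if a i = 1 ∨ a i = 1 / 2 then
      (((w i (p + c i))⁻¹ : (TruncPoly (m i))ˣ) : TruncPoly (m i)) *
        ((1 / 2 : ℂ) • (x i : GlHat (m i)).base (p + c i) (p + c i + d)) * w i (p + c i + d)
    else (x i : GlHat (m i)).base p (p + d)
  let Y : ∀ i, ℤ → TruncPoly (mm i) := fun i => match i with
    | .inl i => Y0 i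
    | .inr _ => fun _ => 0
  -- The places in `F` and their mirror images for both possible axes.
  let F1 : Finset ℤ := F ∪ F.image (fun p => 0 - p - d) ∪ F.image (fun p => 1 - p - d)
  -- For the special values of `a`, the indices before the shift matter as well.
  let F2 : Finset ℤ := F1 ∪ Finset.univ.biUnion fun i => F1.image fun p => p - c i
  obtain ⟨y, hy, hyY⟩ := exists_mem_qDegree_forall_phiMat_eq (N := N) hℓ hq b mm hb d F2 Y
  refine ⟨antisymm ε r y, mem_sumDegree.2 fun i =>
    phiOne_antisymm_mem hℓ hq ε r (a i) (m i) hd hy, fun i p hp => ?_⟩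
  change (phiOne hℓ hq ε r (a i) (m i) (antisymm ε r y) : GlHat (m i)).base p (p + d) = _
  by_cases ha : a i = 1 ∨ a i = 1 / 2
  · rw [phiOne_antisymm_of_special hℓ hq ε r ha (m i) hd hy, CentralExt.base_mk, BandMat.sub_apply]
    obtain ⟨κ, e, hκ, hae, hκe, h1, h0, ht⟩ := exists_targetAlg_eq_classical N ε ha
    have hval : ∀ p ∈ F1, adjustedMat ℓ ε r (a i) (m i) y p (p + d)
        = (1 / 2 : ℂ) • (x i : GlHat (m i)).base p (p + d) := by
      intro p hp
      have h : phiMat q N ℓ (a i) (m i) y (p - c i) (p - c i + d) = Y0 i (p - c i) :=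
        hyY (Sum.inl i) (p - c i) (Finset.mem_union_right _
        (Finset.mem_biUnion.2 ⟨i, Finset.mem_univ i, Finset.mem_image_of_mem _ hp⟩))
      simp only [Y0, if_pos ha, sub_add_cancel] at h
      have h2 : p - c i + d = p + d - c i := by ring
      rw [h2] at h
      rw [adjustedMat_apply]
      have h3 : phiMat q N ℓ (a i) (m i) y (p - shiftOf N (a i)) (p + d - shiftOf N (a i)) = _ := h
      rw [h3]
      have h4 : (w i p : TruncPoly (m i)) * ((w i p)⁻¹ : (TruncPoly (m i))ˣ) = 1 := Units.mul_inv _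
      have h5 : (w i (p + d) : TruncPoly (m i)) * ((w i (p + d))⁻¹ : (TruncPoly (m i))ˣ) = 1 :=
        Units.mul_inv _
      generalize (1 / 2 : ℂ) • (x i : GlHat (m i)).base p (p + d) = X at *
      change (w i p : TruncPoly (m i)) * (((w i p)⁻¹ : (TruncPoly (m i))ˣ) * X * (w i (p + d)))
        * ((w i (p + d))⁻¹ : (TruncPoly (m i))ˣ) = X
      linear_combination X * (w i (p + d) : TruncPoly (m i)) *
        ((w i (p + d))⁻¹ : (TruncPoly (m i))ˣ) * h4 + X * h5
    have hmir := phi_mirror (N := N) hℓ ε (etaOf N ε (a i)) r (a i) (m i) (shiftOf N (a i)) κ e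
      hae hκ hκe h1 h0 y p (p + d)
    have hxi : (x i : GlHat (m i)) ∈ classical κ (etaOf N ε (a i)) (m i) := by
      rw [← ht]
      exact (x i).2
    have hxm := mem_classical.1 hxi p (p + d)
    have hκp : κ - p = κ - (p + d) + d := by ring
    have hmem : κ - (p + d) ∈ F1 := by
      rcases hκ with rfl | rfl
      · refine Finset.mem_union_left _ (Finset.mem_union_right _ (Finset.mem_image.2 ⟨p, hp, ?_⟩))
        ring
      · refine Finset.mem_union_right _ (Finset.mem_image.2 ⟨p, hp, ?_⟩)
        ring
    have hσ : adjustedMat ℓ ε r (a i) (m i) (QMat.sigma ε r y) p (p + d)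
        = (etaOf N ε (a i)) ^ (p + (p + d)) •
          negU (m i) (adjustedMat ℓ ε r (a i) (m i) y (κ - (p + d)) (κ - p)) := hmir
    rw [hσ, hκp, hval _ hmem, hval p (Finset.mem_union_left _ (Finset.mem_union_left _ hp)),
      map_smul, smul_comm, ← hκp, sub_eq_add_neg, ← smul_neg, ← hxm, ← add_smul]
    norm_num
  · rw [phiOne_antisymm_of_generic hℓ hq ε r ha (m i) hd hy, CentralExt.base_mk, BandMat.sub_apply]
    obtain ⟨g, hg⟩ := exists_phiMat_sigma_eq (N := N) hℓ ε r (a i) (m i)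
    have h1 : phiMat q N ℓ (a i) (m i) y p (p + d) = Y0 i p :=
      hyY (Sum.inl i) p (Finset.mem_union_left _ (Finset.mem_union_left _
        (Finset.mem_union_left _ hp)))
    have h2 := hyY (Sum.inr ⟨i, ha⟩) (1 - p - d) (Finset.mem_union_left _
      (Finset.mem_union_right _ (Finset.mem_image_of_mem _ hp)))
    simp only [Y0, if_neg ha] at h1
    rw [sub_add_cancel] at h2
    have h3 : phiMat q N ℓ (2 - a i) (m i) y (1 - (p + d)) (1 - p) = 0 := by
      rw [← sub_sub]
      exact h2
    rw [hg, h3, map_zero, mul_zero, sub_zero, h1]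

end Density

/-! ### Brackets of opposite degrees -/

section Diagonals

variable {K : Type*} [CommRing K] [Algebra ℂ K]

/-- The matrix `∑_l f(l) E_{l,l+k}`. -/
def BandMat.diagonal (k : ℤ) (f : ℤ → K) : BandMat K :=
  BandMat.of (fun i j => if j - i = k then f i else 0) ⟨k.natAbs, fun i j h => by
    rw [if_neg]
    rintro rfl
    rw [Int.natCast_natAbs, abs_sub_comm] at h
    exact lt_irrefl _ h⟩

theorem BandMat.diagonal_apply (k : ℤ) (f : ℤ → K) (i j : ℤ) :
    BandMat.diagonal k f i j = if j - i = k then f i else 0 := rfl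

theorem BandMat.diagonal_mul_apply (k : ℤ) (f : ℤ → K) (A : BandMat K) (i j : ℤ) :
    (BandMat.diagonal k f * A) i j = f i * A (i + k) j := by
  rw [BandMat.mul_apply_sum _ _ _ _ {i + k}, Finset.sum_singleton, BandMat.diagonal_apply,
    if_pos (by ring)]
  intro l hl
  rw [BandMat.diagonal_apply, if_neg, zero_mul]
  intro h
  exact hl (Finset.mem_singleton.2 (by linarith))

/-- The bracket of `∑_l h(l) θ(l) E_{l,l+k}` and `∑_l θ(l) E_{l+k,l}`, where `θ² = 1`. -/
theorem lie_diagonal_diagonal (k : ℕ) (h θ : ℤ → K) (hθ : ∀ l, θ l * θ l = 1) :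
    ⁅(CentralExt.mk _ (BandMat.diagonal k fun l => h l * θ l) 0 : CentralExt BandMat.cocycle),
      (CentralExt.mk _ (BandMat.diagonal (-k) fun l => θ (l - k)) 0 :
        CentralExt BandMat.cocycle)⁆
      = CentralExt.mk _ (BandMat.diagonal 0 fun l => h l - h (l - k))
        (∑ l ∈ Finset.Ioc (-k : ℤ) 0, h l) := by
  refine CentralExt.ext ?_ ?_
  · ext i j
    rw [CentralExt.base_lie, CentralExt.base_mk, CentralExt.base_mk, CentralExt.base_mk,
      BandMat.lie_def, BandMat.sub_apply, BandMat.diagonal_mul_apply, BandMat.diagonal_mul_apply,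
      BandMat.diagonal_apply, BandMat.diagonal_apply, BandMat.diagonal_apply]
    by_cases hij : j = i
    · subst hij
      rw [if_pos (by ring), if_pos (by ring), if_pos (by ring), add_sub_cancel_right,
        ← sub_eq_add_neg]
      linear_combination h j * hθ j - h (j - k) * hθ (j - k)
    · rw [if_neg (by omega), if_neg (by omega), if_neg (by omega), mul_zero, mul_zero, sub_zero]
  · have hJ : ⁅BandMat.J K, BandMat.diagonal (k : ℤ) fun l => h l * θ l⁆
        = BandMat.diagonal (k : ℤ) fun l =>
          ((if l ≤ 0 then 1 else 0) - (if l + k ≤ 0 then 1 else 0)) * (h l * θ l) := by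
      ext i j
      rw [BandMat.lie_J_apply, BandMat.diagonal_apply, BandMat.diagonal_apply]
      by_cases hij : j - i = k
      · rw [if_pos hij, if_pos hij, ← hij, add_sub_cancel]
      · rw [if_neg hij, if_neg hij, mul_zero]
    rw [CentralExt.centre_lie, CentralExt.base_mk, CentralExt.base_mk, CentralExt.centre_mk,
      BandMat.cocycle_apply, hJ, BandMat.trace,
      finsum_eq_sum_of_support_subset (s := Finset.Ioc (-k : ℤ) 0)]
    · refine Finset.sum_congr rfl fun l hl => ?_
      rw [Finset.mem_Ioc] at hl
      rw [BandMat.diagonal_mul_apply, BandMat.diagonal_apply, if_pos hl.2, if_neg (by omega),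
        if_pos (by ring), add_sub_cancel_right]
      linear_combination h l * hθ l
    · intro l hl
      by_contra hc
      refine hl ?_
      dsimp only
      rw [Finset.mem_coe, Finset.mem_Ioc] at hc
      rw [BandMat.diagonal_mul_apply]
      by_cases h0 : l ≤ 0
      · rw [if_pos h0, if_pos (by omega), sub_self, zero_mul, zero_mul]
      · rw [if_neg h0, if_neg (by omega), sub_self, zero_mul, zero_mul]

theorem mk_diagonal_mem_classical {κ : ℤ} {η : ℤˣ} {m : ℕ} {k : ℤ} {f : ℤ → TruncPoly m}
    (hf : ∀ l, f l = -(η ^ k • negU m (f (κ - k - l)))) (z : TruncPoly m) :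
    (CentralExt.mk _ (BandMat.diagonal k f) z : GlHat m) ∈ classical κ η m := by
  rw [mem_classical]
  intro i j
  rw [CentralExt.base_mk, BandMat.diagonal_apply, BandMat.diagonal_apply]
  by_cases hij : j - i = k
  · rw [if_pos hij, if_pos (by linarith), hf i, show i + j = 2 * i + k by omega, zpow_add, zpow_mul,
      zpow_ofNat, Int.units_sq, one_zpow, one_mul, show κ - j = κ - k - i by omega]
  · rw [if_neg hij, if_neg (by omega), map_zero, smul_zero, neg_zero]

/-- Every sequence indexed by `ℤ` is a sequence of differences: sum it up in both directions. -/
theorem exists_sub_shift_eq {G : Type*} [AddCommGroup G] (d : ℤ → G) :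
    ∃ h : ℤ → G, ∀ l, h l - h (l - 1) = d l := by
  refine ⟨fun l => ∑ j ∈ Finset.range l.toNat, d (j + 1) - ∑ j ∈ Finset.range (-l).toNat, d (-j),
    fun l => ?_⟩
  dsimp only
  rcases le_or_gt l 0 with hl | hl
  · obtain ⟨n, rfl⟩ : ∃ n : ℕ, l = -n := ⟨l.natAbs, by omega⟩
    rw [show (-(n : ℤ)).toNat = 0 by omega, show (-(n : ℤ) - 1).toNat = 0 by omega,
      show (- -(n : ℤ)).toNat = n by omega, show (-(-(n : ℤ) - 1)).toNat = n + 1 by omega,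
      Finset.sum_range_succ]
    simp
  · obtain ⟨n, rfl⟩ : ∃ n : ℕ, l = n + 1 := ⟨(l - 1).toNat, by omega⟩
    rw [show ((n : ℤ) + 1).toNat = n + 1 by omega, show ((n : ℤ) + 1 - 1).toNat = n by omega,
      show (-((n : ℤ) + 1)).toNat = 0 by omega, show (-((n : ℤ) + 1 - 1)).toNat = 0 by omega,
      Finset.sum_range_succ]
    simp

/-- For `l ≥ 0` the values are determined by the recursion from those at `0, …, k - 1`, which are
chosen as `d(l) / 2`; the others are given by the symmetry. -/
theorem exists_symmetric_sub_shift_eq {m : ℕ} {k : ℕ} (hk : 0 < k) {d : ℤ → TruncPoly m}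
    (hd : ∀ l, d l = -negU m (d (k - 1 - l))) :
    ∃ h : ℤ → TruncPoly m, (∀ l, h l = negU m (h (-1 - l))) ∧ ∀ l, h l - h (l - k) = d l := by
  let H : ℕ → TruncPoly m := fun n =>
    (1 / 2 : ℂ) • d ((n % k : ℕ) : ℤ) + ∑ j ∈ Finset.range (n / k), d (n - j * k : ℤ)
  have hH : ∀ n, H (n + k) - H n = d ((n + k : ℕ) : ℤ) := by
    intro n
    simp only [H]
    rw [Nat.add_mod_right, Nat.add_div_right n hk, Finset.sum_range_succ']
    have : ∀ j : ℕ, d (((n + k : ℕ) : ℤ) - ((j + 1 : ℕ) : ℤ) * k) = d (n - j * k : ℤ) := fun j => by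
      congr 1
      push_cast
      ring
    simp only [this]
    simp
  have hH0 : ∀ n, n < k → H n = (1 / 2 : ℂ) • d n := by
    intro n hn
    simp only [H]
    rw [Nat.mod_eq_of_lt hn, Nat.div_eq_of_lt hn, Finset.sum_range_zero, add_zero]
  let h : ℤ → TruncPoly m := fun l => if 0 ≤ l then H l.toNat else negU m (H (-1 - l).toNat)
  have hpos : ∀ n : ℕ, h n = H n := fun n => by simp [h]
  have hneg : ∀ n : ℕ, h (-1 - n) = negU m (H n) := fun n => by
    simp only [h]
    rw [if_neg (by omega), show -1 - (-1 - (n : ℤ)) = n by ring, Int.toNat_natCast]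
  have hsplit : ∀ l : ℤ, (∃ n : ℕ, l = n) ∨ ∃ n : ℕ, l = -1 - n := fun l => by
    rcases le_or_gt 0 l with hl | hl
    · exact Or.inl ⟨l.toNat, by omega⟩
    · exact Or.inr ⟨(-1 - l).toNat, by omega⟩
  refine ⟨h, fun l => ?_, fun l => ?_⟩
  · rcases hsplit l with ⟨n, rfl⟩ | ⟨n, rfl⟩
    · rw [hpos, hneg, negU_negU]
    · rw [hneg, show -1 - (-1 - (n : ℤ)) = n by ring, hpos]
  · rcases hsplit l with ⟨n, rfl⟩ | ⟨n, rfl⟩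
    · rcases le_or_gt k n with hn | hn
      · obtain ⟨p, rfl⟩ := Nat.exists_eq_add_of_le' hn
        rw [hpos, show ((p + k : ℕ) : ℤ) - k = p by push_cast; ring, hpos, hH]
      · obtain ⟨p, hp⟩ : ∃ p : ℕ, (k : ℤ) - 1 - n = p := ⟨k - 1 - n, by omega⟩
        rw [show (n : ℤ) - k = -1 - p by omega, hpos, hneg, hH0 n hn, hH0 p (by omega), map_smul]
        have h1 := hd n
        rw [hp] at h1
        rw [sub_eq_add_neg, ← smul_neg, ← h1, ← add_smul]
        norm_num
    · have h1 : -1 - (n : ℤ) - k = -1 - ((n + k : ℕ) : ℤ) := by push_cast; ring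
      rw [h1, hneg, hneg, ← map_sub, ← neg_sub, map_neg, hH, hd (-1 - n)]
      congr 3
      push_cast
      ring

end Diagonals

section DegreeZero

variable {N : ℕ} {ε : ℤˣ} {a : ℂ} {m : ℕ}

theorem base_eq_diagonal_of_mem_targetDegree_zero {x : targetAlg N ε a m}
    (hx : x ∈ targetDegree N ε a m 0) :
    (x : GlHat m).base = BandMat.diagonal 0 fun l => (x : GlHat m).base l l := by
  ext i j
  rw [BandMat.diagonal_apply]
  split_ifs with h
  · rw [sub_eq_zero.1 h]
  · exact (mem_targetDegree.1 hx).1 i j h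

theorem exists_lie_eq_diagonal_of_generic (ha : ¬ (a = 1 ∨ a = 1 / 2)) (h : ℤ → TruncPoly m) :
    ∃ y z : targetAlg N ε a m, (⁅y, z⁆ : targetAlg N ε a m).1
      = CentralExt.mk _ (BandMat.diagonal 0 fun l => h l - h (l - 1)) (h 0) := by
  have hmem : ∀ x : GlHat m, x ∈ targetAlg N ε a m := fun x => by
    rw [targetAlg_eq_top N ε ha]
    exact LieSubalgebra.mem_top x
  refine ⟨⟨_, hmem _⟩, ⟨_, hmem _⟩, (lie_diagonal_diagonal 1 h 1 fun l => one_mul _).trans ?_⟩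
  rw [show Finset.Ioc (-((1 : ℕ) : ℤ)) 0 = {0} from rfl, Finset.sum_singleton, Nat.cast_one]

variable [NeZero N]

/-- For `a ∈ {1, 1/2}` the reflection `i ↦ κ - i` pairs the places `l` and `-1 - l` in degree
`κ + 1`, so that no place is fixed and the entries of one half can be chosen freely. -/
theorem exists_lie_eq_diagonal_of_special (ha : a = 1 ∨ a = 1 / 2) : ∃ k : ℕ, 0 < k ∧
    (∀ x ∈ targetDegree N ε a m 0, ∀ l, (x : GlHat m).base l l
      = -negU m ((x : GlHat m).base (k - 1 - l) (k - 1 - l))) ∧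
    ∀ h : ℤ → TruncPoly m, (∀ l, h l = negU m (h (-1 - l))) → ∃ y z : targetAlg N ε a m,
      (⁅y, z⁆ : targetAlg N ε a m).1
        = CentralExt.mk _ (BandMat.diagonal 0 fun l => h l - h (l - k))
          (∑ l ∈ Finset.Ioc (-k : ℤ) 0, h l) := by
  obtain ⟨κ, e, hκ, -, -, -, -, ht⟩ := exists_targetAlg_eq_classical N ε ha
  obtain ⟨k, hk⟩ : ∃ k : ℕ, κ = k - 1 := ⟨(κ + 1).toNat, by omega⟩
  set η := etaOf N ε a
  subst hk
  refine ⟨k, by omega, fun x _ l => ?_, fun h hh => ?_⟩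
  · have hx : (x : GlHat m) ∈ classical (k - 1) η m := by
      rw [← ht]
      exact x.2
    have := mem_classical.1 hx l l
    rwa [← two_mul, zpow_mul, zpow_ofNat, Int.units_sq, one_zpow, one_smul] at this
  · -- The signs `θ` carry the factor `-η ^ k` of the symmetry, which leaves `h` even.
    let s : ℤˣ := η ^ (k : ℤ)
    let θ : ℤ → TruncPoly m := fun l => if 0 ≤ l then 1 else -(s • 1)
    have hss : ∀ z : TruncPoly m, s • s • z = z := fun z => by
      rw [smul_smul, Int.units_mul_self, one_smul]
    have hnegs : ∀ z : TruncPoly m, negU m (s • z) = s • negU m z := fun z => by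
      rw [Units.smul_def, Units.smul_def, map_zsmul]
    have hθ : ∀ l, θ l * θ l = 1 := fun l => by
      simp only [θ]
      split_ifs
      · rw [one_mul]
      · rw [neg_mul_neg, smul_mul_smul_comm, one_mul, Int.units_mul_self, one_smul]
    have hθm : ∀ l, θ l = -(s • negU m (θ (-1 - l))) := fun l => by
      simp only [θ]
      by_cases hl : 0 ≤ l
      · rw [if_pos hl, if_neg (by omega), map_neg, hnegs, map_one, smul_neg, hss, neg_neg]
      · rw [if_neg hl, if_pos (by omega), map_one]
    have hη : η ^ (-(k : ℤ)) = s := by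
      rw [zpow_neg, Int.units_inv_eq_self]
    have hy : (CentralExt.mk _ (BandMat.diagonal k fun l => h l * θ l) 0 : GlHat m)
        ∈ targetAlg N ε a m := by
      rw [ht]
      refine mk_diagonal_mem_classical (fun l => ?_) 0
      rw [show (k : ℤ) - 1 - k - l = -1 - l by ring, map_mul, ← hh, hθm l, mul_neg, mul_smul_comm]
    have hz : (CentralExt.mk _ (BandMat.diagonal (-k) fun l => θ (l - k)) 0 : GlHat m)
        ∈ targetAlg N ε a m := by
      rw [ht]
      refine mk_diagonal_mem_classical (fun l => ?_) 0
      rw [show (k : ℤ) - 1 - -k - l - k = -1 - (l - k) by ring, hη]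
      exact hθm (l - k)
    exact ⟨⟨_, hy⟩, ⟨_, hz⟩, lie_diagonal_diagonal k h θ hθ⟩

/-- Every element of degree zero is a bracket up to a central element. -/
theorem exists_eq_lie_add_targetCentre {x : targetAlg N ε a m} (hx : x ∈ targetDegree N ε a m 0) :
    ∃ (y z : targetAlg N ε a m) (w : TruncPoly m), x = ⁅y, z⁆ + targetCentre N ε a m w := by
  obtain ⟨y, z, hyz⟩ : ∃ y z : targetAlg N ε a m,
      (⁅y, z⁆ : targetAlg N ε a m).1.base = x.1.base := by
    rw [base_eq_diagonal_of_mem_targetDegree_zero hx]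
    by_cases ha : a = 1 ∨ a = 1 / 2
    · obtain ⟨k, hk, hxk, hlie⟩ := exists_lie_eq_diagonal_of_special (N := N) (ε := ε) (m := m) ha
      obtain ⟨h, hh, hd⟩ := exists_symmetric_sub_shift_eq hk (hxk x hx)
      obtain ⟨y, z, hyz⟩ := hlie h hh
      refine ⟨y, z, ?_⟩
      rw [hyz, CentralExt.base_mk]
      simp only [hd]
    · obtain ⟨h, hd⟩ := exists_sub_shift_eq fun l => (x : GlHat m).base l l
      obtain ⟨y, z, hyz⟩ := exists_lie_eq_diagonal_of_generic (N := N) (ε := ε) ha h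
      refine ⟨y, z, ?_⟩
      rw [hyz, CentralExt.base_mk]
      simp only [hd]
  refine ⟨y, z, x.1.centre - (⁅y, z⁆ : targetAlg N ε a m).1.centre,
    Subtype.ext (CentralExt.ext ?_ ?_)⟩
  · change _ = (⁅y, z⁆ : targetAlg N ε a m).1.base + 0
    rw [hyz, add_zero]
  · change _ = (⁅y, z⁆ : targetAlg N ε a m).1.centre + (x.1.centre - _)
    rw [add_sub_cancel]

theorem exists_lie_eq_targetCentre (w : TruncPoly m) (hw : a = 1 ∨ a = 1 / 2 → negU m w = w) :
    ∃ y z : targetAlg N ε a m, ⁅y, z⁆ = targetCentre N ε a m w := by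
  have hzero : ∀ (w : TruncPoly m), BandMat.diagonal 0 (fun _ => w - w) = 0 := fun w => by
    ext i j
    rw [BandMat.diagonal_apply, sub_self, ite_self]
    rfl
  by_cases ha : a = 1 ∨ a = 1 / 2
  · obtain ⟨k, hk, -, hlie⟩ := exists_lie_eq_diagonal_of_special (N := N) (ε := ε) (m := m) ha
    obtain ⟨y, z, hyz⟩ := hlie (fun _ => (k : ℂ)⁻¹ • w) fun l => by rw [map_smul, hw ha]
    refine ⟨y, z, Subtype.ext (hyz.trans ?_)⟩
    rw [hzero, Finset.sum_const, Int.card_Ioc, sub_neg_eq_add, zero_add, Int.toNat_natCast,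
      ← Nat.cast_smul_eq_nsmul ℂ, smul_smul, mul_inv_cancel₀ (by exact_mod_cast hk.ne'), one_smul]
    rfl
  · obtain ⟨y, z, hyz⟩ := exists_lie_eq_diagonal_of_generic (N := N) (ε := ε) ha fun _ => w
    refine ⟨y, z, Subtype.ext (hyz.trans ?_)⟩
    rw [hzero]
    rfl

end DegreeZero

/-! ### Invariant subspaces -/

section Invariant

variable {N : ℕ} [NeZero N] {ε : ℤˣ} {M : ℕ} {a : Fin M → ℂ} {m : Fin M → ℕ} {V : Type*}
  [AddCommGroup V] [Module ℂ V] [LieRingModule (TargetSum N ε a m) V]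

/-- In a smooth module, the action of an element of degree `d ≠ 0` on a given vector coincides with
the action of some element of the image of `φ`. -/
theorem lie_mem_of_mem_sumDegree {q : ℂˣ} {ℓ : ℂ} (hℓ : Complex.exp ℓ = q) (hq : ‖(q : ℂ)‖ ≠ 1)
    {r : ℤ} (hdiff : ∀ i j, i ≠ j → ¬ InLattice ℓ (a i - a j))
    (hsum : ∀ i j, i ≠ j → ¬ InLattice ℓ (a i + a j))
    (hself : ∀ i, InLattice ℓ (2 * a i) → a i = 1 ∨ a i = 1 / 2) (hV : IsSmooth N ε a m V)
    (W : LieSubmodule ℂ (QHat q N ε r) (Restrict (phi (N := N) hℓ hq ε r a m) V)) {d : ℤ}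
    (hd : d ≠ 0) {x : TargetSum N ε a m} (hx : x ∈ sumDegree N ε a m d) {v : V}
    (hv : v ∈ Restrict.submodule W) : ⁅x, v⁆ ∈ Restrict.submodule W := by
  obtain ⟨F, hF⟩ := hV v d hd
  obtain ⟨s, hs, hsx⟩ := exists_phi_apply_eq hℓ hq ε r hdiff hsum hself hd x F
  have h := hF (phi hℓ hq ε r a m s - x) (sub_mem hs hx) fun i l hl => sub_eq_zero.2 (hsx i l hl)
  rw [sub_lie, sub_eq_zero] at h
  rw [← h]
  exact W.lie_mem (x := s) (m := (v : Restrict (phi (N := N) hℓ hq ε r a m) V)) hv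

variable {U : Submodule ℂ V}

theorem lie_lie_mem_of_forall_sumDegree
    (hU : ∀ d ≠ 0, ∀ x ∈ sumDegree N ε a m d, ∀ v ∈ U, ⁅x, v⁆ ∈ U) (x y : TargetSum N ε a m) {v : V}
    (hv : v ∈ U) : ⁅⁅x, y⁆, v⁆ ∈ U := by
  have hx : x ∈ ⨆ d, sumDegree N ε a m d := by rw [iSup_sumDegree]; trivial
  have hy : y ∈ ⨆ d, sumDegree N ε a m d := by rw [iSup_sumDegree]; trivial
  induction hx using Submodule.iSup_induction' with
  | zero => rw [zero_lie, zero_lie]; exact zero_mem _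
  | add x x2 _ _ h h2 => rw [add_lie, add_lie]; exact add_mem h h2
  | mem d x hx =>
    induction hy using Submodule.iSup_induction' with
    | zero => rw [lie_zero, zero_lie]; exact zero_mem _
    | add y y2 _ _ h h2 => rw [lie_add, add_lie]; exact add_mem h h2
    | mem e y hy =>
      by_cases hde : d + e = 0
      · by_cases hd : d = 0
        · obtain rfl : e = 0 := by omega
          subst hd
          rw [lie_eq_zero_of_mem_sumDegree_zero hx hy, zero_lie]
          exact zero_mem _
        · rw [lie_lie]
          exact sub_mem (hU d hd x hx _ (hU e (by omega) y hy v hv))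
            (hU e (by omega) y hy _ (hU d hd x hx v hv))
      · exact hU _ hde _ (lie_mem_sumDegree hx hy) v hv

theorem lie_single_single {ι : Type*} [DecidableEq ι] {L : ι → Type*} [∀ i, LieRing (L i)] (i : ι)
    (y z : L i) : ⁅(Pi.single i y : ∀ i, L i), (Pi.single i z : ∀ i, L i)⁆
      = Pi.single i ⁅y, z⁆ := by
  funext j
  rw [pi_lie_apply]
  by_cases h : j = i
  · subst h
    rw [Pi.single_eq_same, Pi.single_eq_same, Pi.single_eq_same]
  · rw [Pi.single_eq_of_ne h, Pi.single_eq_of_ne h, Pi.single_eq_of_ne h, lie_self]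

/-- `z ↦` the element `z` of the centre, as a linear map. -/
noncomputable def targetCentreₗ (N : ℕ) (ε : ℤˣ) (a : ℂ) (m : ℕ) :
    TruncPoly m →ₗ[ℂ] targetAlg N ε a m where
  toFun := targetCentre N ε a m
  map_add' z w := by
    refine Subtype.ext (CentralExt.ext ?_ rfl)
    exact (add_zero (0 : GlInf m)).symm
  map_smul' t z := by
    refine Subtype.ext (CentralExt.ext ?_ ?_)
    · change (0 : GlInf m) = t • (0 : GlInf m)
      rw [smul_zero]
    · change t • z = t • z
      rfl

/-- `z ↦` the element `z` of the centre of the `i`-th summand. -/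
noncomputable def centreAt (N : ℕ) (ε : ℤˣ) (a : Fin M → ℂ) (m : Fin M → ℕ) (i : Fin M) :
    TruncPoly (m i) →ₗ[ℂ] TargetSum N ε a m :=
  (LinearMap.single ℂ (fun i => targetAlg N ε (a i) (m i)) i).comp
    (targetCentreₗ N ε (a i) (m i))

variable [LieModule ℂ (TargetSum N ε a m) V]

/-- The degree zero part is reached by brackets and central elements. Even powers of `u` in the
centre of a summand with `a ∈ {1, 1/2}`, and all powers of `u` in the centre of the other summands,
are brackets. -/
theorem lie_mem_of_forall_sumDegree
    (hU : ∀ d ≠ 0, ∀ x ∈ sumDegree N ε a m d, ∀ v ∈ U, ⁅x, v⁆ ∈ U)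
    (hc : ∀ i, (a i = 1 ∨ a i = 1 / 2) → ∀ j : ℕ, Odd j → ∀ v ∈ U,
      ⁅(Pi.single i (targetCentre N ε (a i) (m i) (uu (m i) ^ j)) : TargetSum N ε a m), v⁆ ∈ U)
    (x : TargetSum N ε a m) {v : V} (hv : v ∈ U) : ⁅x, v⁆ ∈ U := by
  have hbr : ∀ i (y z : targetAlg N ε (a i) (m i)),
      ⁅(Pi.single i ⁅y, z⁆ : TargetSum N ε a m), v⁆ ∈ U := fun i y z => by
    rw [← lie_single_single]
    exact lie_lie_mem_of_forall_sumDegree hU _ _ hv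
  have hcentre : ∀ i (w : TruncPoly (m i)), ⁅centreAt N ε a m i w, v⁆ ∈ U := by
    intro i w
    have hpow : ∀ j : ℕ, ⁅centreAt N ε a m i (uu (m i) ^ j), v⁆ ∈ U := by
      intro j
      by_cases hj : (a i = 1 ∨ a i = 1 / 2) ∧ Odd j
      · exact hc i hj.1 j hj.2 v hv
      · obtain ⟨y, z, hyz⟩ := exists_lie_eq_targetCentre (N := N) (ε := ε) (a := a i)
          (uu (m i) ^ j) fun ha => by
            have hj := Nat.not_odd_iff_even.1 fun h => hj ⟨ha, h⟩
            rw [map_pow, negU_uu, hj.neg_pow]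
        have := hbr i y z
        rw [hyz] at this
        exact this
    induction w using AdjoinRoot.induction_on with
    | ih f =>
      have hf : AdjoinRoot.mk _ f = ∑ j ∈ f.support, f.coeff j • uu (m i) ^ j := by
        rw [uu, ← AdjoinRoot.aeval_eq, Polynomial.aeval_eq_sum_range]
        refine (Finset.sum_subset (Finset.subset_iff.2 fun n hn => Finset.mem_range_succ_iff.2
          (Polynomial.le_natDegree_of_mem_supp n hn)) fun n _ hn => ?_).symm
        rw [Polynomial.notMem_support_iff.1 hn, zero_smul]
      rw [hf, map_sum, _root_.sum_lie]
      refine Submodule.sum_mem _ fun j _ => ?_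
      rw [map_smul, smul_lie]
      exact U.smul_mem _ (hpow j)
  have hx : x ∈ ⨆ d, sumDegree N ε a m d := by rw [iSup_sumDegree]; trivial
  induction hx using Submodule.iSup_induction' with
  | zero => rw [zero_lie]; exact zero_mem _
  | add x x2 _ _ h h2 => rw [add_lie]; exact add_mem h h2
  | mem d x hx =>
    by_cases hd : d = 0
    · subst hd
      rw [← Finset.univ_sum_single x, _root_.sum_lie]
      refine Submodule.sum_mem _ fun i _ => ?_
      obtain ⟨y, z, w, hyzw⟩ := exists_eq_lie_add_targetCentre (mem_sumDegree.1 hx i)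
      rw [hyzw, Pi.single_add, add_lie]
      exact add_mem (hbr i y z) (hcentre i w)
    · exact hU d hd x hx v hv

end Invariant

/-! ### Irreducibility of tensor products -/

section TensorModule

theorem isIrreducibleSet_range_toEnd {L V : Type*} [LieRing L] [LieAlgebra ℂ L] [AddCommGroup V]
    [Module ℂ V] [LieRingModule L V] [LieModule ℂ L V] (h : LieModule.IsIrreducible ℂ L V) :
    IsIrreducibleSet (Set.range (LieModule.toEnd ℂ L V)) := by
  intro W hW
  let W2 : LieSubmodule ℂ L V :=
    { W with lie_mem := fun {x v} hv => hW ⟨x, rfl⟩ v hv }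
  rcases eq_bot_or_eq_top W2 with h2 | h2
  · exact Or.inl (congrArg LieSubmodule.toSubmodule h2)
  · exact Or.inr (congrArg LieSubmodule.toSubmodule h2)

theorem nontrivial_piTensorProduct {ι : Type*} [Fintype ι] {V : ι → Type*}
    [∀ i, AddCommGroup (V i)] [∀ i, Module ℂ (V i)] [∀ i, Nontrivial (V i)] :
    Nontrivial (PiTensorProduct ℂ V) := by
  let b := Basis.piTensorProduct fun i => Module.Basis.ofVectorSpace ℂ (V i)
  exact ⟨⟨b fun i => (Module.Basis.ofVectorSpace ℂ (V i)).index_nonempty.some, 0, b.ne_zero _⟩⟩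

variable {N : ℕ} {ε : ℤˣ} {M : ℕ} {a : Fin M → ℂ} {m : Fin M → ℕ}
  {V : Fin M → Type*} [∀ i, AddCommGroup (V i)] [∀ i, Module ℂ (V i)]
  [∀ i, LieRingModule (targetAlg N ε (a i) (m i)) (V i)]
  [∀ i, LieModule ℂ (targetAlg N ε (a i) (m i)) (V i)]

theorem single_lie_piTensorProduct (i : Fin M) (x : targetAlg N ε (a i) (m i))
    (v : PiTensorProduct ℂ V) : ⁅(Pi.single i x : TargetSum N ε a m), v⁆
      = tensorAt V i (LieModule.toEnd ℂ _ (V i) x) v := by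
  change tensorAction V (Pi.single i x : TargetSum N ε a m) v = _
  simp only [tensorAction, LinearMap.coe_mk, AddHom.coe_mk, LinearMap.sum_apply]
  rw [Finset.sum_eq_single i]
  · rw [Pi.single_eq_same]
  · intro j _ hj
    rw [Pi.single_eq_of_ne hj, map_zero, map_zero, LinearMap.zero_apply]
  · simp

theorem targetCentre_lie {a : ℂ} {m : ℕ} (z : TruncPoly m) (x : targetAlg N ε a m) :
    ⁅targetCentre N ε a m z, x⁆ = 0 := by
  refine Subtype.ext (CentralExt.ext ?_ ?_)
  · change ⁅(0 : GlInf m), (x : GlHat m).base⁆ = 0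
    rw [zero_lie]
  · change BandMat.cocycle.toBilin (0 : GlInf m) _ = 0
    rw [map_zero, LinearMap.zero_apply]

/-- By Schur's lemma the centre acts on the tensor product by scalars. -/
theorem centre_lie_mem_piTensorProduct
    (hirr : ∀ i, LieModule.IsIrreducible ℂ (targetAlg N ε (a i) (m i)) (V i))
    (hrank : ∀ i, Module.rank ℂ (V i) ≤ Cardinal.aleph0) {U : Submodule ℂ (PiTensorProduct ℂ V)}
    (i : Fin M) (z : TruncPoly (m i)) {v : PiTensorProduct ℂ V} (hv : v ∈ U) :
    ⁅(Pi.single i (targetCentre N ε (a i) (m i) z) : TargetSum N ε a m), v⁆ ∈ U := by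
  obtain ⟨c, hc⟩ := (isIrreducibleSet_range_toEnd (hirr i)).exists_eq_algebraMap (hrank i)
    (T := LieModule.toEnd ℂ _ (V i) (targetCentre N ε (a i) (m i) z)) (by
      rintro _ ⟨x, rfl⟩
      have h := toEnd_lie_eq (W := V i) (targetCentre N ε (a i) (m i) z) x
      rw [targetCentre_lie, map_zero, eq_comm, sub_eq_zero] at h
      exact h.symm)
  rw [single_lie_piTensorProduct, hc]
  exact tensorAt_mem_of_mem_adjoin (S := ∅) (by simp)
    (Subalgebra.algebraMap_mem (Algebra.adjoin ℂ ∅) c) v hv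

end TensorModule

end QPDO

theorem mainTheorem3 (q : ℂˣ) (ℓ : ℂ) (hℓ : Complex.exp ℓ = q) (hq : ‖(q : ℂ)‖ ≠ 1)
    (N : ℕ) [NeZero N] (ε : ℤˣ) (r : ℤ) (M : ℕ) (a : Fin M → ℂ) (m : Fin M → ℕ)
    (hint : ∀ i, (∃ b : ℤ, a i = b) → a i = 1)
    (hhalf : ∀ i, (∃ b : ℤ, a i = b + 1 / 2) → a i = 1 / 2)
    (hdiff : ∀ i j, i ≠ j → ¬ InLattice ℓ (a i - a j))
    (hsum : ∀ i j, i ≠ j → ¬ InLattice ℓ (a i + a j))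
    (hself : ∀ i, InLattice ℓ (2 * a i) → a i = 1 ∨ a i = 1 / 2) :
    (∀ (V : Type*) [AddCommGroup V] [Module ℂ V] [LieRingModule (TargetSum N ε a m) V]
        [LieModule ℂ (TargetSum N ε a m) V], IsQuasifinite (sumDegree N ε a m) V →
      ∀ W : LieSubmodule ℂ (QHat q N ε r) (Restrict (phi (N := N) hℓ hq ε r a m) V),
        (∀ x y : TargetSum N ε a m, ∀ v ∈ Restrict.submodule W,
          ⁅⁅x, y⁆, v⁆ ∈ Restrict.submodule W) ∧
        ((∀ i, (a i = 1 ∨ a i = 1 / 2) → ∀ j : ℕ, Odd j → ∀ v ∈ Restrict.submodule W,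
            ⁅(Pi.single i (targetCentre N ε (a i) (m i) (uu (m i) ^ j)) : TargetSum N ε a m), v⁆
              ∈ Restrict.submodule W) →
          ∃ W' : LieSubmodule ℂ (TargetSum N ε a m) V,
            W'.toSubmodule = Restrict.submodule W)) ∧
    (∀ (V : Fin M → Type*) [∀ i, AddCommGroup (V i)] [∀ i, Module ℂ (V i)]
        [∀ i, LieRingModule (targetAlg N ε (a i) (m i)) (V i)]
        [∀ i, LieModule ℂ (targetAlg N ε (a i) (m i)) (V i)]
        (wt : ∀ i, Module.Dual ℂ (targetDegree N ε (a i) (m i) 0)),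
      (∀ i, IsIrreducibleHighestWeight (targetDegree N ε (a i) (m i)) (V i) (wt i)) →
      (∀ i, IsQuasifinite (targetDegree N ε (a i) (m i)) (V i)) →
      LieModule.IsIrreducible ℂ (QHat q N ε r)
        (Restrict (phi (N := N) hℓ hq ε r a m) (PiTensorProduct ℂ V))) := by
  refine ⟨?_, ?_⟩
  · intro V _ _ _ _ hV W
    have hU : ∀ d ≠ 0, ∀ x ∈ sumDegree N ε a m d, ∀ v ∈ Restrict.submodule W,
        ⁅x, v⁆ ∈ Restrict.submodule W := fun d hd x hx v hv =>
      lie_mem_of_mem_sumDegree hℓ hq hdiff hsum hself hV.isSmooth W hd hx hv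
    refine ⟨fun x y v hv => lie_lie_mem_of_forall_sumDegree hU x y hv, fun hc => ?_⟩
    exact ⟨{ Restrict.submodule W with
      lie_mem := fun {x v} hv => lie_mem_of_forall_sumDegree hU hc x hv }, rfl⟩
  · intro V _ _ _ _ wt hwt hV
    have hirr := fun i => (hwt i).1
    have hrank := fun i => (hV i).rank_le_aleph0
    have hnt : ∀ i, Nontrivial (V i) := fun i =>
      LieModule.nontrivial_of_isIrreducible ℂ (targetAlg N ε (a i) (m i)) (V i)
    have hnt2 : Nontrivial (Restrict (phi (N := N) hℓ hq ε r a m) (PiTensorProduct ℂ V)) :=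
      nontrivial_piTensorProduct
    refine LieModule.IsIrreducible.mk fun W hW => ?_
    have hU : ∀ x : TargetSum N ε a m, ∀ v ∈ Restrict.submodule W, ⁅x, v⁆ ∈ Restrict.submodule W :=
      fun x v hv => lie_mem_of_forall_sumDegree
        (fun d hd x hx v hv => lie_mem_of_mem_sumDegree hℓ hq hdiff hsum hself
          (isSmooth_piTensorProduct hV) W hd hx hv)
        (fun i _ j _ v hv => centre_lie_mem_piTensorProduct hirr hrank i _ hv) x hv
    rcases eq_bot_or_eq_top_of_tensorAt_mem (fun i => isIrreducibleSet_range_toEnd (hirr i)) hrank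
      (W := Restrict.submodule W) (by
        rintro i _ ⟨x, rfl⟩ v hv
        rw [← single_lie_piTensorProduct]
        exact hU _ v hv) with h | h
    · exact absurd (LieSubmodule.toSubmodule_injective h) hW
    · exact LieSubmodule.toSubmodule_injective h
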